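/- Let $0<\alpha<1/3$ and $0<\beta<\big(\tfrac{2}{3(1-\alpha)}\big)^2$. In $\mathbb R^2$ let $p_1=(0,0)$, $p_2=(\tfrac12,\tfrac{\sqrt3}{2})$, $p_3=(1,0)$, $p_4=\tfrac{p_2+p_3}{2}$, $p_5=\tfrac{p_1+p_3}{2}$, $p_6=\tfrac{p_1+p_2}{2}$, and let $G_i(x)=A_i(x-p_i)+p_i$ $(1\le i\le 6)$ with $A_1=A_2=A_3=\tfrac{1-\alpha}{2}I_2$, $A_4=\tfrac{\alpha}{4}\begin{pmatrix}1&-\sqrt3\\-\sqrt3&3\end{pmatrix}$, $A_5=\alpha\begin{pmatrix}1&0\\0&0\end{pmatrix}$, $A_6=\tfrac{\alpha}{4}\begin{pmatrix}1&\sqrt3\\\sqrt3&3\end{pmatrix}$. The Hanoi attractor $K_\alpha$ is the unique nonempty compact set with $K_\alpha=\bigcup_{i=1}^6G_i(K_\alpha)$; let $F_\alpha$ be the unique nonempty compact set with $F_\alpha=\bigcup_{i=1}^3G_i(F_\alpha)$. For a word $w=w_1\cdots w_n\in\{1,2,3\}^n$ let $G_w=G_{w_1}\circ\cdots\circ G_{w_n}$,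 and for $\{i,j,k\}=\{1,2,3\}$ let $e_i$ be the open segment joining $G_j(p_k)$ and $G_k(p_j)$. For $k\ge1$ the wires of level $k$ are the segments $G_w(e_i)$ with $|w|=k-1$ and $i\in\{1,2,3\}$; they have length $d_k=\alpha(\tfrac{1-\alpha}{2})^{k-1}$. A wire $e$ with endpoints $a_e,b_e$ is parametrized by $\varphi_e(t)=a_e+t(b_e-a_e)$, $t\in[0,1]$. Let $J_\alpha$ be the union of all wires. Put $\rho^d_n=\prod_{i=1}^n\frac{3}{5+3d_i}$, $\rho^c_n=\rho^d_{n-1}\frac{3d_n}{5+3d_n}$ and $$\mathcal E_n(u,v)=\frac1{\rho^d_n}\sum_{|w|=n}\ \sum_{1\le i<j\le 3}\big(u(G_wp_i)-u(G_wp_j)\big)\big(v(G_wp_i)-v(G_wp_j)\big)+\sum_{k=1}^n\frac1{\rho^c_k}\sum_{e\text{ of level }k}\int_0^1(u\circ\varphi_e)'(v\circ\varphi_e)'\,dt .$$ Let $\mathcal D$ be the set of continuous $u\colon K_\alpha\to\mathbb R$ such that $u\circ\varphi_e\in H^1(0,1)$ for all wires $e$ and $\lim_n\mathcal E_n(u,u)$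 exists and is finite. Let $\mathcal D^0=\{u\in\mathcal D: u(p_1)=u(p_2)=u(p_3)=0\}$, and let $\mathcal E(u,v)=\lim_n\mathcal E_n(u,v)$. Let $\mu_{\alpha,\beta}$ be the probability measure on $K_\alpha$ given by $$\mu_{\alpha,\beta}(A)=\frac{\mathcal H^{\delta}(A\cap F_\alpha)}{2\mathcal H^{\delta}(F_\alpha)}+\frac{\nu(A)}{2\nu(J_\alpha)},\qquad \delta=\frac{\ln3}{\ln2-\ln(1-\alpha)},\qquad \nu(A)=\sum_{k\ge1}\ \sum_{e\text{ of level }k}\beta^{k-1}\mathcal H^1(A\cap e).$$ Then there is a unique densely defined, non-negative self-adjoint operator $-\Delta^N_{\mu_{\alpha,\beta}}$ on the real space $L^2(K_\alpha,\mu_{\alpha,\beta})$ whose domain is contained in $\mathcal D$ and which satisfies $\mathcal E(u,v)=(-\Delta^N_{\mu_{\alpha,\beta}}u,v)_{L^2}$ for all $u$ in its domain and all $v\in\mathcal D$ (the Neumann Laplacian). There is likewise a unique such operator $-\Delta^D_{\mu_{\alpha,\beta}}$ with $\mathcal D^0$ in place of $\mathcal D$ (the Dirichlet Laplacian). Each of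 the two operators has pure point spectrum: its spectrum equals its set of eigenvalues, and its eigenvectors span a dense subspace of $L^2(K_\alpha,\mu_{\alpha,\beta})$. The eigenvalues form a countably infinite set of non-negative numbers, each of finite multiplicity, and their only accumulation point is $+\infty$ (that is, only finitely many of them lie below any real bound). -/

import Mathlib

open MeasureTheory Filter Topology Set
open scoped NNReal ENNReal

/-! ## Attractors of iterated function systems -/

/-- The attractor of a family of maps: the union of all compact invariant sets.  For a finite
nonempty family of contractions of a complete metric space it is the unique nonempty compact
invariant set (`attractor_spec`, `attractor_unique`). -/
def attractor {X ι : Type*} [TopologicalSpace X] (f : ι → X → X) : Set X :=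
  ⋃₀ {S : Set X | IsCompact S ∧ S = ⋃ i, f i '' S}

section Attractor

theorem hausdorffEDist_iUnion_image_le {X ι : Type*} [MetricSpace X] {f : ι → X → X} {c : ℝ≥0}
    (hf : ∀ i, LipschitzWith c (f i)) {S T : Set X} (hS : IsCompact S) (hT : IsCompact T)
    (hS' : S.Nonempty) (hT' : T.Nonempty) :
    Metric.hausdorffEDist (⋃ i, f i '' S) (⋃ i, f i '' T) ≤ c * Metric.hausdorffEDist S T := by
  have key : ∀ S T : Set X, IsCompact T → T.Nonempty → ∀ x ∈ ⋃ i, f i '' S,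
      ∃ y ∈ ⋃ i, f i '' T, edist x y ≤ c * Metric.hausdorffEDist S T := by
    intro S T hT hT' x hx
    obtain ⟨i, s, hs, rfl⟩ := mem_iUnion.1 hx
    obtain ⟨t, ht, hst⟩ := hT.exists_infEDist_eq_edist hT' s
    refine ⟨f i t, mem_iUnion.2 ⟨i, t, ht, rfl⟩, (hf i s t).trans ?_⟩
    gcongr
    rw [← hst]
    exact Metric.infEDist_le_hausdorffEDist_of_mem hs
  refine Metric.hausdorffEDist_le_of_mem_edist (key S T hT hT') ?_
  rw [Metric.hausdorffEDist_comm]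
  exact key T S hS hS'

theorem attractor_unique {X ι : Type*} [MetricSpace X] {f : ι → X → X} {c : ℝ≥0} (hc : c < 1)
    (hf : ∀ i, LipschitzWith c (f i)) {S T : Set X} (hS : IsCompact S) (hS' : S.Nonempty)
    (hSf : S = ⋃ i, f i '' S) (hT : IsCompact T) (hT' : T.Nonempty) (hTf : T = ⋃ i, f i '' T) :
    S = T := by
  have h := hausdorffEDist_iUnion_image_le hf hS hT hS' hT'
  rw [← hSf, ← hTf] at h
  have hfin : Metric.hausdorffEDist S T ≠ ⊤ :=
    Metric.hausdorffEDist_ne_top_of_nonempty_of_bounded hS' hT' hS.isBounded hT.isBounded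
  rw [← hS.isClosed.hausdorffEDist_zero_iff hT.isClosed]
  by_contra h0
  have h1 : (c : ℝ≥0∞) * Metric.hausdorffEDist S T < 1 * Metric.hausdorffEDist S T :=
    ENNReal.mul_lt_mul_left h0 hfin (by exact_mod_cast hc)
  rw [one_mul] at h1
  exact absurd h (not_le.2 h1)

theorem attractor_spec {X ι : Type*} [MetricSpace X] [CompleteSpace X] [Nonempty X] [Finite ι]
    [Nonempty ι] {f : ι → X → X} {c : ℝ≥0} (hc : c < 1) (hf : ∀ i, LipschitzWith c (f i)) :
    IsCompact (attractor f) ∧ (attractor f).Nonempty ∧ attractor f = ⋃ i, f i '' attractor f := by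
  let Φ : TopologicalSpace.NonemptyCompacts X → TopologicalSpace.NonemptyCompacts X := fun S =>
    ⟨⟨⋃ i, f i '' S, isCompact_iUnion fun i => S.isCompact.image (hf i).continuous⟩, by
      obtain ⟨x, hx⟩ := S.nonempty
      obtain ⟨i⟩ := ‹Nonempty ι›
      exact ⟨f i x, mem_iUnion.2 ⟨i, x, hx, rfl⟩⟩⟩
  have hΦ : ContractingWith c Φ := ⟨hc, fun S T =>
    hausdorffEDist_iUnion_image_le hf S.isCompact T.isCompact S.nonempty T.nonempty⟩
  obtain ⟨x0⟩ := ‹Nonempty X›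
  have : Nonempty (TopologicalSpace.NonemptyCompacts X) := ⟨{x0}⟩
  let K := ContractingWith.fixedPoint Φ hΦ
  have hK : (K : Set X) = ⋃ i, f i '' (K : Set X) :=
    congrArg (fun S : TopologicalSpace.NonemptyCompacts X => (S : Set X))
      (hΦ.fixedPoint_isFixedPt).symm
  have hKa : attractor f = K := by
    refine Subset.antisymm (sUnion_subset ?_) (subset_sUnion_of_mem ⟨K.isCompact, hK⟩)
    rintro S ⟨hS, hSf⟩
    rcases S.eq_empty_or_nonempty with rfl | hS'
    · exact empty_subset _
    · exact (attractor_unique hc hf hS hS' hSf K.isCompact K.nonempty hK).subset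
  rw [hKa]
  exact ⟨K.isCompact, K.nonempty, hK⟩

end Attractor

/-! ## The Hanoi attractor -/

/-- The Euclidean plane. -/
abbrev Plane : Type := EuclideanSpace ℝ (Fin 2)

/-- The points `p₁, …, p₆` (with indices shifted to `0, …, 5`). -/
noncomputable def hanoiPoint : Fin 6 → Plane :=
  ![!₂[0, 0], !₂[1 / 2, √3 / 2], !₂[1, 0], !₂[3 / 4, √3 / 4], !₂[1 / 2, 0], !₂[1 / 4, √3 / 4]]

/-- The linear parts `A₁, …, A₆` of the six contractions. -/
noncomputable def hanoiMatrix (α : ℝ) : Fin 6 → Matrix (Fin 2) (Fin 2) ℝ :=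
  ![((1 - α) / 2) • 1, ((1 - α) / 2) • 1, ((1 - α) / 2) • 1,
    (α / 4) • !![1, -√3; -√3, 3], α • !![1, 0; 0, 0], (α / 4) • !![1, √3; √3, 3]]

/-- The six contractions `G_i x = A_i (x - p_i) + p_i`. -/
noncomputable def hanoiMap (α : ℝ) (i : Fin 6) (x : Plane) : Plane :=
  Matrix.toEuclideanLin (hanoiMatrix α i) (x - hanoiPoint i) + hanoiPoint i

/-- The vertices `p₁, p₂, p₃` of the triangle. -/
noncomputable def corner (i : Fin 3) : Plane := hanoiPoint (i.castLE (by norm_num))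

/-- The three similitudes `G₁, G₂, G₃`. -/
noncomputable def cornerMap (α : ℝ) (i : Fin 3) : Plane → Plane :=
  hanoiMap α (i.castLE (by norm_num))

/-- The Hanoi attractor `K`. -/
def hanoiAttractor (α : ℝ) : Set Plane := attractor (hanoiMap α)

/-- The fractal dust `F`, the attractor of the three similitudes. -/
def hanoiDust (α : ℝ) : Set Plane := attractor (cornerMap α)

theorem hanoiMap_lipschitz {α : ℝ} (h0 : 0 < α) (h1 : α < 1 / 3) (i : Fin 6) :
    LipschitzWith (Real.toNNReal ((1 - α) / 2)) (hanoiMap α i) := by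
  refine LipschitzWith.of_dist_le_mul fun x y => ?_
  rw [Real.coe_toNNReal _ (by linarith), dist_eq_norm, dist_eq_norm]
  have hxy : hanoiMap α i x - hanoiMap α i y
      = Matrix.toEuclideanLin (hanoiMatrix α i) (x - y) := by
    simp only [hanoiMap, map_sub]; abel
  rw [hxy]
  generalize x - y = v
  have h3 : √3 ^ 2 = 3 := Real.sq_sqrt (by norm_num)
  have hα : α ^ 2 ≤ ((1 - α) / 2) ^ 2 := by nlinarith
  refine le_of_sq_le_sq ?_ (by have := norm_nonneg v; nlinarith)
  rw [mul_pow, EuclideanSpace.real_norm_sq_eq, EuclideanSpace.real_norm_sq_eq]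
  fin_cases i <;>
    simp [hanoiMatrix, Matrix.toLpLin_apply, Fin.sum_univ_two, dotProduct]
  · nlinarith
  · nlinarith
  · nlinarith
  · generalize v.ofLp 0 = a at *
    generalize v.ofLp 1 = b at *
    have e : α ^ 2 * (a ^ 2 + b ^ 2) - ((α / 4 * a + -(α / 4 * √3 * b)) ^ 2 +
        (-(α / 4 * √3 * a) + α / 4 * 3 * b) ^ 2) = (α / 2 * (√3 * a + b)) ^ 2 := by
      linear_combination (-(5 * α ^ 2 / 16) * a ^ 2 - α ^ 2 / 16 * b ^ 2) * h3
    nlinarith [mul_le_mul_of_nonneg_right hα (add_nonneg (sq_nonneg a) (sq_nonneg b)),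
      sq_nonneg (α / 2 * (√3 * a + b))]
  · nlinarith [mul_le_mul_of_nonneg_right hα (sq_nonneg (v 0)),
      mul_nonneg (sq_nonneg ((1 - α) / 2)) (sq_nonneg (v 1))]
  · generalize v.ofLp 0 = a at *
    generalize v.ofLp 1 = b at *
    have e : α ^ 2 * (a ^ 2 + b ^ 2) - ((α / 4 * a + α / 4 * √3 * b) ^ 2 +
        (α / 4 * √3 * a + α / 4 * 3 * b) ^ 2) = (α / 2 * (√3 * a - b)) ^ 2 := by
      linear_combination (-(5 * α ^ 2 / 16) * a ^ 2 - α ^ 2 / 16 * b ^ 2) * h3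
    nlinarith [mul_le_mul_of_nonneg_right hα (add_nonneg (sq_nonneg a) (sq_nonneg b)),
      sq_nonneg (α / 2 * (√3 * a - b))]

/-- `K` is the unique nonempty compact set with `K = G₁ K ∪ … ∪ G₆ K`. -/
theorem hanoiAttractor_spec {α : ℝ} (h0 : 0 < α) (h1 : α < 1 / 3) :
    (IsCompact (hanoiAttractor α) ∧ (hanoiAttractor α).Nonempty ∧
      hanoiAttractor α = ⋃ i, hanoiMap α i '' hanoiAttractor α) ∧
    ∀ S : Set Plane, IsCompact S → S.Nonempty → S = ⋃ i, hanoiMap α i '' S →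
      S = hanoiAttractor α := by
  have hc : Real.toNNReal ((1 - α) / 2) < 1 := by
    rw [Real.toNNReal_lt_one]; linarith
  have h := attractor_spec hc (hanoiMap_lipschitz h0 h1)
  exact ⟨h, fun S hS hS' hSf =>
    attractor_unique hc (hanoiMap_lipschitz h0 h1) hS hS' hSf h.1 h.2.1 h.2.2⟩

/-- `F` is the unique nonempty compact set with `F = G₁ F ∪ G₂ F ∪ G₃ F`. -/
theorem hanoiDust_spec {α : ℝ} (h0 : 0 < α) (h1 : α < 1 / 3) :
    (IsCompact (hanoiDust α) ∧ (hanoiDust α).Nonempty ∧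
      hanoiDust α = ⋃ i, cornerMap α i '' hanoiDust α) ∧
    ∀ S : Set Plane, IsCompact S → S.Nonempty → S = ⋃ i, cornerMap α i '' S →
      S = hanoiDust α := by
  have hc : Real.toNNReal ((1 - α) / 2) < 1 := by
    rw [Real.toNNReal_lt_one]; linarith
  have hl : ∀ i, LipschitzWith (Real.toNNReal ((1 - α) / 2)) (cornerMap α i) :=
    fun i => hanoiMap_lipschitz h0 h1 _
  have h := attractor_spec hc hl
  exact ⟨h, fun S hS hS' hSf => attractor_unique hc hl hS hS' hSf h.1 h.2.1 h.2.2⟩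

/-! ## Cells and wires -/

/-- `G_w = G_{w₁} ∘ ⋯ ∘ G_{wₙ}` for a word `w` of length `n` in three letters. -/
noncomputable def wordMap (α : ℝ) : (n : ℕ) → (Fin n → Fin 3) → Plane → Plane
  | 0, _ => id
  | n + 1, w => cornerMap α (w 0) ∘ wordMap α n (Fin.tail w)

/-- The wires: `⟨k, w, i⟩`, with `w` a word of length `k`, stands for the open segment `G_w(e_i)`.
The wires with first component `k` are those that appear at level `k + 1`. -/
abbrev Wire : Type := Σ k : ℕ, (Fin k → Fin 3) × Fin 3

/-- First endpoint of `G_w(e_i)`; with `{i, j, k} = {1, 2, 3}`, the segment `e_i` joins `G_j(p_k)`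
and `G_k(p_j)` (here `j = i + 1`, `k = i + 2` modulo 3). -/
noncomputable def Wire.left (α : ℝ) (e : Wire) : Plane :=
  wordMap α e.1 e.2.1 (cornerMap α (e.2.2 + 1) (corner (e.2.2 + 2)))

/-- Second endpoint of `G_w(e_i)`. -/
noncomputable def Wire.right (α : ℝ) (e : Wire) : Plane :=
  wordMap α e.1 e.2.1 (cornerMap α (e.2.2 + 2) (corner (e.2.2 + 1)))

/-- The wire as an open segment. -/
noncomputable def Wire.segment (α : ℝ) (e : Wire) : Set Plane :=
  openSegment ℝ (e.left α) (e.right α)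

/-- The parametrization `φ_e(t) = a_e + t (b_e - a_e)`. -/
noncomputable def Wire.param (α : ℝ) (e : Wire) (t : ℝ) : Plane :=
  AffineMap.lineMap (e.left α) (e.right α) t

/-- The union `J` of all wires. -/
noncomputable def hanoiWires (α : ℝ) : Set Plane := ⋃ e : Wire, e.segment α

/-! ## Energy -/

/-- `d_{k+1}`, the length of the wires that appear at level `k + 1`. -/
noncomputable def wireLength (α : ℝ) (k : ℕ) : ℝ := α * ((1 - α) / 2) ^ k

/-- `ρ^d_n = ∏_{i=1}^n 3 / (5 + 3 d_i)`. -/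
noncomputable def rhoD (α : ℝ) (n : ℕ) : ℝ := ∏ i ∈ Finset.range n, 3 / (5 + 3 * wireLength α i)

/-- `ρ^c_{k+1} = ρ^d_k * 3 d_{k+1} / (5 + 3 d_{k+1})`. -/
noncomputable def rhoC (α : ℝ) (k : ℕ) : ℝ :=
  rhoD α k * (3 * wireLength α k / (5 + 3 * wireLength α k))

/-- Discrete energy at level `n`: the sum over all pairs of `n`-neighbours, each unordered pair
`{G_w(p_i), G_w(p_{i+1})}` counted once. -/
noncomputable def discreteEnergy (α : ℝ) (n : ℕ) (u v : Plane → ℝ) : ℝ :=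
  ∑ w : Fin n → Fin 3, ∑ i : Fin 3,
    (u (wordMap α n w (corner i)) - u (wordMap α n w (corner (i + 1)))) *
      (v (wordMap α n w (corner i)) - v (wordMap α n w (corner (i + 1))))

/-- Energy of the wires that appear at level `k + 1`. -/
noncomputable def wireEnergy (α : ℝ) (k : ℕ) (u v : Plane → ℝ) : ℝ :=
  ∑ e : (Fin k → Fin 3) × Fin 3, ∫ t in (0 : ℝ)..1,
    deriv (u ∘ Wire.param α ⟨k, e⟩) t * deriv (v ∘ Wire.param α ⟨k, e⟩) t

/-- The renormalized bilinear form `ℰ_n(u, v)`. -/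
noncomputable def energyAt (α : ℝ) (n : ℕ) (u v : Plane → ℝ) : ℝ :=
  (rhoD α n)⁻¹ * discreteEnergy α n u v +
    ∑ k ∈ Finset.range n, (rhoC α k)⁻¹ * wireEnergy α k u v

/-- `H¹(0, 1)` (continuous representatives on `[0, 1]`): absolutely continuous functions with
square integrable derivative. -/
def IsH1 (f : ℝ → ℝ) : Prop :=
  AbsolutelyContinuousOnInterval f 0 1 ∧
    IntegrableOn (fun t => deriv f t ^ 2) (Icc 0 1) volume

open Classical in
/-- Extension by zero of a function on `K` to the plane, so that it can be evaluated at vertices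
and along wires (all of which lie in `K`). -/
noncomputable def extendZero (α : ℝ) (u : C(hanoiAttractor α, ℝ)) (x : Plane) : ℝ :=
  if h : x ∈ hanoiAttractor α then u ⟨x, h⟩ else 0

/-- The domain `𝒟` of the energy form: continuous functions on `K`, of class `H¹` on every wire,
whose energies `ℰ_n[u]` converge to a finite limit. -/
def neumannDomain (α : ℝ) : Set C(hanoiAttractor α, ℝ) :=
  {u | (∀ e : Wire, IsH1 (extendZero α u ∘ e.param α)) ∧
    ∃ L : ℝ, Tendsto (fun n => energyAt α n (extendZero α u) (extendZero α u)) atTop (𝓝 L)}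

/-- The functions of the energy domain that vanish at `p₁, p₂, p₃`. -/
def dirichletDomain (α : ℝ) : Set C(hanoiAttractor α, ℝ) :=
  {u | u ∈ neumannDomain α ∧ ∀ i, extendZero α u (corner i) = 0}

/-- `ℰ(u, v) = c`, where `ℰ(u, v) = lim ℰ_n(u, v)`. -/
def HasEnergy (α : ℝ) (u v : C(hanoiAttractor α, ℝ)) (c : ℝ) : Prop :=
  Tendsto (fun n => energyAt α n (extendZero α u) (extendZero α v)) atTop (𝓝 c)

/-! ## The measure -/

/-- The Hausdorff dimension `δ = log 3 / (log 2 - log (1 - α))`. -/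
noncomputable def hanoiDim (α : ℝ) : ℝ := Real.log 3 / (Real.log 2 - Real.log (1 - α))

/-- The measure `μ^d`: normalized Hausdorff measure on `F`, of mass `1/2`. -/
noncomputable def dustMeasure (α : ℝ) : Measure Plane :=
  (2 * (Measure.hausdorffMeasure (hanoiDim α) : Measure Plane) (hanoiDust α))⁻¹ •
    (Measure.hausdorffMeasure (hanoiDim α)).restrict (hanoiDust α)

/-- The measure `∑_e β_e λ(· ∩ e)`, with `λ` the one-dimensional Hausdorff measure and
`β_e = β ^ k` for the wires that appear at level `k + 1`. -/
noncomputable def rawWireMeasure (α β : ℝ) : Measure Plane :=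
  Measure.sum fun e : Wire =>
    ENNReal.ofReal (β ^ e.1) • (Measure.hausdorffMeasure 1).restrict (e.segment α)

/-- The measure `μ^c`, of mass `1/2`. -/
noncomputable def wireMeasure (α β : ℝ) : Measure Plane :=
  (2 * rawWireMeasure α β (hanoiWires α))⁻¹ • rawWireMeasure α β

/-- The measure `μ` on the plane. -/
noncomputable def planeMeasure (α β : ℝ) : Measure Plane :=
  (dustMeasure α).restrict (hanoiDust α) + (wireMeasure α β).restrict (hanoiWires α)

/-- The measure `μ` on `K`. -/
noncomputable def hanoiMeasure (α β : ℝ) : Measure (hanoiAttractor α) :=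
  (planeMeasure α β).comap Subtype.val

/-- The real Hilbert space `L²(K, μ)`. -/
abbrev HanoiL2 (α β : ℝ) : Type := Lp ℝ 2 (hanoiMeasure α β)

/-! ## Laplacians and their spectra -/

/-- `T = -Δ` for the form `(ℰ, 𝒟)` with domain `𝒟 = D` on `L²(K, μ)`: a non-negative, densely
defined self-adjoint operator whose domain is contained in `𝒟`, with `ℰ(u, v) = (T u, v)` for all
`u` in the domain of `T` and all `v ∈ 𝒟`. -/
structure IsNegLaplacian (α β : ℝ) (D : Set C(hanoiAttractor α, ℝ))
    (T : HanoiL2 α β →ₗ.[ℝ] HanoiL2 α β) : Prop where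
  dense_domain : Dense (T.domain : Set (HanoiL2 α β))
  selfAdjoint : IsSelfAdjoint T
  nonneg : ∀ f : T.domain, 0 ≤ inner ℝ (T f) (f : HanoiL2 α β)
  form_eq : ∀ f : T.domain, ∃ u ∈ D, (⇑(f : HanoiL2 α β) =ᵐ[hanoiMeasure α β] u) ∧
    ∀ v ∈ D, HasEnergy α u v (∫ x, T f x * v x ∂hanoiMeasure α β)

section Spectrum

variable {H : Type*} [NormedAddCommGroup H] [InnerProductSpace ℝ H]

/-- The spectrum of an unbounded operator: the `κ` for which `T - κ`, defined on the domain of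
`T`, has no bounded everywhere defined inverse. -/
def opSpectrum (T : H →ₗ.[ℝ] H) : Set ℝ :=
  {κ | ¬ ∃ R : H →L[ℝ] H,
    (∀ g : H, ∃ f : T.domain, (f : H) = R g ∧ T f - κ • (f : H) = g) ∧
    ∀ f : T.domain, R (T f - κ • (f : H)) = f}

/-- The eigenspace of an unbounded operator. -/
def opEigenspace (T : H →ₗ.[ℝ] H) (κ : ℝ) : Submodule ℝ H :=
  (LinearMap.ker (T.toFun - κ • T.domain.subtype)).map T.domain.subtype

/-- The set of eigenvalues of an unbounded operator. -/
def opEigenvalues (T : H →ₗ.[ℝ] H) : Set ℝ := {κ | opEigenspace T κ ≠ ⊥}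

/-- Pure point spectrum, consisting of countably (infinitely) many non-negative eigenvalues of
finite multiplicity that accumulate only at `+∞`. -/
structure HasDiscreteSpectrum (T : H →ₗ.[ℝ] H) : Prop where
  /-- The spectrum consists of eigenvalues. -/
  spectrum_eq : opSpectrum T = opEigenvalues T
  /-- The eigenvectors span a dense subspace. -/
  pure_point : (⨆ κ : ℝ, opEigenspace T κ).topologicalClosure = ⊤
  countable : (opEigenvalues T).Countable
  infinite : (opEigenvalues T).Infinite
  nonneg : ∀ κ ∈ opEigenvalues T, 0 ≤ κ
  finite_multiplicity : ∀ κ ∈ opEigenvalues T, FiniteDimensional ℝ (opEigenspace T κ)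
  /-- No finite accumulation point: only finitely many eigenvalues lie below any bound. -/
  finite_below : ∀ r : ℝ, {κ ∈ opEigenvalues T | κ ≤ r}.Finite

end Spectrum

/-! The energy ℰ is a closed form whose domain embeds densely and compactly in L²(K, μ). Everything
then follows from the operator theory of such forms (`exists_operator_of_form`). With the inner
product ℰ + (·,·) the domain is a Hilbert space V with compact embedding j, and R = j j* is compact,
injective, symmetric and satisfies ‖Rx‖² ≤ (Rx, x). The Laplacian is R⁻¹ − 1, and κ ↦ 1/(1 + κ)
translates the spectral theory of R into the discrete spectrum claimed. Any operator satisfying the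
form identity is a restriction of R⁻¹ − 1, and a self-adjoint operator has no proper self-adjoint
restriction, hence uniqueness.

The analytic input is that ℰ_n(u, u) increases with n (`energyAt_mono`). Replacing a triangle by
three smaller triangles joined by wires never lowers the renormalized energy of given corner values
(`network_trace_le`), and on a wire Cauchy–Schwarz compares the integral with the squared difference
at the ends. So ℰ dominates each level. Since ρ^d_n decays geometrically, a function of energy M
oscillates by at most a multiple of √M (4/5)^n on a cell of level n (`abs_sub_cell_le`). This gives
equicontinuity, hence relative compactness by Arzelà–Ascoli, and a bound of the supremum norm by
energy plus L² norm (`exists_norm_sq_le`). With completeness of H¹(0, 1) on each wire, the form is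
closed (`mem_neumannSubmodule_of_tendsto`).

Density comes from Lipschitz functions that are constant on the cells of some level. They separate
points, and the domain is stable under absolute values, so the lattice form of Stone–Weierstrass
applies. For 𝒟⁰ one truncates small values and uses that the corners are null sets. The measure
enters through being finite, charging every nonempty open set (the wires are dense in K) and having
no atoms at the corners. -/

/-! ### Self-adjoint operators of the form R⁻¹ − 1. -/

section FormOperator

variable {H : Type*} [NormedAddCommGroup H] [InnerProductSpace ℝ H]

/-- The operator `R⁻¹ - 1`, with domain the range of the injective operator `R`. -/
noncomputable def resolventOp (R : H →L[ℝ] H) (hR : Function.Injective R) : H →ₗ.[ℝ] H where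
  domain := LinearMap.range (R : H →ₗ[ℝ] H)
  toFun := (LinearEquiv.ofInjective (R : H →ₗ[ℝ] H) hR).symm.toLinearMap -
    (LinearMap.range (R : H →ₗ[ℝ] H)).subtype

theorem resolventOp_apply {R : H →L[ℝ] H} (hR : Function.Injective R) (h : H)
    (f : (resolventOp R hR).domain) (hf : (f : H) = R h) : resolventOp R hR f = h - R h := by
  obtain rfl : f = LinearEquiv.ofInjective (R : H →ₗ[ℝ] H) hR h := Subtype.ext hf
  change (LinearEquiv.ofInjective (R : H →ₗ[ℝ] H) hR).symm _ - _ = _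
  rw [LinearEquiv.symm_apply_apply]
  rfl

theorem mem_resolventOp_domain {R : H →L[ℝ] H} (hR : Function.Injective R) (h : H) :
    R h ∈ (resolventOp R hR).domain := ⟨h, rfl⟩

/-- The orthogonal complement of the range of a symmetric operator is its kernel, which is trivial
here. -/
theorem dense_resolventOp_domain [CompleteSpace H] {R : H →L[ℝ] H} (hR : Function.Injective R)
    (hs : ∀ x y, inner ℝ (R x) y = inner ℝ x (R y)) :
    Dense ((resolventOp R hR).domain : Set H) := by
  rw [Submodule.dense_iff_topologicalClosure_eq_top,
    Submodule.topologicalClosure_eq_top_iff, Submodule.eq_bot_iff]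
  intro x hx
  apply hR
  rw [map_zero, ← inner_self_eq_zero (𝕜 := ℝ), hs]
  exact (Submodule.mem_orthogonal' _ _).1 hx _ (mem_resolventOp_domain hR _)

theorem isSelfAdjoint_resolventOp [CompleteSpace H] {R : H →L[ℝ] H} (hR : Function.Injective R)
    (hs : ∀ x y, inner ℝ (R x) y = inner ℝ x (R y)) : IsSelfAdjoint (resolventOp R hR) := by
  have hd := dense_resolventOp_domain hR hs
  have hform : (resolventOp R hR).IsFormalAdjoint (resolventOp R hR) := by
    rintro ⟨_, x, rfl⟩ ⟨_, y, rfl⟩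
    rw [resolventOp_apply hR x _ rfl, resolventOp_apply hR y _ rfl]
    simp only [ContinuousLinearMap.coe_coe, inner_sub_left, map_sub, inner_sub_right, hs]
  rw [LinearPMap.isSelfAdjoint_def]
  have hle := hform.le_adjoint hd
  refine (LinearPMap.eq_of_le_of_domain_eq hle (le_antisymm hle.1 fun y hy => ?_)).symm
  · have h1 := LinearPMap.adjoint_isFormalAdjoint hd ⟨y, hy⟩
    set g := (resolventOp R hR).adjoint ⟨y, hy⟩
    -- The adjoint relation ⟨g, Rz⟩ = ⟨y, z − Rz⟩ for all z, with R symmetric, gives R(g + y) = y.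
    refine ⟨g + y, ?_⟩
    refine ext_inner_right ℝ fun z => ?_
    have h2 := h1 ⟨R z, mem_resolventOp_domain hR z⟩
    rw [resolventOp_apply hR z _ rfl] at h2
    simp only [inner_sub_right] at h2
    rw [ContinuousLinearMap.coe_coe, hs, inner_add_left]
    linarith

theorem mem_opEigenspace {T : H →ₗ.[ℝ] H} {κ : ℝ} {x : H} :
    x ∈ opEigenspace T κ ↔ ∃ f : T.domain, (f : H) = x ∧ T f = κ • x := by
  simp only [opEigenspace, Submodule.mem_map, LinearMap.mem_ker, LinearMap.sub_apply,
    LinearMap.smul_apply, sub_eq_zero]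
  constructor
  · rintro ⟨f, h1, rfl⟩
    exact ⟨f, rfl, h1⟩
  · rintro ⟨f, rfl, h1⟩
    exact ⟨f, h1, rfl⟩

/-- Apply R to (R⁻¹ − 1)x = κx. Written without division, the relation also covers κ = −1, where it
forces x = 0. -/
theorem mem_opEigenspace_resolventOp {R : H →L[ℝ] H} (hR : Function.Injective R) {κ : ℝ} {x : H} :
    x ∈ opEigenspace (resolventOp R hR) κ ↔ (1 + κ) • R x = x := by
  rw [mem_opEigenspace]
  constructor
  · rintro ⟨⟨_, h, rfl⟩, rfl, h1⟩
    rw [resolventOp_apply hR h _ rfl, sub_eq_iff_eq_add] at h1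
    simp only [ContinuousLinearMap.coe_coe] at h1 ⊢
    rw [← map_smul, add_smul, one_smul, add_comm, ← h1]
  · intro h
    have hx : x = R ((1 + κ) • x) := by rw [map_smul, h]
    refine ⟨⟨x, _, hx.symm⟩, rfl, ?_⟩
    rw [resolventOp_apply hR _ _ hx, ← hx, add_smul, one_smul, add_sub_cancel_left]

theorem opEigenspace_resolventOp {R : H →L[ℝ] H} (hR : Function.Injective R) {κ : ℝ}
    (hκ : 1 + κ ≠ 0) : opEigenspace (resolventOp R hR) κ =
      Module.End.eigenspace (R : H →ₗ[ℝ] H) (1 + κ)⁻¹ := by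
  ext x
  rw [mem_opEigenspace_resolventOp, Module.End.mem_eigenspace_iff, ContinuousLinearMap.coe_coe,
    eq_inv_smul_iff₀ hκ]

end FormOperator

/-! ### Discrete spectrum from compactness of R. -/

section Discrete

variable {H : Type*} [NormedAddCommGroup H] [InnerProductSpace ℝ H]

/-- A compact self-adjoint operator has only finitely many eigenvalues away from zero. -/
theorem finite_eigenvalues_ge {R : H →L[ℝ] H} (hc : IsCompactOperator R)
    (hs : ∀ x y, inner ℝ (R x) y = inner ℝ x (R y)) {c : ℝ} (h0 : 0 < c) :
    {m : ℝ | c ≤ m ∧ Module.End.eigenspace (R : H →ₗ[ℝ] H) m ≠ ⊥}.Finite := by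
  by_contra hinf
  have hinf : Set.Infinite _ := hinf
  set f := hinf.natEmbedding
  have hv : ∀ n, ∃ v : H, ‖v‖ = 1 ∧ R v = (f n : ℝ) • v := by
    intro n
    obtain ⟨v, hv, hv0⟩ := Submodule.exists_mem_ne_zero_of_ne_bot (f n).2.2
    refine ⟨‖v‖⁻¹ • v, by simp [norm_smul, hv0], ?_⟩
    rw [Module.End.mem_eigenspace_iff, ContinuousLinearMap.coe_coe] at hv
    rw [map_smul, hv, smul_comm]
  choose v hv1 hv2 using hv
  have horth : ∀ m n, m ≠ n → inner ℝ (v m) (v n) = 0 := by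
    intro m n hmn
    have h := hs (v m) (v n)
    rw [hv2, hv2, inner_smul_left, inner_smul_right] at h
    have hne : (f m : ℝ) ≠ f n := fun h => hmn (f.injective (Subtype.ext h))
    have : ((f m : ℝ) - f n) * inner ℝ (v m) (v n) = 0 := by
      rw [sub_mul]; simpa [sub_eq_zero] using h
    exact (mul_eq_zero.1 this).resolve_left (sub_ne_zero.2 hne)
  obtain ⟨K, hK, hK'⟩ := hc.image_closedBall_subset_compact (𝕜₁ := ℝ) (f := (R : H →ₗ[ℝ] H)) 1
  obtain ⟨y, -, φ, hφ, hy⟩ := hK.tendsto_subseq fun n => hK' ⟨v n, by simp [hv1], rfl⟩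
  have hcau := Metric.cauchySeq_iff'.1 hy.cauchySeq c h0
  obtain ⟨N, hN⟩ := hcau
  have h1 := hN (N + 1) (Nat.le_succ N)
  have hne : φ (N + 1) ≠ φ N := fun h => by simpa using hφ.injective h
  simp only [Function.comp, ContinuousLinearMap.coe_coe, hv2, dist_eq_norm] at h1
  -- By Pythagoras, images of distinct orthonormal eigenvectors are at distance at least c, which a
  -- convergent subsequence forbids.
  have h2 : ‖(f (φ (N + 1)) : ℝ) • v (φ (N + 1)) - (f (φ N) : ℝ) • v (φ N)‖ ^ 2 =
      (f (φ (N + 1)) : ℝ) ^ 2 + (f (φ N) : ℝ) ^ 2 := by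
    rw [norm_sub_sq_real, inner_smul_left, inner_smul_right, horth _ _ hne, norm_smul, norm_smul,
      hv1, hv1]
    simp
  have h3 : c ≤ (f (φ (N + 1)) : ℝ) := (f (φ (N + 1))).2.1
  nlinarith [norm_nonneg ((f (φ (N + 1)) : ℝ) • v (φ (N + 1)) - (f (φ N) : ℝ) • v (φ N)),
    sq_nonneg (f (φ N) : ℝ)]

/-- For x = (1 + κ)Rx the bound reads ‖Rx‖² ≤ (1 + κ)‖Rx‖², with Rx ≠ 0. -/
theorem opEigenvalues_nonneg {R : H →L[ℝ] H} (hR : Function.Injective R)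
    (hp : ∀ x, ‖R x‖ ^ 2 ≤ inner ℝ (R x) x) {κ : ℝ}
    (h : κ ∈ opEigenvalues (resolventOp R hR)) : 0 ≤ κ := by
  obtain ⟨x, hx, hx0⟩ := Submodule.exists_mem_ne_zero_of_ne_bot h
  rw [mem_opEigenspace_resolventOp] at hx
  have h1 := hp x
  have h2 : inner ℝ (R x) x = (1 + κ) * ‖R x‖ ^ 2 := by
    nth_rw 2 [← hx]
    rw [real_inner_smul_right, real_inner_self_eq_norm_sq]
  have h3 : 0 < ‖R x‖ := norm_pos_iff.2 fun h => hx0 (hR (by simpa using h))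
  nlinarith [pow_pos h3 2]

/-- Eigenvalues of a compact symmetric operator accumulate only at 0; under κ ↦ 1/(1 + κ) this
becomes accumulation only at +∞. -/
theorem resolventOp_hasDiscreteSpectrum [CompleteSpace H] (hH : ¬ FiniteDimensional ℝ H) {R : H →L[ℝ] H}
    (hR : Function.Injective R) (hc : IsCompactOperator R)
    (hs : ∀ x y, inner ℝ (R x) y = inner ℝ x (R y)) (hp : ∀ x, ‖R x‖ ^ 2 ≤ inner ℝ (R x) x) :
    HasDiscreteSpectrum (resolventOp R hR) := by
  have hnn : ∀ κ ∈ opEigenvalues (resolventOp R hR), 0 ≤ κ := fun κ h =>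
    opEigenvalues_nonneg hR hp h
  have hfm : ∀ κ ∈ opEigenvalues (resolventOp R hR),
      FiniteDimensional ℝ (opEigenspace (resolventOp R hR) κ) := fun κ h => by
    have h1 : 1 + κ ≠ 0 := by linarith [hnn κ h]
    rw [opEigenspace_resolventOp hR h1]
    exact ContinuousLinearMap.finite_dimensional_eigenspace hc _ (inv_ne_zero h1)
  have hfb : ∀ r : ℝ, {κ ∈ opEigenvalues (resolventOp R hR) | κ ≤ r}.Finite := by
    intro r
    rcases lt_or_ge r 0 with hr | hr
    · refine Set.Finite.subset Set.finite_empty fun κ hκ => ?_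
      linarith [hnn κ hκ.1, hκ.2]
    · refine Set.Finite.of_finite_image (f := fun κ : ℝ => (1 + κ)⁻¹)
        ((finite_eigenvalues_ge hc hs (c := (1 + r)⁻¹) (by positivity)).subset ?_) ?_
      · rintro _ ⟨κ, ⟨hκ, hκr⟩, rfl⟩
        have h0 := hnn κ hκ
        refine ⟨inv_anti₀ (by positivity) (by linarith), ?_⟩
        rw [← opEigenspace_resolventOp hR (by positivity : 1 + κ ≠ 0)]
        exact hκ
      · intro x _ y _ hxy
        simpa using hxy
  have hdense : (⨆ κ : ℝ, opEigenspace (resolventOp R hR) κ).topologicalClosure = ⊤ := by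
    rw [Submodule.topologicalClosure_eq_top_iff, ← le_bot_iff,
      ← ContinuousLinearMap.orthogonalComplement_iSup_eigenspaces_eq_bot hc hs]
    refine Submodule.orthogonal_le (iSup_le fun m => ?_)
    -- The value m = 0 corresponds to no κ, but it is not an eigenvalue since R is injective.
    rcases eq_or_ne m 0 with rfl | hm
    · intro x hx
      rw [Module.End.mem_eigenspace_iff, zero_smul] at hx
      rw [hR (hx.trans (map_zero R).symm)]
      exact zero_mem _
    · have h1 : 1 + (m⁻¹ - 1) ≠ 0 := by simpa using hm
      refine le_trans (le_of_eq ?_) (le_iSup _ (m⁻¹ - 1))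
      rw [opEigenspace_resolventOp hR h1]
      simp
  refine ⟨?_, hdense, ?_, ?_, hnn, hfm, hfb⟩
  · ext κ
    by_cases hκ : κ ∈ opEigenvalues (resolventOp R hR)
    · refine iff_of_true ?_ hκ
      rintro ⟨S, -, hS⟩
      obtain ⟨x, hx, hx0⟩ := Submodule.exists_mem_ne_zero_of_ne_bot hκ
      obtain ⟨f, rfl, hf⟩ := mem_opEigenspace.1 hx
      apply hx0
      rw [← hS f, hf, sub_self, map_zero]
    · refine iff_of_false (not_not.2 ?_) hκ
      -- On its domain, T − κ = (1 − (1 + κ)R) R⁻¹, so inverting the bounded factor gives the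
      -- resolvent R(1 − (1 + κ)R)⁻¹. The Fredholm alternative makes the factor bijective off the
      -- eigenvalues.
      have hbij : Function.Bijective (1 - (1 + κ) • R : H →L[ℝ] H) := by
        rcases eq_or_ne (1 + κ) 0 with h0 | h0
        · rw [h0, zero_smul, sub_zero]
          exact Function.bijective_id
        · rcases hc.hasEigenvalue_or_mem_resolventSet (inv_ne_zero h0) with h | h
          · refine absurd ?_ hκ
            change opEigenspace _ _ ≠ ⊥
            rw [opEigenspace_resolventOp hR h0]
            exact h
          · rw [spectrum.mem_resolventSet_iff, ContinuousLinearMap.isUnit_iff_bijective] at h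
            have h2 : ⇑(1 - (1 + κ) • R : H →L[ℝ] H) = (fun x => (1 + κ) • x) ∘
                ⇑(algebraMap ℝ (H →L[ℝ] H) (1 + κ)⁻¹ - R) := by
              ext x
              simp [Algebra.algebraMap_eq_smul_one, smul_sub, smul_smul, h0]
            rw [h2]
            exact (MulAction.bijective₀ h0).comp h
      let e := ContinuousLinearEquiv.ofBijective (1 - (1 + κ) • R : H →L[ℝ] H)
        (LinearMap.ker_eq_bot.2 hbij.1) (LinearMap.range_eq_top.2 hbij.2)
      have he : ∀ x, e x = x - (1 + κ) • R x := fun x => rfl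
      refine ⟨R ∘L e.symm, fun g => ⟨⟨R (e.symm g), mem_resolventOp_domain hR _⟩, rfl, ?_⟩, ?_⟩
      · rw [resolventOp_apply hR (e.symm g) _ rfl]
        conv_rhs => rw [← e.apply_symm_apply g, he]
        simp only [add_smul, one_smul]
        abel
      · rintro ⟨_, h, rfl⟩
        rw [resolventOp_apply hR h _ rfl]
        simp only [ContinuousLinearMap.coe_coe, ContinuousLinearMap.comp_apply,
          ContinuousLinearEquiv.coe_coe]
        congr 1
        rw [ContinuousLinearEquiv.symm_apply_eq, he, add_smul, one_smul]
        abel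
  · have : opEigenvalues (resolventOp R hR) =
        ⋃ n : ℕ, {κ ∈ opEigenvalues (resolventOp R hR) | κ ≤ n} := by
      ext κ
      simp only [mem_iUnion, mem_ofPred_eq]
      exact ⟨fun h => (exists_nat_ge κ).imp fun n hn => ⟨h, hn⟩, fun ⟨_, h, _⟩ => h⟩
    rw [this]
    exact countable_iUnion fun n => (hfb n).countable
  -- Finitely many finite-dimensional eigenspaces span a finite-dimensional, hence closed, subspace;
  -- being dense it would be all of H.
  · intro hfin
    apply hH
    have h1 : (⨆ κ : ℝ, opEigenspace (resolventOp R hR) κ) =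
        ⨆ κ : opEigenvalues (resolventOp R hR), opEigenspace (resolventOp R hR) κ :=
      (iSup_ne_bot_subtype _).symm
    have := hfin.to_subtype
    have := fun κ : opEigenvalues (resolventOp R hR) => hfm κ κ.2
    have h2 : FiniteDimensional ℝ (⨆ κ : ℝ, opEigenspace (resolventOp R hR) κ : Submodule ℝ H) := by
      rw [h1]; infer_instance
    rw [Submodule.topologicalClosure_eq_self] at hdense
    rw [hdense] at h2
    exact Module.Finite.of_surjective (Submodule.subtype ⊤) fun x => ⟨⟨x, trivial⟩, rfl⟩

end Discrete

/-! ### The operator of a closed form with compact dense embedding. -/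

section Form

variable {H : Type*} [NormedAddCommGroup H] [InnerProductSpace ℝ H] [CompleteSpace H]

/-- The operator associated with a compactly and densely embedded Hilbert space `V`. -/
theorem exists_operator_of_compact_embedding {V : Type*} [NormedAddCommGroup V]
    [InnerProductSpace ℝ V] [CompleteSpace V] (j : V →L[ℝ] H) (hinj : Function.Injective j)
    (hdense : DenseRange j) (hcpt : IsCompactOperator j) (hle : ∀ u, ‖j u‖ ≤ ‖u‖)
    (hH : ¬ FiniteDimensional ℝ H) :
    ∃ T : H →ₗ.[ℝ] H, Dense (T.domain : Set H) ∧ IsSelfAdjoint T ∧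
      (∀ f : T.domain, 0 ≤ inner ℝ (T f) (f : H)) ∧
      (∀ f : T.domain, ∃ u, j u = f ∧ ∀ v, inner ℝ u v = inner ℝ (T f + f) (j v)) ∧
      HasDiscreteSpectrum T ∧
      ∀ T' : H →ₗ.[ℝ] H, IsSelfAdjoint T' →
        (∀ f : T'.domain, ∃ u, j u = f ∧ ∀ v, inner ℝ u v = inner ℝ (T' f + f) (j v)) →
        T' = T := by
  -- S x is the Riesz representative in V of v ↦ ⟨x, j v⟩, that is, the weak solution u of ⟨u, v⟩ =
  -- ⟨x, j v⟩ for all v.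
  let S := ContinuousLinearMap.adjoint j
  have hS : ∀ x v, inner ℝ (S x) v = inner ℝ x (j v) := fun x v =>
    ContinuousLinearMap.adjoint_inner_left j v x
  have hSinj : Function.Injective S := by
    refine (injective_iff_map_eq_zero S).2 fun x hx => ?_
    refine hdense.eq_zero_of_inner_left ℝ fun v => ?_
    rw [← hS, hx, inner_zero_left]
  let R : H →L[ℝ] H := j ∘L S
  have hR : Function.Injective R := hinj.comp hSinj
  have hRc : IsCompactOperator R := hcpt.comp_clm S
  have hRS : ∀ x y, inner ℝ x (R y) = inner ℝ (S x) (S y) := fun x y => (hS x (S y)).symm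
  have hs : ∀ x y, inner ℝ (R x) y = inner ℝ x (R y) := fun x y => by
    rw [real_inner_comm, hRS, hRS, real_inner_comm]
  have hp : ∀ x, ‖R x‖ ^ 2 ≤ inner ℝ (R x) x := fun x => by
    rw [hs, hRS, real_inner_self_eq_norm_sq]
    exact pow_le_pow_left₀ (norm_nonneg _) (hle (S x)) 2
  have hform : ∀ f : (resolventOp R hR).domain, ∃ u, j u = f ∧
      ∀ v, inner ℝ u v = inner ℝ (resolventOp R hR f + f) (j v) := by
    intro f
    obtain ⟨h, hh⟩ := f.2
    have hh : (f : H) = R h := hh.symm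
    refine ⟨S h, hh.symm, fun v => ?_⟩
    rw [resolventOp_apply hR h _ hh, hh, sub_add_cancel, hS]
  have hd := dense_resolventOp_domain hR hs
  have hsa := isSelfAdjoint_resolventOp hR hs
  refine ⟨resolventOp R hR, hd, hsa, ?_, hform, resolventOp_hasDiscreteSpectrum hH hR hRc hs hp, ?_⟩
  · intro f
    obtain ⟨h, hh⟩ := f.2
    have hh : (f : H) = R h := hh.symm
    rw [resolventOp_apply hR h _ hh, hh, inner_sub_left,
      real_inner_self_eq_norm_sq, real_inner_comm]
    linarith [hp h]
  · intro T' hT' hform'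
    -- The form identity identifies u as S(T'f + f), so R(T'f + f) = f and T' is a restriction of T.
    -- Taking adjoints reverses the inclusion.
    have hle' : T' ≤ resolventOp R hR := by
      have key : ∀ f : T'.domain, R (T' f + f) = f := fun f => by
        obtain ⟨u, hu, huv⟩ := hform' f
        have : u = S (T' f + f) := ext_inner_right ℝ fun v => by rw [huv, hS]
        rw [this] at hu
        exact hu
      refine ⟨fun x hx => ⟨_, key ⟨x, hx⟩⟩, fun x y hxy => ?_⟩
      rw [resolventOp_apply hR (T' x + x) y (by rw [key, hxy]), key, add_sub_cancel_right]
    have hfa : T'.IsFormalAdjoint (resolventOp R hR) := fun x y => by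
      have h1 := LinearPMap.adjoint_isFormalAdjoint hd
      rw [LinearPMap.isSelfAdjoint_def.1 hsa] at h1
      rw [LinearPMap.apply_comp_inclusion hle' x]
      exact h1 (Submodule.inclusion hle'.1 x) y
    have hge := hfa.le_adjoint hT'.dense_domain
    rw [LinearPMap.isSelfAdjoint_def.1 hT'] at hge
    exact le_antisymm hle' hge

/-- The operator associated with a closed non-negative symmetric form `E` whose domain `D` is
compactly and densely embedded by `ι`. -/
theorem exists_operator_of_form {D : Type*} [AddCommGroup D] [Module ℝ D] (ι : D →ₗ[ℝ] H)
    (E : LinearMap.BilinForm ℝ D) (hsymm : ∀ u v, E u v = E v u) (hnn : ∀ u, 0 ≤ E u u)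
    (hinj : Function.Injective ι) (hdense : DenseRange ι)
    (hcomplete : ∀ u : ℕ → D, (∀ ε > 0, ∃ N, ∀ m ≥ N, ∀ n ≥ N,
      E (u m - u n) (u m - u n) + ‖ι (u m - u n)‖ ^ 2 < ε) →
      ∃ v, Tendsto (fun n => E (u n - v) (u n - v) + ‖ι (u n - v)‖ ^ 2) atTop (𝓝 0))
    (hcpt : IsCompact (closure (ι '' {u | E u u ≤ 1 ∧ ‖ι u‖ ≤ 1})))
    (hH : ¬ FiniteDimensional ℝ H) :
    ∃ T : H →ₗ.[ℝ] H, Dense (T.domain : Set H) ∧ IsSelfAdjoint T ∧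
      (∀ f : T.domain, 0 ≤ inner ℝ (T f) (f : H)) ∧
      (∀ f : T.domain, ∃ u, ι u = f ∧ ∀ v, E u v = inner ℝ (T f) (ι v)) ∧
      HasDiscreteSpectrum T ∧
      ∀ T' : H →ₗ.[ℝ] H, IsSelfAdjoint T' →
        (∀ f : T'.domain, ∃ u, ι u = f ∧ ∀ v, E u v = inner ℝ (T' f) (ι v)) → T' = T := by
  -- The inner product is E(u, v) + ⟨ιu, ιv⟩. For its norm, `hcomplete` is completeness of D and
  -- `hcpt` is compactness of ι.
  let core : InnerProductSpace.Core ℝ D :=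
    { inner := fun u v => E u v + inner ℝ (ι u) (ι v)
      conj_inner_symm := fun u v => by
        simp only [conj_trivial]
        rw [hsymm, real_inner_comm]
      re_inner_nonneg := fun u => add_nonneg (hnn u) real_inner_self_nonneg
      add_left := fun u v w => by
        simp only [map_add, LinearMap.add_apply, inner_add_left]; ring
      smul_left := fun u v r => by
        simp only [map_smul, LinearMap.smul_apply, inner_smul_left, smul_eq_mul,
          conj_trivial]
        ring
      definite := fun u hu => by
        have h1 := hnn u
        have h2 : E u u + inner ℝ (ι u) (ι u) = 0 := hu
        rw [real_inner_self_eq_norm_sq] at h2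
        apply hinj
        rw [map_zero, ← norm_eq_zero]
        nlinarith [norm_nonneg (ι u)] }
  let _ : NormedAddCommGroup D := core.toNormedAddCommGroup
  let _ : InnerProductSpace ℝ D := InnerProductSpace.ofCore core.toCore
  have hin : ∀ u v : D, inner ℝ u v = E u v + inner ℝ (ι u) (ι v) := fun u v => rfl
  have hnorm : ∀ u : D, ‖u‖ ^ 2 = E u u + ‖ι u‖ ^ 2 := fun u => by
    rw [← real_inner_self_eq_norm_sq, hin, real_inner_self_eq_norm_sq]
  have hle : ∀ u, ‖ι u‖ ≤ ‖u‖ := fun u => by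
    refine le_of_sq_le_sq ?_ (norm_nonneg _)
    rw [hnorm]
    linarith [hnn u]
  let j : D →L[ℝ] H := ι.mkContinuous 1 fun u => by rw [one_mul]; exact hle u
  have hcs : CompleteSpace D := by
    refine Metric.complete_of_cauchySeq_tendsto fun u hu => ?_
    obtain ⟨v, hv⟩ := hcomplete u fun ε hε => by
      obtain ⟨N, hN⟩ := Metric.cauchySeq_iff.1 hu (√ε) (Real.sqrt_pos.2 hε)
      refine ⟨N, fun m hm n hn => ?_⟩
      have := hN m hm n hn
      rw [dist_eq_norm, Real.lt_sqrt (norm_nonneg _), hnorm] at this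
      exact this
    refine ⟨v, tendsto_iff_norm_sub_tendsto_zero.2 ?_⟩
    have := hv.sqrt
    simpa only [← hnorm, Real.sqrt_sq (norm_nonneg _), Real.sqrt_zero] using this
  have hjc : IsCompactOperator j := by
    refine (isCompactOperator_iff_isCompact_closure_image_closedBall (j : D →ₗ[ℝ] H)
      one_pos).2 ?_
    refine hcpt.of_isClosed_subset isClosed_closure (closure_mono (image_mono fun u hu => ?_))
    rw [mem_closedBall_zero_iff] at hu
    have h1 := hnorm u
    refine ⟨?_, (hle u).trans hu⟩
    nlinarith [norm_nonneg u, sq_nonneg ‖ι u‖]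
  obtain ⟨T, h1, h2, h3, h4, h5, h6⟩ :=
    exists_operator_of_compact_embedding j hinj hdense hjc hle hH
  refine ⟨T, h1, h2, h3, fun f => ?_, h5, fun T' hT' hf => h6 T' hT' fun f => ?_⟩
  · obtain ⟨u, hu, huv⟩ := h4 f
    refine ⟨u, hu, fun v => ?_⟩
    have := huv v
    rw [hin, inner_add_left, ← hu] at this
    exact add_right_cancel this
  · obtain ⟨u, hu, huv⟩ := hf f
    refine ⟨u, hu, fun v => ?_⟩
    rw [hin, huv, inner_add_left, ← hu]
    rfl

end Form

/-! ### The space H¹(0, 1) and its Dirichlet form. -/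

section SobolevInterval

theorem AbsolutelyContinuousOnInterval.congr {f g : ℝ → ℝ} {a b : ℝ}
    (hf : AbsolutelyContinuousOnInterval f a b) (h : EqOn f g (uIcc a b)) :
    AbsolutelyContinuousOnInterval g a b := by
  rw [absolutelyContinuousOnInterval_iff] at hf ⊢
  intro ε hε
  obtain ⟨δ, hδ, H⟩ := hf ε hε
  refine ⟨δ, hδ, fun E hE hEδ => ?_⟩
  have := H E hE hEδ
  rwa [Finset.sum_congr rfl fun i hi => by
    rw [h (hE.1 i hi).1, h (hE.1 i hi).2]] at this

theorem AbsolutelyContinuousOnInterval.lipschitz_comp {f φ : ℝ → ℝ} {a b : ℝ} {K : ℝ≥0}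
    (hf : AbsolutelyContinuousOnInterval f a b) (hφ : LipschitzWith K φ) :
    AbsolutelyContinuousOnInterval (φ ∘ f) a b := by
  have h := Tendsto.const_mul (K : ℝ) hf
  rw [mul_zero] at h
  refine squeeze_zero (fun E => Finset.sum_nonneg fun _ _ => dist_nonneg) (fun E => ?_) h
  rw [Finset.mul_sum]
  exact Finset.sum_le_sum fun i _ => hφ.dist_le_mul _ _

/-- The Dirichlet form `∫₀¹ f' g'`. -/
noncomputable def dirichletForm (f g : ℝ → ℝ) : ℝ := ∫ t in (0 : ℝ)..1, deriv f t * deriv g t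

/-- `deriv` is always measurable and endpoints are null, so the condition becomes membership in L²
of the half-open interval used by interval integrals. -/
theorem isH1_iff {f : ℝ → ℝ} : IsH1 f ↔ AbsolutelyContinuousOnInterval f 0 1 ∧
    MemLp (deriv f) 2 (volume.restrict (Ioc 0 1)) := by
  rw [IsH1, memLp_two_iff_integrable_sq (measurable_deriv f).aestronglyMeasurable, IntegrableOn,
    ← Measure.restrict_congr_set Ioc_ae_eq_Icc]

theorem IsH1.memLp {f : ℝ → ℝ} (hf : IsH1 f) :
    MemLp (deriv f) 2 (volume.restrict (Ioc 0 1)) := (isH1_iff.1 hf).2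

theorem IsH1.ae_differentiableAt {f : ℝ → ℝ} (hf : IsH1 f) :
    ∀ᵐ t ∂volume.restrict (Ioc (0 : ℝ) 1), DifferentiableAt ℝ f t := by
  rw [ae_restrict_iff' measurableSet_Ioc]
  filter_upwards [hf.1.ae_differentiableAt] with t ht ht'
  exact ht (by rw [uIcc_of_le zero_le_one]; exact Ioc_subset_Icc_self ht')

theorem IsH1.deriv_add {f g : ℝ → ℝ} (hf : IsH1 f) (hg : IsH1 g) :
    deriv (f + g) =ᵐ[volume.restrict (Ioc 0 1)] deriv f + deriv g := by
  filter_upwards [hf.ae_differentiableAt, hg.ae_differentiableAt] with t h1 h2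
  exact _root_.deriv_add h1 h2

/-- Holds even where f is not differentiable: there `deriv f` has the default value 0, and so has
the left side. -/
theorem deriv_const_smul_fun (c : ℝ) (f : ℝ → ℝ) : deriv (c • f) = c • deriv f := by
  ext t
  exact deriv_const_smul_field c f

theorem IsH1.add {f g : ℝ → ℝ} (hf : IsH1 f) (hg : IsH1 g) : IsH1 (f + g) :=
  isH1_iff.2 ⟨hf.1.add hg.1, (hf.memLp.add hg.memLp).ae_eq (hf.deriv_add hg).symm⟩

theorem IsH1.smul {f : ℝ → ℝ} (hf : IsH1 f) (c : ℝ) : IsH1 (c • f) :=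
  isH1_iff.2 ⟨hf.1.const_mul c, by rw [deriv_const_smul_fun]; exact hf.memLp.const_smul c⟩

theorem IsH1.sub {f g : ℝ → ℝ} (hf : IsH1 f) (hg : IsH1 g) : IsH1 (f - g) := by
  have := hf.add (hg.smul (-1))
  rwa [neg_one_smul, ← sub_eq_add_neg] at this

theorem IsH1.deriv_sub {f g : ℝ → ℝ} (hf : IsH1 f) (hg : IsH1 g) :
    deriv (f - g) =ᵐ[volume.restrict (Ioc 0 1)] deriv f - deriv g := by
  filter_upwards [hf.ae_differentiableAt, hg.ae_differentiableAt] with t h1 h2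
  exact _root_.deriv_sub h1 h2

theorem IsH1.integrable_mul {f g : ℝ → ℝ} (hf : IsH1 f) (hg : IsH1 g) :
    Integrable (fun t => deriv f t * deriv g t) (volume.restrict (Ioc 0 1)) :=
  hf.memLp.integrable_mul hg.memLp

theorem dirichletForm_eq (f g : ℝ → ℝ) :
    dirichletForm f g = ∫ t in Ioc (0 : ℝ) 1, deriv f t * deriv g t :=
  intervalIntegral.integral_of_le zero_le_one

theorem dirichletForm_self_nonneg (f : ℝ → ℝ) : 0 ≤ dirichletForm f f := by
  rw [dirichletForm_eq]
  exact integral_nonneg fun t => mul_self_nonneg _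

theorem dirichletForm_add_left {f g h : ℝ → ℝ} (hf : IsH1 f) (hg : IsH1 g) (hh : IsH1 h) :
    dirichletForm (f + g) h = dirichletForm f h + dirichletForm g h := by
  simp only [dirichletForm_eq]
  rw [← integral_add (hf.integrable_mul hh) (hg.integrable_mul hh)]
  refine integral_congr_ae ?_
  filter_upwards [hf.deriv_add hg] with t ht
  rw [ht, Pi.add_apply, add_mul]

theorem dirichletForm_smul_left (c : ℝ) (f h : ℝ → ℝ) :
    dirichletForm (c • f) h = c * dirichletForm f h := by
  rw [dirichletForm, deriv_const_smul_fun, dirichletForm, ← intervalIntegral.integral_const_mul]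
  simp only [Pi.smul_apply, smul_eq_mul, mul_assoc]

/-- Cauchy–Schwarz for the integral of f' from s to t. All oscillation bounds along wires rest on
it. -/
theorem IsH1.sq_sub_le {f : ℝ → ℝ} (hf : IsH1 f) {s t : ℝ} (hs : s ∈ Icc (0 : ℝ) 1)
    (ht : t ∈ Icc (0 : ℝ) 1) : (f t - f s) ^ 2 ≤ |t - s| * dirichletForm f f := by
  wlog hst : s ≤ t generalizing s t
  · rw [abs_sub_comm, ← neg_sub, neg_sq]
    exact this ht hs (le_of_not_ge hst)
  have hac : AbsolutelyContinuousOnInterval f s t := hf.1.mono (by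
    rw [uIcc_of_le hst, uIcc_of_le zero_le_one]
    exact Icc_subset_Icc hs.1 ht.2)
  rw [← hac.integral_deriv_eq_sub, intervalIntegral.integral_of_le hst,
    abs_of_nonneg (sub_nonneg.2 hst), dirichletForm_eq]
  have hsub : Ioc s t ⊆ Ioc 0 1 := Ioc_subset_Ioc hs.1 ht.2
  have hm : MemLp (deriv f) 2 (volume.restrict (Ioc s t)) :=
    hf.memLp.mono_measure (Measure.restrict_mono hsub le_rfl)
  have hsq : IntegrableOn (fun x => deriv f x * deriv f x) (Ioc s t) := hm.integrable_mul hm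
  set A := ∫ x in Ioc s t, deriv f x with hA
  set B := ∫ x in Ioc s t, deriv f x * deriv f x with hB
  have hBle : B ≤ ∫ x in Ioc (0 : ℝ) 1, deriv f x * deriv f x :=
    setIntegral_mono_set (hf.integrable_mul hf) (Eventually.of_forall fun x => mul_self_nonneg _)
      hsub.eventuallyLE
  -- Cauchy–Schwarz through the integral of (f' − c)², used below at its minimum c = A/(t − s).
  have key : ∀ c : ℝ, 0 ≤ B - 2 * c * A + c ^ 2 * (t - s) := by
    intro c
    have h2 : 0 ≤ ∫ x in Ioc s t, (deriv f x - c) ^ 2 := integral_nonneg fun x => sq_nonneg _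
    have h3 : ∫ x in Ioc s t, (deriv f x - c) ^ 2 = B - 2 * c * A + c ^ 2 * (t - s) := by
      have e : ∀ x, (deriv f x - c) ^ 2 = deriv f x * deriv f x - 2 * c * deriv f x + c ^ 2 :=
        fun x => by ring
      simp only [e]
      have hi' : Integrable (deriv f) (volume.restrict (Ioc s t)) := hm.integrable (by norm_num)
      have hs1 : Integrable (fun x => deriv f x * deriv f x - 2 * c * deriv f x)
        (volume.restrict (Ioc s t)) := hsq.sub (hi'.const_mul _)
      rw [integral_add hs1 (integrable_const _),
        integral_sub hsq (hi'.const_mul _), integral_const_mul, integral_const]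
      simp [hst, mul_comm, hA, hB]
    linarith
  rcases hst.eq_or_lt with h | h
  · subst h; simp [hA]
  · have h4 := key (A / (t - s))
    have h5 : 0 < t - s := sub_pos.2 h
    have h6 : B - 2 * (A / (t - s)) * A + (A / (t - s)) ^ 2 * (t - s) = B - A ^ 2 / (t - s) := by
      field_simp; ring
    rw [h6, sub_nonneg, div_le_iff₀ h5] at h4
    nlinarith

/-- The difference quotients of φ ∘ f are at most K times those of f, so the derivatives compare
wherever both exist. -/
theorem IsH1.lipschitz_comp {f φ : ℝ → ℝ} {K : ℝ≥0} (hf : IsH1 f) (hφ : LipschitzWith K φ) :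
    IsH1 (φ ∘ f) ∧ dirichletForm (φ ∘ f) (φ ∘ f) ≤ K ^ 2 * dirichletForm f f := by
  have hle : ∀ᵐ t ∂volume.restrict (Ioc (0 : ℝ) 1), ‖deriv (φ ∘ f) t‖ ≤ ‖K * deriv f t‖ := by
    filter_upwards [hf.ae_differentiableAt] with t ht
    by_cases hd : DifferentiableAt ℝ (φ ∘ f) t
    · have h1 := hd.hasDerivAt.tendsto_slope.norm
      have h2 := (ht.hasDerivAt.tendsto_slope.norm).const_mul (K : ℝ)
      rw [norm_mul, Real.norm_of_nonneg K.coe_nonneg]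
      refine le_of_tendsto_of_tendsto h1 h2 (Eventually.of_forall fun y => ?_)
      simp only [slope_def_field, norm_div, Function.comp_apply]
      rw [← mul_div_assoc]
      gcongr
      simpa [dist_eq_norm] using hφ.dist_le_mul (f y) (f t)
    -- Where φ ∘ f is not differentiable its `deriv` is 0 by default, so the bound is trivial.
    · rw [deriv_zero_of_not_differentiableAt hd]
      rw [norm_zero]
      exact norm_nonneg _
  have hm : MemLp (deriv (φ ∘ f)) 2 (volume.restrict (Ioc 0 1)) :=
    (hf.memLp.const_mul (K : ℝ)).mono (measurable_deriv _).aestronglyMeasurable hle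
  have h1 : IsH1 (φ ∘ f) := isH1_iff.2 ⟨hf.1.lipschitz_comp hφ, hm⟩
  refine ⟨h1, ?_⟩
  rw [dirichletForm_eq, dirichletForm_eq, ← integral_const_mul]
  refine integral_mono_ae (h1.integrable_mul h1) ((hf.integrable_mul hf).const_mul _) ?_
  filter_upwards [hle] with t ht
  rw [← pow_two, ← pow_two, ← mul_pow]
  exact sq_le_sq.2 ht

theorem isH1_of_lipschitzOn {f : ℝ → ℝ} {K : ℝ≥0} (hf : LipschitzOnWith K f (Icc 0 1)) :
    IsH1 f := by
  refine isH1_iff.2 ⟨?_, ?_⟩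
  · exact LipschitzOnWith.absolutelyContinuousOnInterval (K := K)
      (by rwa [uIcc_of_le zero_le_one])
  · refine MemLp.of_bound (measurable_deriv f).aestronglyMeasurable K ?_
    -- The endpoint is dropped because f is uncontrolled outside [0, 1], so `deriv` is only
    -- meaningful at interior points.
    rw [← restrict_Ioo_eq_restrict_Ioc, ae_restrict_iff' measurableSet_Ioo]
    refine Eventually.of_forall fun t ht => ?_
    exact norm_deriv_le_of_lipschitzOn (Icc_mem_nhds ht.1 ht.2) hf

theorem dirichletForm_eq_zero_of_const {f : ℝ → ℝ} {c : ℝ} (hf : ∀ t ∈ Icc (0 : ℝ) 1, f t = c)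
    (g : ℝ → ℝ) : dirichletForm f g = 0 := by
  rw [dirichletForm_eq, integral_Ioc_eq_integral_Ioo]
  refine setIntegral_eq_zero_of_forall_eq_zero fun t ht => ?_
  have : f =ᶠ[𝓝 t] fun _ => c := by
    filter_upwards [Icc_mem_nhds ht.1 ht.2] with s hs using hf s hs
  rw [this.deriv_eq, deriv_const, zero_mul]

theorem dirichletForm_sub_self {f g : ℝ → ℝ} (hf : IsH1 f) (hg : IsH1 g) :
    dirichletForm (f - g) (f - g) =
      ‖hf.memLp.toLp - hg.memLp.toLp‖ ^ 2 := by
  rw [← real_inner_self_eq_norm_sq, dirichletForm_eq, L2.inner_def]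
  refine integral_congr_ae ?_
  filter_upwards [hf.deriv_sub hg, Lp.coeFn_sub hf.memLp.toLp hg.memLp.toLp,
    hf.memLp.coeFn_toLp, hg.memLp.coeFn_toLp] with t h1 h2 h3 h4
  rw [h1, h2]
  simp [h3, h4, pow_two]

/-- Completeness of `H¹(0, 1)`, with the limit function given in advance. -/
theorem isH1_of_tendsto {f : ℕ → ℝ → ℝ} {g : ℝ → ℝ} (hf : ∀ n, IsH1 (f n))
    (hfg : ∀ t ∈ Icc (0 : ℝ) 1, Tendsto (fun n => f n t) atTop (𝓝 (g t)))
    (hcau : ∀ ε > 0, ∃ N, ∀ m ≥ N, ∀ n ≥ N, dirichletForm (f m - f n) (f m - f n) < ε) :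
    IsH1 g ∧ Tendsto (fun n => dirichletForm (f n - g) (f n - g)) atTop (𝓝 0) := by
  set F : ℕ → Lp ℝ 2 (volume.restrict (Ioc (0 : ℝ) 1)) := fun n => (hf n).memLp.toLp with hF
  have hFc : CauchySeq F := by
    refine Metric.cauchySeq_iff.2 fun ε hε => ?_
    obtain ⟨N, hN⟩ := hcau (ε ^ 2) (by positivity)
    refine ⟨N, fun m hm n hn => ?_⟩
    have := hN m hm n hn
    rw [dirichletForm_sub_self (hf m) (hf n)] at this
    rw [dist_eq_norm]
    exact lt_of_pow_lt_pow_left₀ 2 hε.le this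
  obtain ⟨G, hG⟩ := cauchySeq_tendsto_of_complete hFc
  have hGm : MemLp G 2 (volume.restrict (Ioc (0 : ℝ) 1)) := Lp.memLp G
  have hGi : IntervalIntegrable G volume 0 1 :=
    (intervalIntegrable_iff_integrableOn_Ioc_of_le zero_le_one).2 (hGm.integrable (by norm_num))
  have hint : ∀ t ∈ Icc (0 : ℝ) 1, g t = g 0 + ∫ x in (0 : ℝ)..t, G x := by
    intro t ht
    have hms : MeasurableSet (Ioc 0 t) := measurableSet_Ioc
    -- Pairing with the indicator of (0, t] is a continuous functional, so f n t − f n 0 converges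
    -- to the integral of G over (0, t]. Thus g is the primitive of G.
    have hin : ∀ Q : Lp ℝ 2 (volume.restrict (Ioc (0 : ℝ) 1)),
        inner ℝ (indicatorConstLp 2 hms (measure_ne_top (volume.restrict (Ioc (0 : ℝ) 1)) _)
          (1 : ℝ)) Q = ∫ x in (0 : ℝ)..t, Q x := fun Q => by
      rw [L2.inner_indicatorConstLp_one, Measure.restrict_restrict hms,
        inter_eq_left.2 (Ioc_subset_Ioc_right ht.2), intervalIntegral.integral_of_le ht.1]
    have h1 := (tendsto_const_nhds (x := indicatorConstLp 2 hms
      (measure_ne_top (volume.restrict (Ioc (0 : ℝ) 1)) _) (1 : ℝ))).inner (𝕜 := ℝ) hG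
    simp only [hin] at h1
    have h2 : ∀ n, ∫ x in (0 : ℝ)..t, F n x = f n t - f n 0 := fun n => by
      have hac : AbsolutelyContinuousOnInterval (f n) 0 t := (hf n).1.mono (by
        rw [uIcc_of_le ht.1, uIcc_of_le zero_le_one]
        exact Icc_subset_Icc_right ht.2)
      rw [← hac.integral_deriv_eq_sub, intervalIntegral.integral_of_le ht.1,
        intervalIntegral.integral_of_le ht.1]
      refine integral_congr_ae ?_
      exact ae_restrict_of_ae_restrict_of_subset (Ioc_subset_Ioc_right ht.2)
        (hf n).memLp.coeFn_toLp
    simp only [h2] at h1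
    have h3 := (hfg t ht).sub (hfg 0 ⟨le_rfl, zero_le_one⟩)
    linarith [tendsto_nhds_unique h1 h3]
  have hacI := hGi.absolutelyContinuousOnInterval_intervalIntegral (c := 0) (by simp)
  have hac : AbsolutelyContinuousOnInterval g 0 1 := by
    have hc : AbsolutelyContinuousOnInterval (fun _ : ℝ => g 0) 0 1 :=
      (LipschitzWith.const (g 0)).lipschitzOnWith.absolutelyContinuousOnInterval
    refine (hc.add hacI).congr fun t ht => ?_
    rw [uIcc_of_le zero_le_one] at ht
    exact (hint t ht).symm
  have hder : deriv g =ᵐ[volume.restrict (Ioc (0 : ℝ) 1)] G := by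
    rw [EventuallyEq, ae_restrict_iff' measurableSet_Ioc]
    -- The point 1 is discarded so that the integral formula for g holds on a neighbourhood of t.
    filter_upwards [hGi.ae_hasDerivAt_integral, compl_mem_ae_iff.2 (measure_singleton (1 : ℝ))]
      with t ht h1 ht'
    replace ht' : t ∈ Ioo (0 : ℝ) 1 := ⟨ht'.1, lt_of_le_of_ne ht'.2 h1⟩
    have h1 := ht (by rw [uIcc_of_le zero_le_one]; exact Ioo_subset_Icc_self ht') 0 (by simp)
    have h2 : g =ᶠ[𝓝 t] fun s => g 0 + ∫ x in (0 : ℝ)..s, G x := by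
      filter_upwards [Icc_mem_nhds ht'.1 ht'.2] with s hs using hint s hs
    rw [h2.deriv_eq]
    exact (h1.const_add _).deriv
  have hg : IsH1 g := isH1_iff.2 ⟨hac, hGm.ae_eq hder.symm⟩
  refine ⟨hg, ?_⟩
  have hgG : hg.memLp.toLp = G := by
    refine Lp.ext ?_
    exact hg.memLp.coeFn_toLp.trans hder
  have h1 := (tendsto_iff_norm_sub_tendsto_zero.1 hG).pow 2
  simp only [dirichletForm_sub_self (hf _) hg, hgG]
  simpa using h1

end SobolevInterval

/-! ### Geometry of the attractor: corners, cells and wires. -/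

section Geometry

/-- A compact invariant set is contained in every nonempty closed sub-invariant set. -/
theorem subset_of_invariant {X ι : Type*} [MetricSpace X] {f : ι → X → X} {c : ℝ≥0} (hc : c < 1)
    (hf : ∀ i, LipschitzWith c (f i)) {S T : Set X} (hS : IsCompact S)
    (hSf : S ⊆ ⋃ i, f i '' S) (hT : IsClosed T) (hT' : T.Nonempty)
    (hTf : ∀ i, ∀ x ∈ T, f i x ∈ T) : S ⊆ T := by
  rcases S.eq_empty_or_nonempty with rfl | hS'
  · exact empty_subset _
  -- A point of S farthest from T has the form f i y with y ∈ S, so the maximal distance is at most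
  -- c < 1 times itself and vanishes.
  obtain ⟨x, hx, hmax⟩ := hS.exists_isMaxOn hS' (Metric.continuous_infDist_pt T).continuousOn
  obtain ⟨i, y, hy, rfl⟩ := mem_iUnion.1 (hSf hx)
  have h1 : Metric.infDist (f i y) T ≤ c * Metric.infDist y T := by
    refine le_of_forall_gt_imp_ge_of_dense fun r hr => ?_
    rcases eq_or_ne c 0 with rfl | h0
    · obtain ⟨t, ht⟩ := hT'
      refine (Metric.infDist_le_dist_of_mem (hTf i t ht)).trans (((hf i).dist_le_mul y t).trans ?_)
      simp only [NNReal.coe_zero, zero_mul] at hr ⊢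
      exact hr.le
    · have hc0 : (0 : ℝ) < c := by positivity
      rw [mul_comm, ← lt_div_iff₀ hc0, Metric.infDist_lt_iff hT'] at hr
      obtain ⟨t, ht, hyt⟩ := hr
      refine (Metric.infDist_le_dist_of_mem (hTf i t ht)).trans (((hf i).dist_le_mul y t).trans ?_)
      rw [lt_div_iff₀ hc0] at hyt
      linarith
  have h2 : Metric.infDist y T ≤ Metric.infDist (f i y) T := hmax hy
  have hc1 : (c : ℝ) < 1 := by exact_mod_cast hc
  have h3 : Metric.infDist (f i y) T = 0 := by
    have := Metric.infDist_nonneg (x := y) (s := T)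
    have := Metric.infDist_nonneg (x := f i y) (s := T)
    nlinarith
  intro z hz
  rw [hT.mem_iff_infDist_zero hT']
  exact le_antisymm (h3 ▸ hmax hz) Metric.infDist_nonneg

/-- Barycentric coordinates with respect to the three corners. -/
noncomputable def bary : Fin 3 → Plane → ℝ :=
  ![fun x => 1 - x 0 - x 1 / √3, fun x => 2 * x 1 / √3, fun x => x 0 - x 1 / √3]

theorem continuous_bary (i : Fin 3) : Continuous (bary i) := by
  fin_cases i <;> simp only [bary] <;> simp <;> fun_prop

theorem bary_sum (x : Plane) (i : Fin 3) : bary i x + bary (i + 1) x + bary (i + 2) x = 1 := by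
  fin_cases i <;> simp [bary] <;> ring

theorem bary_corner (i j : Fin 3) : bary i (corner j) = if i = j then 1 else 0 := by
  have h3 : √3 ≠ 0 := by positivity
  fin_cases i <;> fin_cases j <;> simp [bary, corner, hanoiPoint] <;> field_simp <;> norm_num

theorem bary_lineMap (i : Fin 3) (x y : Plane) (t : ℝ) :
    bary i (AffineMap.lineMap x y t) = (1 - t) * bary i x + t * bary i y := by
  fin_cases i <;> simp [bary, AffineMap.lineMap_apply] <;> ring

theorem cornerMap_eq (α : ℝ) (i : Fin 3) (x : Plane) :
    cornerMap α i x = AffineMap.lineMap (corner i) x ((1 - α) / 2) := by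
  rw [AffineMap.lineMap_apply]
  fin_cases i <;> ext k <;> fin_cases k <;>
    simp [cornerMap, hanoiMap, corner, hanoiPoint, hanoiMatrix]

theorem bary_cornerMap (α : ℝ) (i j : Fin 3) (x : Plane) : bary i (cornerMap α j x) =
    (1 + α) / 2 * (if i = j then 1 else 0) + (1 - α) / 2 * bary i x := by
  rw [cornerMap_eq, bary_lineMap, bary_corner]
  ring

/-- The affine parameter along the edge opposite to corner `i`. -/
noncomputable def edgeParam (i : Fin 3) (x : Plane) : ℝ := bary (i + 2) x + bary i x / 2

theorem edgeParam_lineMap (i : Fin 3) (x y : Plane) (t : ℝ) :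
    edgeParam i (AffineMap.lineMap x y t) = (1 - t) * edgeParam i x + t * edgeParam i y := by
  simp only [edgeParam, bary_lineMap]; ring

/-- The closed wire of level one opposite to corner `i`, parametrized. -/
noncomputable def baseWire (α : ℝ) (i : Fin 3) (t : ℝ) : Plane :=
  AffineMap.lineMap (cornerMap α (i + 1) (corner (i + 2))) (cornerMap α (i + 2) (corner (i + 1))) t

/-- A₄, A₅, A₆ are α times the orthogonal projections onto the directions of the sides, and
`edgeParam` is the coordinate of that projection. These maps therefore flatten the triangle onto
closed wires. -/
theorem hanoiMap_natAdd (α : ℝ) (i : Fin 3) (x : Plane) :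
    hanoiMap α (Fin.natAdd 3 i) x = baseWire α i (edgeParam i x) := by
  have h3 : √3 ≠ 0 := by positivity
  have h3' : √3 ^ 2 = 3 := Real.sq_sqrt (by norm_num)
  have h3'' : √3 ^ 3 = 3 * √3 := by rw [pow_succ, h3']
  simp only [baseWire, cornerMap_eq, AffineMap.lineMap_apply, edgeParam]
  fin_cases i <;> ext k <;> fin_cases k <;>
    simp [hanoiMap, corner, hanoiPoint, hanoiMatrix, Matrix.toLpLin_apply, bary,
      Fin.natAdd, Fin.castLE, Matrix.vecHead, Matrix.vecTail]
  all_goals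
    field_simp
    ring_nf
    try simp only [h3', h3'']
    try ring_nf

theorem edgeParam_corner_one (i : Fin 3) : edgeParam i (corner (i + 1)) = 0 := by
  fin_cases i <;> simp [edgeParam, bary_corner]

theorem edgeParam_corner_two (i : Fin 3) : edgeParam i (corner (i + 2)) = 1 := by
  fin_cases i <;> simp [edgeParam, bary_corner]

theorem edgeParam_baseWire (α : ℝ) (i : Fin 3) (t : ℝ) :
    edgeParam i (baseWire α i t) = (1 - α) / 2 + α * t := by
  simp only [baseWire, cornerMap_eq, edgeParam_lineMap, edgeParam_corner_one, edgeParam_corner_two]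
  ring

/-- The closed triangle. -/
def hanoiTriangle : Set Plane := {x | ∀ i, 0 ≤ bary i x}

theorem isClosed_hanoiTriangle : IsClosed hanoiTriangle := by
  simp only [hanoiTriangle, ofPred_forall]
  exact isClosed_iInter fun i => isClosed_le continuous_const (continuous_bary i)

theorem corner_mem_hanoiTriangle (i : Fin 3) : corner i ∈ hanoiTriangle := fun j => by
  rw [bary_corner]; split_ifs <;> norm_num

theorem lineMap_mem_hanoiTriangle {x y : Plane} (hx : x ∈ hanoiTriangle) (hy : y ∈ hanoiTriangle)
    {t : ℝ} (ht : t ∈ Icc (0 : ℝ) 1) : AffineMap.lineMap x y t ∈ hanoiTriangle := fun i => by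
  rw [bary_lineMap]
  exact add_nonneg (mul_nonneg (sub_nonneg.2 ht.2) (hx i)) (mul_nonneg ht.1 (hy i))

theorem edgeParam_mem {x : Plane} (hx : x ∈ hanoiTriangle) (i : Fin 3) :
    edgeParam i x ∈ Icc (0 : ℝ) 1 := by
  have h1 := hx i
  have h2 := hx (i + 1)
  have h3 := hx (i + 2)
  have h4 := bary_sum x i
  constructor <;> rw [edgeParam] <;> linarith

theorem bary_le_one {x : Plane} (hx : x ∈ hanoiTriangle) (i : Fin 3) : bary i x ≤ 1 := by
  have h2 := hx (i + 1)
  have h3 := hx (i + 2)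
  linarith [bary_sum x i]

section Attr

variable {α : ℝ}

theorem cornerMap_mem_hanoiTriangle (h0 : 0 < α) (h1 : α < 1 / 3) (i : Fin 3) {x : Plane}
    (hx : x ∈ hanoiTriangle) : cornerMap α i x ∈ hanoiTriangle := by
  rw [cornerMap_eq]
  exact lineMap_mem_hanoiTriangle (corner_mem_hanoiTriangle i) hx ⟨by linarith, by linarith⟩

theorem baseWire_mem_hanoiTriangle (h0 : 0 < α) (h1 : α < 1 / 3) (i : Fin 3) {t : ℝ}
    (ht : t ∈ Icc (0 : ℝ) 1) : baseWire α i t ∈ hanoiTriangle :=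
  lineMap_mem_hanoiTriangle (cornerMap_mem_hanoiTriangle h0 h1 _ (corner_mem_hanoiTriangle _))
    (cornerMap_mem_hanoiTriangle h0 h1 _ (corner_mem_hanoiTriangle _)) ht

theorem forall_fin_six {P : Fin 6 → Prop} : (∀ i, P i) ↔
    (∀ i : Fin 3, P (i.castLE (by norm_num))) ∧ ∀ i : Fin 3, P (Fin.natAdd 3 i) := by
  simp only [Fin.forall_fin_succ, Fin.forall_fin_zero]
  simp [Fin.natAdd, Fin.castLE, and_assoc]

theorem toNNReal_ratio_lt_one (h0 : 0 < α) : Real.toNNReal ((1 - α) / 2) < 1 := by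
  rw [Real.toNNReal_lt_one]; linarith

theorem hanoiAttractor_subset (h0 : 0 < α) (h1 : α < 1 / 3) {T : Set Plane} (hT : IsClosed T)
    (hT' : T.Nonempty) (hc : ∀ i, ∀ x ∈ T, cornerMap α i x ∈ T)
    (hw : ∀ i, ∀ x ∈ T, baseWire α i (edgeParam i x) ∈ T) : hanoiAttractor α ⊆ T := by
  have h := (hanoiAttractor_spec h0 h1).1
  refine subset_of_invariant (toNNReal_ratio_lt_one h0) (hanoiMap_lipschitz h0 h1) h.1 h.2.2.subset
    hT hT' ?_
  rw [forall_fin_six]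
  refine ⟨hc, fun i x hx => ?_⟩
  rw [hanoiMap_natAdd]
  exact hw i x hx

theorem hanoiAttractor_subset_triangle (h0 : 0 < α) (h1 : α < 1 / 3) :
    hanoiAttractor α ⊆ hanoiTriangle :=
  hanoiAttractor_subset h0 h1 isClosed_hanoiTriangle ⟨_, corner_mem_hanoiTriangle 0⟩
    (fun i _ hx => cornerMap_mem_hanoiTriangle h0 h1 i hx)
    (fun i _ hx => baseWire_mem_hanoiTriangle h0 h1 i (edgeParam_mem hx i))

theorem cornerMap_mem_hanoiAttractor (h0 : 0 < α) (h1 : α < 1 / 3) (i : Fin 3) {x : Plane}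
    (hx : x ∈ hanoiAttractor α) : cornerMap α i x ∈ hanoiAttractor α := by
  rw [(hanoiAttractor_spec h0 h1).1.2.2]
  exact mem_iUnion.2 ⟨_, x, hx, rfl⟩

theorem corner_mem_hanoiAttractor (h0 : 0 < α) (h1 : α < 1 / 3) (i : Fin 3) :
    corner i ∈ hanoiAttractor α := by
  have h := (hanoiAttractor_spec h0 h1).1
  have hfix : cornerMap α i (corner i) = corner i := by
    rw [cornerMap_eq, AffineMap.lineMap_same, AffineMap.const_apply]
  have := subset_of_invariant (f := fun _ : Unit => cornerMap α i) (S := {corner i})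
    (toNNReal_ratio_lt_one h0) (fun _ => hanoiMap_lipschitz h0 h1 _) isCompact_singleton
    (by simp [hfix]) h.1.isClosed h.2.1
    (fun _ x hx => cornerMap_mem_hanoiAttractor h0 h1 i hx)
  exact this rfl

theorem edgeParam_cornerMap_one (i : Fin 3) (x : Plane) :
    edgeParam i (cornerMap α (i + 1) x) = (1 - α) / 2 * edgeParam i x := by
  rw [cornerMap_eq, edgeParam_lineMap, edgeParam_corner_one]; ring

theorem edgeParam_cornerMap_two (i : Fin 3) (x : Plane) :
    edgeParam i (cornerMap α (i + 2) x) = (1 + α) / 2 + (1 - α) / 2 * edgeParam i x := by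
  rw [cornerMap_eq, edgeParam_lineMap, edgeParam_corner_two]; ring

theorem continuous_edgeParam (i : Fin 3) : Continuous (edgeParam i) :=
  (continuous_bary _).add ((continuous_bary _).div_const _)

/-- The attractor projects onto every edge of the triangle. -/
theorem Icc_subset_edgeParam_image (h0 : 0 < α) (h1 : α < 1 / 3) (i : Fin 3) :
    Icc (0 : ℝ) 1 ⊆ edgeParam i '' hanoiAttractor α := by
  have h := (hanoiAttractor_spec h0 h1).1
  -- `edgeParam i` carries G_{i+1}, the wire map and G_{i+2} to these three contractions of the
  -- line, whose images of [0, 1] are adjacent and cover it.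
  let f : Fin 3 → ℝ → ℝ := ![fun t => (1 - α) / 2 * t, fun t => (1 - α) / 2 + α * t,
    fun t => (1 + α) / 2 + (1 - α) / 2 * t]
  have hlip : ∀ k, LipschitzWith (Real.toNNReal ((1 - α) / 2)) (f k) := by
    intro k
    refine LipschitzWith.of_dist_le_mul fun x y => ?_
    rw [Real.coe_toNNReal _ (by linarith), Real.dist_eq, Real.dist_eq]
    fin_cases k <;> simp only [f] <;> simp
    · rw [← mul_sub, abs_mul, abs_of_pos (by linarith : 0 < (1 - α) / 2)]
    · rw [← mul_sub, abs_mul, abs_of_pos h0]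
      gcongr; linarith
    · rw [← mul_sub, abs_mul, abs_of_pos (by linarith : 0 < (1 - α) / 2)]
  refine subset_of_invariant (toNNReal_ratio_lt_one h0) hlip isCompact_Icc ?_
    (h.1.image (continuous_edgeParam i)).isClosed (h.2.1.image _) ?_
  · intro t ht
    rw [mem_iUnion]
    have hs : 0 < (1 - α) / 2 := by linarith
    rcases le_total t ((1 - α) / 2) with h2 | h2
    · refine ⟨0, t / ((1 - α) / 2), ⟨div_nonneg ht.1 hs.le, (div_le_one hs).2 h2⟩, ?_⟩
      exact mul_div_cancel₀ _ hs.ne'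
    rcases le_total t ((1 + α) / 2) with h3 | h3
    · refine ⟨1, (t - (1 - α) / 2) / α, ⟨div_nonneg (by linarith) h0.le,
        (div_le_one h0).2 (by linarith)⟩, ?_⟩
      change (1 - α) / 2 + α * _ = t
      rw [mul_div_cancel₀ _ h0.ne']; ring
    · refine ⟨2, (t - (1 + α) / 2) / ((1 - α) / 2), ⟨div_nonneg (by linarith) hs.le,
        (div_le_one hs).2 (by linarith [ht.2])⟩, ?_⟩
      change (1 + α) / 2 + (1 - α) / 2 * _ = t
      rw [mul_div_cancel₀ _ hs.ne']; ring
  · rintro k _ ⟨x, hx, rfl⟩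
    fin_cases k
    · exact ⟨_, cornerMap_mem_hanoiAttractor h0 h1 (i + 1) hx, edgeParam_cornerMap_one i x⟩
    · refine ⟨hanoiMap α (Fin.natAdd 3 i) x, ?_, ?_⟩
      · rw [h.2.2]
        exact mem_iUnion.2 ⟨_, x, hx, rfl⟩
      · rw [hanoiMap_natAdd, edgeParam_baseWire]
        rfl
    · exact ⟨_, cornerMap_mem_hanoiAttractor h0 h1 (i + 2) hx, edgeParam_cornerMap_two i x⟩

/-- K projects onto the whole side, so its image under the flattening map is the whole closed wire.
-/
theorem baseWire_mem_hanoiAttractor (h0 : 0 < α) (h1 : α < 1 / 3) (i : Fin 3) {t : ℝ}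
    (ht : t ∈ Icc (0 : ℝ) 1) : baseWire α i t ∈ hanoiAttractor α := by
  obtain ⟨x, hx, rfl⟩ := Icc_subset_edgeParam_image h0 h1 i ht
  rw [← hanoiMap_natAdd, (hanoiAttractor_spec h0 h1).1.2.2]
  exact mem_iUnion.2 ⟨_, x, hx, rfl⟩

theorem hanoiAttractor_cases (h0 : 0 < α) (h1 : α < 1 / 3) {x : Plane}
    (hx : x ∈ hanoiAttractor α) : (∃ i, ∃ y ∈ hanoiAttractor α, cornerMap α i y = x) ∨
      ∃ i, ∃ t ∈ Icc (0 : ℝ) 1, baseWire α i t = x := by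
  rw [(hanoiAttractor_spec h0 h1).1.2.2] at hx
  obtain ⟨i, y, hy, hxy⟩ := mem_iUnion.1 hx
  by_contra hcon
  rw [not_or] at hcon
  refine (forall_fin_six (P := fun i => hanoiMap α i y ≠ x)).2 ⟨fun j hj => ?_, fun j hj => ?_⟩ i hxy
  · exact hcon.1 ⟨j, y, hy, hj⟩
  · rw [hanoiMap_natAdd] at hj
    exact hcon.2 ⟨j, _, edgeParam_mem (hanoiAttractor_subset_triangle h0 h1 hy) j, hj⟩

theorem wordMap_mem_hanoiAttractor (h0 : 0 < α) (h1 : α < 1 / 3) (n : ℕ) (w : Fin n → Fin 3)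
    {x : Plane} (hx : x ∈ hanoiAttractor α) : wordMap α n w x ∈ hanoiAttractor α := by
  induction n with
  | zero => exact hx
  | succ n ih => exact cornerMap_mem_hanoiAttractor h0 h1 _ (ih _)

/-- The three similitudes are homotheties of the same ratio without rotation, so a composition is a
scaling followed by a translation. -/
theorem wordMap_sub (n : ℕ) (w : Fin n → Fin 3) (x y : Plane) :
    wordMap α n w x - wordMap α n w y = ((1 - α) / 2) ^ n • (x - y) := by
  induction n with
  | zero => simp [wordMap]
  | succ n ih =>
    rw [pow_succ', mul_smul, ← ih (Fin.tail w)]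
    simp only [wordMap, Function.comp_apply, cornerMap_eq, AffineMap.lineMap_apply]
    simp [smul_sub]

theorem wordMap_eq (n : ℕ) (w : Fin n → Fin 3) (x : Plane) :
    wordMap α n w x = ((1 - α) / 2) ^ n • x + wordMap α n w 0 := by
  rw [← sub_eq_iff_eq_add, wordMap_sub, sub_zero]

theorem dist_wordMap (h1 : α < 1 / 3) (n : ℕ) (w : Fin n → Fin 3) (x y : Plane) :
    dist (wordMap α n w x) (wordMap α n w y) = ((1 - α) / 2) ^ n * dist x y := by
  have : 0 < (1 - α) / 2 := by linarith
  rw [dist_eq_norm, wordMap_sub, norm_smul, dist_eq_norm, Real.norm_of_nonneg (by positivity)]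

theorem continuous_wordMap (n : ℕ) (w : Fin n → Fin 3) : Continuous (wordMap α n w) := by
  rw [funext (wordMap_eq n w)]
  fun_prop

theorem wordMap_lineMap (n : ℕ) (w : Fin n → Fin 3) (x y : Plane) (t : ℝ) :
    wordMap α n w (AffineMap.lineMap x y t) =
      AffineMap.lineMap (wordMap α n w x) (wordMap α n w y) t := by
  rw [wordMap_eq n w x, wordMap_eq n w y, wordMap_eq n w (AffineMap.lineMap x y t)]
  simp only [AffineMap.lineMap_apply, vsub_eq_sub, vadd_eq_add]
  module

theorem wordMap_snoc (n : ℕ) (w : Fin n → Fin 3) (i : Fin 3) (x : Plane) :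
    wordMap α (n + 1) (Fin.snoc w i : Fin (n + 1) → Fin 3) x =
      wordMap α n w (cornerMap α i x) := by
  induction n with
  | zero => rfl
  | succ n ih =>
    have h : (Fin.snoc w i : Fin (n + 2) → Fin 3) =
        Fin.cons (w 0) (Fin.snoc (Fin.tail w) i : Fin (n + 1) → Fin 3) := by
      rw [Fin.cons_snoc_eq_snoc_cons, Fin.cons_self_tail]
    rw [h, wordMap]
    simp only [Function.comp_apply, Fin.cons_zero, Fin.tail_cons, ih]
    rfl

theorem wire_param_eq (k : ℕ) (w : Fin k → Fin 3) (i : Fin 3) (t : ℝ) :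
    Wire.param α ⟨k, w, i⟩ t = wordMap α k w (baseWire α i t) := by
  rw [baseWire, wordMap_lineMap]
  rfl

theorem wire_param_mem_hanoiAttractor (h0 : 0 < α) (h1 : α < 1 / 3) (e : Wire) {t : ℝ}
    (ht : t ∈ Icc (0 : ℝ) 1) : e.param α t ∈ hanoiAttractor α := by
  obtain ⟨k, w, i⟩ := e
  rw [wire_param_eq]
  exact wordMap_mem_hanoiAttractor h0 h1 k w (baseWire_mem_hanoiAttractor h0 h1 i ht)

/-- Iterated one-step decomposition; the equicontinuity estimate localizes to this finite cover by
closed pieces. -/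
theorem hanoiAttractor_cover (h0 : 0 < α) (h1 : α < 1 / 3) {x : Plane}
    (hx : x ∈ hanoiAttractor α) (n : ℕ) :
    (∃ w : Fin n → Fin 3, ∃ y ∈ hanoiAttractor α, wordMap α n w y = x) ∨
      ∃ e : Wire, e.1 < n ∧ ∃ t ∈ Icc (0 : ℝ) 1, e.param α t = x := by
  induction n with
  | zero => exact Or.inl ⟨Fin.elim0, x, hx, rfl⟩
  | succ n ih =>
    rcases ih with ⟨w, y, hy, rfl⟩ | ⟨e, he, t, ht, rfl⟩
    · rcases hanoiAttractor_cases h0 h1 hy with ⟨i, z, hz, rfl⟩ | ⟨i, t, ht, rfl⟩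
      · exact Or.inl ⟨Fin.snoc w i, z, hz, wordMap_snoc n w i z⟩
      · exact Or.inr ⟨⟨n, w, i⟩, Nat.lt_succ_self n, t, ht, wire_param_eq n w i t⟩
    · exact Or.inr ⟨e, he.trans (Nat.lt_succ_self n), t, ht, rfl⟩

/-- Distinct cells of the same level are disjoint. -/
theorem wordMap_cell_disjoint (h0 : 0 < α) (h1 : α < 1 / 3) (n : ℕ) {w v : Fin n → Fin 3}
    {x y : Plane} (hx : x ∈ hanoiAttractor α) (hy : y ∈ hanoiAttractor α)
    (hxy : wordMap α n w x = wordMap α n v y) : w = v := by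
  induction n with
  | zero => exact Subsingleton.elim _ _
  | succ n ih =>
    have hx' := wordMap_mem_hanoiAttractor h0 h1 n (Fin.tail w) hx
    have hy' := wordMap_mem_hanoiAttractor h0 h1 n (Fin.tail v) hy
    simp only [wordMap, Function.comp_apply] at hxy
    have h01 : w 0 = v 0 := by
      by_contra hne
      -- This coordinate is at least (1 + α)/2 on the cell at corner `w 0` and at most (1 − α)/2 on
      -- the other two.
      have h2 := congrArg (bary (w 0)) hxy
      rw [bary_cornerMap, bary_cornerMap, if_pos rfl, if_neg hne] at h2
      have h3 := hanoiAttractor_subset_triangle h0 h1 hx' (w 0)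
      have h4 := bary_le_one (hanoiAttractor_subset_triangle h0 h1 hy') (w 0)
      nlinarith
    rw [h01, cornerMap_eq, cornerMap_eq] at hxy
    have h2 : wordMap α n (Fin.tail w) x = wordMap α n (Fin.tail v) y := by
      have hs : (1 - α) / 2 ≠ 0 := by linarith
      simpa [AffineMap.lineMap_apply, hs] using hxy
    have h3 := ih h2
    rw [← Fin.cons_self_tail w, ← Fin.cons_self_tail v, h01, h3]

theorem norm_corner_sub (i : Fin 3) : ‖corner (i + 2) - corner (i + 1)‖ = 1 := by
  have h3 : √3 ^ 2 = 3 := Real.sq_sqrt (by norm_num)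
  rw [← sq_eq_sq₀ (norm_nonneg _) zero_le_one, EuclideanSpace.real_norm_sq_eq]
  fin_cases i <;> simp [corner, hanoiPoint, Fin.sum_univ_two] <;> nlinarith

theorem baseWire_sub (i : Fin 3) (s t : ℝ) :
    baseWire α i t - baseWire α i s = (α * (t - s)) • (corner (i + 2) - corner (i + 1)) := by
  simp only [baseWire, cornerMap_eq, AffineMap.lineMap_apply, vsub_eq_sub, vadd_eq_add]
  module

theorem dist_wire_param (h0 : 0 < α) (h1 : α < 1 / 3) (e : Wire) (s t : ℝ) :
    dist (e.param α t) (e.param α s) = wireLength α e.1 * |t - s| := by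
  obtain ⟨k, w, i⟩ := e
  rw [wire_param_eq, wire_param_eq, dist_wordMap h1, dist_eq_norm, baseWire_sub, norm_smul,
    norm_corner_sub, Real.norm_eq_abs, abs_mul, abs_of_pos h0, wireLength]
  ring

theorem wire_segment_eq (e : Wire) : e.segment α = e.param α '' Ioo 0 1 := by
  rw [Wire.segment, openSegment_eq_image_lineMap]
  rfl

/-- The closure of the wires is stable under all six maps, so it contains the attractor. This is
what makes μ charge open sets. -/
theorem hanoiAttractor_subset_closure_wires (h0 : 0 < α) (h1 : α < 1 / 3) :
    hanoiAttractor α ⊆ closure (hanoiWires α) := by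
  have hbase : ∀ i, ∀ t ∈ Icc (0 : ℝ) 1, baseWire α i t ∈ closure (hanoiWires α) := by
    intro i t ht
    rw [← closure_Ioo zero_ne_one] at ht
    have hc : Continuous (baseWire α i) := AffineMap.lineMap_continuous
    refine closure_mono ?_ (image_closure_subset_closure_image hc ⟨t, ht, rfl⟩)
    have : baseWire α i = Wire.param α ⟨0, Fin.elim0, i⟩ := funext fun t => (wire_param_eq 0 _ i t).symm
    rw [this, ← wire_segment_eq]
    exact subset_iUnion (fun e : Wire => e.segment α) _
  have hcm : ∀ i, Continuous (cornerMap α i) := fun i => (hanoiMap_lipschitz h0 h1 _).continuous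
  have htri : closure (hanoiWires α) ⊆ hanoiTriangle := by
    refine closure_minimal (iUnion_subset fun e => ?_) isClosed_hanoiTriangle
    rw [wire_segment_eq]
    rintro _ ⟨t, ht, rfl⟩
    exact hanoiAttractor_subset_triangle h0 h1
      (wire_param_mem_hanoiAttractor h0 h1 e (Ioo_subset_Icc_self ht))
  refine hanoiAttractor_subset h0 h1 isClosed_closure ⟨_, hbase 0 0 ⟨le_rfl, zero_le_one⟩⟩ ?_ ?_
  · intro i x hx
    refine closure_mono ?_ (image_closure_subset_closure_image (hcm i) ⟨x, hx, rfl⟩)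
    rintro _ ⟨y, hy, rfl⟩
    obtain ⟨⟨k, w, j⟩, he⟩ := mem_iUnion.1 hy
    rw [wire_segment_eq] at he
    obtain ⟨t, ht, rfl⟩ := he
    refine mem_iUnion.2 ⟨⟨k + 1, Fin.cons i w, j⟩, ?_⟩
    rw [wire_segment_eq]
    refine ⟨t, ht, ?_⟩
    rw [wire_param_eq, wire_param_eq]
    rfl
  · intro i x hx
    exact hbase i _ (edgeParam_mem (htri hx) i)

end Attr

end Geometry

/-! ### Monotonicity of the energies and oscillation estimates. -/

section Energy

/-- `u` is of class `H¹` on every wire. -/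
def WireH1 (α : ℝ) (u : Plane → ℝ) : Prop := ∀ e : Wire, IsH1 (u ∘ e.param α)

variable {α : ℝ}

theorem wireLength_pos (h0 : 0 < α) (h1 : α < 1 / 3) (k : ℕ) : 0 < wireLength α k := by
  have : 0 < (1 - α) / 2 := by linarith
  exact mul_pos h0 (pow_pos this k)

theorem rhoD_pos (h0 : 0 < α) (h1 : α < 1 / 3) (n : ℕ) : 0 < rhoD α n :=
  Finset.prod_pos fun i _ => by have := wireLength_pos h0 h1 i; positivity

theorem rhoD_succ (n : ℕ) : rhoD α (n + 1) = rhoD α n * (3 / (5 + 3 * wireLength α n)) :=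
  Finset.prod_range_succ _ _

/-- Each factor is at most 3/5 ≤ 16/25. Choosing a rational square gives √ρ^d_n the clean rate
(4/5)^n used in all oscillation bounds. -/
theorem rhoD_le (h0 : 0 < α) (h1 : α < 1 / 3) (n : ℕ) : rhoD α n ≤ ((4 / 5) ^ n) ^ 2 := by
  rw [← pow_mul, mul_comm, pow_mul]
  rw [rhoD, ← Finset.card_range n, ← Finset.prod_const, Finset.card_range]
  refine Finset.prod_le_prod (fun i _ => ?_) fun i _ => ?_
  · have := wireLength_pos h0 h1 i; positivity
  · have := wireLength_pos h0 h1 i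
    rw [div_le_iff₀ (by positivity)]
    linarith

theorem rhoC_pos (h0 : 0 < α) (h1 : α < 1 / 3) (k : ℕ) : 0 < rhoC α k := by
  have := wireLength_pos h0 h1 k
  have := rhoD_pos h0 h1 k
  rw [rhoC]
  positivity

theorem rhoC_le (h0 : 0 < α) (h1 : α < 1 / 3) (k : ℕ) : rhoC α k ≤ rhoD α k := by
  have := wireLength_pos h0 h1 k
  refine mul_le_of_le_one_right (rhoD_pos h0 h1 k).le ?_
  rw [div_le_one (by positivity)]
  linarith

theorem wireEnergy_eq (k : ℕ) (u v : Plane → ℝ) : wireEnergy α k u v =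
    ∑ e : (Fin k → Fin 3) × Fin 3,
      dirichletForm (u ∘ Wire.param α ⟨k, e⟩) (v ∘ Wire.param α ⟨k, e⟩) := rfl

theorem discreteEnergy_nonneg (n : ℕ) (u : Plane → ℝ) : 0 ≤ discreteEnergy α n u u :=
  Finset.sum_nonneg fun _ _ => Finset.sum_nonneg fun _ _ => mul_self_nonneg _

theorem wireEnergy_nonneg (k : ℕ) (u : Plane → ℝ) : 0 ≤ wireEnergy α k u u :=
  Finset.sum_nonneg fun _ _ => dirichletForm_self_nonneg _

theorem energyAt_nonneg (h0 : 0 < α) (h1 : α < 1 / 3) (n : ℕ) (u : Plane → ℝ) :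
    0 ≤ energyAt α n u u :=
  add_nonneg (mul_nonneg (inv_nonneg.2 (rhoD_pos h0 h1 n).le) (discreteEnergy_nonneg n u))
    (Finset.sum_nonneg fun k _ =>
      mul_nonneg (inv_nonneg.2 (rhoC_pos h0 h1 k).le) (wireEnergy_nonneg k u))

theorem cornerMap_corner (i : Fin 3) : cornerMap α i (corner i) = corner i := by
  rw [cornerMap_eq, AffineMap.lineMap_same, AffineMap.const_apply]

theorem sum_snoc (n : ℕ) (f : (Fin (n + 1) → Fin 3) → ℝ) :
    ∑ w, f w = ∑ w : Fin n → Fin 3, ∑ i : Fin 3, f (Fin.snoc w i : Fin (n + 1) → Fin 3) := by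
  rw [Finset.sum_comm, ← Fintype.sum_prod_type', ← (Fin.snocEquiv fun _ => Fin 3).sum_comp]
  rfl

/-- The trace inequality for one subdivision step of the network. -/
theorem network_trace_le {d : ℝ} (hd : 0 < d) (x : Fin 3 → Fin 3 → ℝ) :
    ∑ i, (x i i - x (i + 1) (i + 1)) * (x i i - x (i + 1) (i + 1)) ≤
      (5 + 3 * d) / 3 * ∑ i, ∑ j, (x i j - x i (j + 1)) * (x i j - x i (j + 1)) +
        (5 + 3 * d) / (3 * d) * ∑ i, (x (i + 2) (i + 1) - x (i + 1) (i + 2)) ^ 2 := by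
  obtain ⟨r, hr⟩ : ∃ r, r = 3 / (5 + 3 * d) := ⟨_, rfl⟩
  have hpos : 0 < 5 + 3 * d := by positivity
  have hr0 : 0 < r := by rw [hr]; positivity
  have e1 : (5 + 3 * d) / 3 = r⁻¹ := by rw [hr, inv_div]
  have e2 : (5 + 3 * d) / (3 * d) = r⁻¹ * d⁻¹ := by rw [hr, inv_div]; field_simp
  have e3 : r * (5 + 3 * d) = 3 := by rw [hr]; field_simp
  rw [e1, e2, ← sub_nonneg]
  -- The excess energy is a weighted sum of squares, measuring how far each potential drop is from
  -- that of the harmonic extension of the three outer values. It balances because r(5 + 3d) = 3. By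
  -- Δ–Y transformation this says that triangles of resistance r with wires of resistance rd have
  -- Y-arms r/3 + (2r/3 + rd)/3 = 1/3, as a triangle of unit resistances has.
  have key : r⁻¹ * ∑ i, ∑ j, (x i j - x i (j + 1)) * (x i j - x i (j + 1)) +
      r⁻¹ * d⁻¹ * ∑ i, (x (i + 2) (i + 1) - x (i + 1) (i + 2)) ^ 2 -
      ∑ i, (x i i - x (i + 1) (i + 1)) * (x i i - x (i + 1) (i + 1)) =
      r⁻¹ * ∑ i : Fin 3, (
        (x i i - x i (i + 1) -
          r * ((3 * x i i - 2 * x (i + 1) (i + 1) - x (i + 2) (i + 2)) / 3)) ^ 2 +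
        (x i i - x i (i + 2) -
          r * ((3 * x i i - x (i + 1) (i + 1) - 2 * x (i + 2) (i + 2)) / 3)) ^ 2 +
        (x i (i + 1) - x i (i + 2) - r * ((x (i + 1) (i + 1) - x (i + 2) (i + 2)) / 3)) ^ 2) +
      r⁻¹ * d⁻¹ * ∑ i : Fin 3, (x (i + 2) (i + 1) - x (i + 1) (i + 2) -
        r * d * (x (i + 2) (i + 2) - x (i + 1) (i + 1))) ^ 2 := by
    simp only [Fin.sum_univ_three, Fin.reduceAdd, zero_add]
    field_simp
    linear_combination (-3 * d * r * ((x 0 0 - x 1 1) ^ 2 + (x 1 1 - x 2 2) ^ 2 +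
      (x 2 2 - x 0 0) ^ 2)) * e3
  rw [key]
  positivity

/-- The network inequality is applied in each cell of level n, after bounding each new wire's
Dirichlet integral below by the squared difference of its end values. The factors ρ^d and ρ^c match
its coefficients. -/
theorem energyAt_le_succ (h0 : 0 < α) (h1 : α < 1 / 3) {u : Plane → ℝ} (hu : WireH1 α u)
    (n : ℕ) : energyAt α n u u ≤ energyAt α (n + 1) u u := by
  have hd := wireLength_pos h0 h1 n
  have hD := rhoD_pos h0 h1 n
  have hwire : ∑ w : Fin n → Fin 3, ∑ i : Fin 3,
      (u (wordMap α n w (cornerMap α (i + 2) (corner (i + 1)))) -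
        u (wordMap α n w (cornerMap α (i + 1) (corner (i + 2))))) ^ 2 ≤ wireEnergy α n u u := by
    rw [wireEnergy_eq, Fintype.sum_prod_type]
    refine Finset.sum_le_sum fun w _ => Finset.sum_le_sum fun i _ => ?_
    have := (hu ⟨n, w, i⟩).sq_sub_le (s := 0) (t := 1) (by simp) (by simp)
    simp only [Function.comp_apply, wire_param_eq, baseWire, AffineMap.lineMap_apply_one,
      AffineMap.lineMap_apply_zero, sub_zero, abs_one, one_mul] at this
    exact this
  have hdisc : discreteEnergy α n u u ≤
      (5 + 3 * wireLength α n) / 3 * discreteEnergy α (n + 1) u u +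
        (5 + 3 * wireLength α n) / (3 * wireLength α n) * wireEnergy α n u u := by
    refine le_trans ?_ (add_le_add_right (mul_le_mul_of_nonneg_left hwire (by positivity)) _)
    rw [discreteEnergy, discreteEnergy, sum_snoc, Finset.mul_sum, Finset.mul_sum,
      ← Finset.sum_add_distrib]
    refine Finset.sum_le_sum fun w _ => ?_
    have := network_trace_le hd fun i j => u (wordMap α n w (cornerMap α i (corner j)))
    simpa only [cornerMap_corner, wordMap_snoc] using this
  rw [energyAt, energyAt, Finset.sum_range_succ, rhoD_succ, rhoC]
  have h2 := mul_le_mul_of_nonneg_left hdisc (inv_nonneg.2 hD.le)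
  have e1 : (rhoD α n * (3 / (5 + 3 * wireLength α n)))⁻¹ =
      (rhoD α n)⁻¹ * ((5 + 3 * wireLength α n) / 3) := by
    rw [mul_inv, inv_div]
  have e2 : (rhoD α n * (3 * wireLength α n / (5 + 3 * wireLength α n)))⁻¹ =
      (rhoD α n)⁻¹ * ((5 + 3 * wireLength α n) / (3 * wireLength α n)) := by
    rw [mul_inv, inv_div]
  rw [e1, e2]
  linarith

theorem energyAt_mono (h0 : 0 < α) (h1 : α < 1 / 3) {u : Plane → ℝ} (hu : WireH1 α u) :
    Monotone fun n => energyAt α n u u :=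
  monotone_nat_of_le_succ (energyAt_le_succ h0 h1 hu)

theorem sq_sub_corner_le (h0 : 0 < α) (h1 : α < 1 / 3) {u : Plane → ℝ} {M : ℝ} {n : ℕ}
    (hM : energyAt α n u u ≤ M) (w : Fin n → Fin 3) (i j : Fin 3) :
    (u (wordMap α n w (corner i)) - u (wordMap α n w (corner j))) ^ 2 ≤ rhoD α n * M := by
  have hD := rhoD_pos h0 h1 n
  have h2 : discreteEnergy α n u u ≤ rhoD α n * M := by
    rw [← inv_mul_le_iff₀ hD]
    refine le_trans (le_add_of_nonneg_right ?_) hM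
    exact Finset.sum_nonneg fun k _ =>
      mul_nonneg (inv_nonneg.2 (rhoC_pos h0 h1 k).le) (wireEnergy_nonneg k u)
  have h3 : ∀ i, (u (wordMap α n w (corner i)) - u (wordMap α n w (corner (i + 1)))) ^ 2 ≤
      rhoD α n * M := by
    intro i
    refine le_trans ?_ h2
    refine le_trans ?_ (Finset.single_le_sum (f := fun w : Fin n → Fin 3 => ∑ i : Fin 3,
      (u (wordMap α n w (corner i)) - u (wordMap α n w (corner (i + 1)))) *
      (u (wordMap α n w (corner i)) - u (wordMap α n w (corner (i + 1)))))
      (fun _ _ => Finset.sum_nonneg fun _ _ => mul_self_nonneg _) (Finset.mem_univ w))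
    rw [pow_two]
    exact Finset.single_le_sum (f := fun i : Fin 3 =>
      (u (wordMap α n w (corner i)) - u (wordMap α n w (corner (i + 1)))) *
      (u (wordMap α n w (corner i)) - u (wordMap α n w (corner (i + 1)))))
      (fun _ _ => mul_self_nonneg _) (Finset.mem_univ i)
  -- Modulo 3, any two distinct indices are neighbours in one order or the other.
  have hcases : i = j ∨ j = i + 1 ∨ i = j + 1 := by revert i j; decide
  rcases hcases with rfl | rfl | rfl
  · rw [sub_self]
    exact le_trans (by simpa using sq_nonneg _) (h3 i)
  · exact h3 i
  · rw [← neg_sub, neg_sq]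
    exact h3 j

theorem dirichletForm_wire_le (h0 : 0 < α) (h1 : α < 1 / 3) {u : Plane → ℝ} {M : ℝ} (e : Wire)
    (hM : energyAt α (e.1 + 1) u u ≤ M) :
    dirichletForm (u ∘ e.param α) (u ∘ e.param α) ≤ rhoC α e.1 * M := by
  obtain ⟨k, e⟩ := e
  have hC := rhoC_pos h0 h1 k
  refine le_trans ?_ ((inv_mul_le_iff₀ hC).1 ?_ : wireEnergy α k u u ≤ _)
  · rw [wireEnergy_eq]
    exact Finset.single_le_sum (f := fun e : (Fin k → Fin 3) × Fin 3 =>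
      dirichletForm (u ∘ Wire.param α ⟨k, e⟩) (u ∘ Wire.param α ⟨k, e⟩))
      (fun _ _ => dirichletForm_self_nonneg _) (Finset.mem_univ e)
  · refine le_trans ?_ hM
    rw [energyAt, Finset.sum_range_succ]
    have h2 := mul_nonneg (inv_nonneg.2 (rhoD_pos h0 h1 (k + 1)).le)
      (discreteEnergy_nonneg (α := α) (k + 1) u)
    have h3 : 0 ≤ ∑ k ∈ Finset.range k, (rhoC α k)⁻¹ * wireEnergy α k u u :=
      Finset.sum_nonneg fun k _ =>
        mul_nonneg (inv_nonneg.2 (rhoC_pos h0 h1 k).le) (wireEnergy_nonneg k u)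
    linarith

theorem sq_sub_wire_le (h0 : 0 < α) (h1 : α < 1 / 3) {u : Plane → ℝ} {M : ℝ} (hu : WireH1 α u)
    (e : Wire) (hM : energyAt α (e.1 + 1) u u ≤ M) {s t : ℝ} (hs : s ∈ Icc (0 : ℝ) 1)
    (ht : t ∈ Icc (0 : ℝ) 1) :
    (u (e.param α t) - u (e.param α s)) ^ 2 ≤ |t - s| * (rhoD α e.1 * M) := by
  have hM0 : 0 ≤ M := (energyAt_nonneg h0 h1 _ u).trans hM
  refine ((hu e).sq_sub_le hs ht).trans ?_
  gcongr
  exact (dirichletForm_wire_le h0 h1 e hM).trans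
    (mul_le_mul_of_nonneg_right (rhoC_le h0 h1 e.1) hM0)

theorem abs_le_of_sq_le_rhoD (h0 : 0 < α) (h1 : α < 1 / 3) {M a : ℝ} (hM : 0 ≤ M) {n : ℕ}
    (h : a ^ 2 ≤ rhoD α n * M) : |a| ≤ √M * (4 / 5) ^ n := by
  refine abs_le_of_sq_le_sq ?_ (by positivity)
  rw [mul_pow, Real.sq_sqrt hM, mul_comm]
  exact h.trans (mul_le_mul_of_nonneg_right (rhoD_le h0 h1 n) hM)

/-- Functions of finite energy oscillate little on small cells. -/
theorem abs_sub_cell_le (h0 : 0 < α) (h1 : α < 1 / 3) {u : Plane → ℝ} (hu : WireH1 α u)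
    (hc : ContinuousOn u (hanoiAttractor α)) {M : ℝ} (hM : ∀ n, energyAt α n u u ≤ M)
    (n : ℕ) (w : Fin n → Fin 3) (i : Fin 3) {x : Plane} (hx : x ∈ hanoiAttractor α) :
    |u (wordMap α n w x) - u (wordMap α n w (corner i))| ≤ 15 * √M * (4 / 5) ^ n := by
  have hM0 : 0 ≤ M := (energyAt_nonneg h0 h1 0 u).trans (hM 0)
  have hK := (hanoiAttractor_spec h0 h1).1.1
  refine le_of_forall_pos_le_add fun ε hε => ?_
  -- Uniform continuity supplies the start at deep levels, at the price of an ε that is finally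
  -- arbitrary.
  obtain ⟨N, hN⟩ : ∃ N, ∀ m ≥ N, ∀ w : Fin m → Fin 3, ∀ i, ∀ x ∈ hanoiAttractor α,
      |u (wordMap α m w x) - u (wordMap α m w (corner i))| ≤ ε := by
    obtain ⟨δ, hδ, hδ'⟩ := Metric.uniformContinuousOn_iff_le.1
      (hK.uniformContinuousOn_of_continuous hc) ε hε
    obtain ⟨B, hB⟩ := Metric.isBounded_iff.1 hK.isBounded
    have hlim : Tendsto (fun m : ℕ => ((1 - α) / 2) ^ m * B) atTop (𝓝 (0 * B)) :=
      (tendsto_pow_atTop_nhds_zero_of_lt_one (by linarith) (by linarith)).mul_const B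
    rw [zero_mul] at hlim
    obtain ⟨N, hN⟩ := eventually_atTop.1 (hlim.eventually (ge_mem_nhds hδ))
    refine ⟨N, fun m hm w i x hx => ?_⟩
    rw [← Real.dist_eq]
    have hp := corner_mem_hanoiAttractor h0 h1 i
    refine hδ' _ (wordMap_mem_hanoiAttractor h0 h1 m w hx) _
      (wordMap_mem_hanoiAttractor h0 h1 m w hp) ?_
    rw [dist_wordMap h1]
    refine le_trans ?_ (hN m hm)
    have hs : 0 ≤ (1 - α) / 2 := by linarith
    exact mul_le_mul_of_nonneg_left (hB hx hp) (by positivity)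
  -- Downward induction on the level. With s = √M (4/5)^n, passing to a subcell costs s + (4/5)·15 s
  -- = 13 s, and reaching a point of a wire costs s + (4/5)s + s; both stay below 15 s.
  have key : ∀ k n, N ≤ n + k → ∀ w : Fin n → Fin 3, ∀ i, ∀ x ∈ hanoiAttractor α,
      |u (wordMap α n w x) - u (wordMap α n w (corner i))| ≤ 15 * √M * (4 / 5) ^ n + ε := by
    intro k
    induction k with
    | zero =>
      intro n hn w i x hx
      refine (hN n hn w i x hx).trans (le_add_of_nonneg_left (by positivity))
    | succ k ih =>
      intro n hn w i x hx
      have hcor : ∀ j, |u (wordMap α n w (corner j)) - u (wordMap α n w (corner i))| ≤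
          √M * (4 / 5) ^ n := fun j =>
        abs_le_of_sq_le_rhoD h0 h1 hM0 (sq_sub_corner_le h0 h1 (hM n) w j i)
      have hs : (0 : ℝ) ≤ √M * (4 / 5) ^ n := by positivity
      rcases hanoiAttractor_cases h0 h1 hx with ⟨j, y, hy, rfl⟩ | ⟨j, t, ht, rfl⟩
      · have h2 := ih (n + 1) (by omega) (Fin.snoc w j) j y hy
        rw [wordMap_snoc, wordMap_snoc, cornerMap_corner, pow_succ] at h2
        have h3 := hcor j
        rw [abs_le] at h2 h3 ⊢
        constructor <;> linarith
      · have h2 := abs_le_of_sq_le_rhoD h0 h1 hM0 (n := n) (M := M)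
          (a := u (wordMap α n w (baseWire α j t)) - u (wordMap α n w (baseWire α j 0))) (by
            have := sq_sub_wire_le h0 h1 hu ⟨n, w, j⟩ (hM _) ⟨le_rfl, zero_le_one⟩ ht
            rw [wire_param_eq, wire_param_eq, sub_zero, abs_of_nonneg ht.1] at this
            exact this.trans (mul_le_of_le_one_left
              (mul_nonneg (rhoD_pos h0 h1 n).le hM0) ht.2))
        have h3 := abs_le_of_sq_le_rhoD h0 h1 hM0
          (sq_sub_corner_le h0 h1 (hM (n + 1)) (Fin.snoc w (j + 1)) (j + 2) (j + 1))
        rw [wordMap_snoc, wordMap_snoc, cornerMap_corner, pow_succ] at h3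
        have h4 := hcor (j + 1)
        have h5 : baseWire α j 0 = cornerMap α (j + 1) (corner (j + 2)) :=
          AffineMap.lineMap_apply_zero _ _
        rw [h5] at h2
        rw [abs_le] at h2 h3 h4 ⊢
        constructor <;> linarith
  exact key N n (Nat.le_add_left _ _) w i x hx

theorem abs_sub_cell_le' (h0 : 0 < α) (h1 : α < 1 / 3) {u : Plane → ℝ} (hu : WireH1 α u)
    (hc : ContinuousOn u (hanoiAttractor α)) {M : ℝ} (hM : ∀ n, energyAt α n u u ≤ M)
    (n : ℕ) (w : Fin n → Fin 3) {x y : Plane} (hx : x ∈ hanoiAttractor α)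
    (hy : y ∈ hanoiAttractor α) :
    |u (wordMap α n w x) - u (wordMap α n w y)| ≤ 30 * √M * (4 / 5) ^ n := by
  have h2 := abs_sub_cell_le h0 h1 hu hc hM n w 0 hx
  have h3 := abs_sub_cell_le h0 h1 hu hc hM n w 0 hy
  rw [abs_le] at h2 h3 ⊢
  constructor <;> linarith

theorem abs_sub_le_of_energy_le (h0 : 0 < α) (h1 : α < 1 / 3) {u : Plane → ℝ} (hu : WireH1 α u)
    (hc : ContinuousOn u (hanoiAttractor α)) {M : ℝ} (hM : ∀ n, energyAt α n u u ≤ M)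
    {x y : Plane} (hx : x ∈ hanoiAttractor α) (hy : y ∈ hanoiAttractor α) :
    |u x - u y| ≤ 30 * √M := by
  simpa [wordMap] using abs_sub_cell_le' h0 h1 hu hc hM 0 Fin.elim0 hx hy

theorem finite_wire_lt (n : ℕ) : {e : Wire | e.1 < n}.Finite := by
  have : {e : Wire | e.1 < n} = ⋃ k : Fin n, range fun e : (Fin k → Fin 3) × Fin 3 =>
      (⟨k, e⟩ : Wire) := by
    ext ⟨k, e⟩
    simp only [mem_ofPred_eq, mem_iUnion, mem_range]
    constructor
    · intro h
      exact ⟨⟨k, h⟩, e, rfl⟩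
    · rintro ⟨⟨j, hj⟩, e', h⟩
      cases h
      exact hj
  rw [this]
  exact finite_iUnion fun k => finite_range _

/-- Functions of energy at most `M` are equicontinuous. -/
theorem exists_equicontinuity (h0 : 0 < α) (h1 : α < 1 / 3) {M : ℝ} (hM0 : 0 ≤ M) (x : Plane)
    {ε : ℝ} (hε : 0 < ε) :
    ∀ᶠ y in 𝓝 x, y ∈ hanoiAttractor α → ∀ u : Plane → ℝ, WireH1 α u →
      ContinuousOn u (hanoiAttractor α) → (∀ n, energyAt α n u u ≤ M) → |u x - u y| ≤ ε := by
  have hK := (hanoiAttractor_spec h0 h1).1.1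
  obtain ⟨n, hn⟩ : ∃ n : ℕ, 30 * √M * (4 / 5) ^ n ≤ ε := by
    have hlim : Tendsto (fun m : ℕ => 30 * √M * (4 / 5 : ℝ) ^ m) atTop (𝓝 (30 * √M * 0)) :=
      (tendsto_pow_atTop_nhds_zero_of_lt_one (by norm_num) (by norm_num)).const_mul _
    rw [mul_zero] at hlim
    exact (hlim.eventually (ge_mem_nhds hε)).exists
  -- δ bounds the parameter distance along a wire, on which the squared oscillation is at most δM.
  obtain ⟨δ, hδ, hδ'⟩ : ∃ δ > 0, δ * M ≤ ε ^ 2 :=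
    ⟨ε ^ 2 / (M + 1), by positivity, by
      rw [div_mul_eq_mul_div, div_le_iff₀ (by positivity)]
      nlinarith [sq_nonneg ε]⟩
  have hfin := finite_wire_lt n
  -- Closed pieces of the finite cover that miss x also miss a neighbourhood of x, so a nearby y
  -- always shares its cell or wire with x.
  have hcell : ∀ᶠ y in 𝓝 x, ∀ w : Fin n → Fin 3, y ∈ wordMap α n w '' hanoiAttractor α →
      x ∈ wordMap α n w '' hanoiAttractor α := by
    refine eventually_all.2 fun w => ?_
    by_cases hx : x ∈ wordMap α n w '' hanoiAttractor α
    · exact Eventually.of_forall fun y _ => hx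
    · have hcl := (hK.image (continuous_wordMap (α := α) n w)).isClosed
      filter_upwards [hcl.isOpen_compl.mem_nhds hx] with y hy hy'
      exact absurd hy' hy
  have hwire : ∀ᶠ y in 𝓝 x, ∀ e ∈ {e : Wire | e.1 < n}, y ∈ e.param α '' Icc 0 1 →
      x ∈ e.param α '' Icc 0 1 ∧ dist x y < wireLength α e.1 * δ := by
    refine (eventually_all_finite hfin).2 fun e _ => ?_
    have hd : ∀ᶠ y in 𝓝 x, dist x y < wireLength α e.1 * δ := by
      have := Metric.ball_mem_nhds x (mul_pos (wireLength_pos h0 h1 e.1) hδ)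
      filter_upwards [this] with y hy
      rwa [dist_comm]
    by_cases hx : x ∈ e.param α '' Icc 0 1
    · filter_upwards [hd] with y hy _ using ⟨hx, hy⟩
    · have hcl := ((isCompact_Icc (a := (0 : ℝ)) (b := 1)).image (f := e.param α)
        AffineMap.lineMap_continuous).isClosed
      filter_upwards [hcl.isOpen_compl.mem_nhds hx] with y hy hy'
      exact absurd hy' hy
  filter_upwards [hcell, hwire] with y hy1 hy2 hy u hu hc hM
  rcases hanoiAttractor_cover h0 h1 hy n with ⟨w, z, hz, rfl⟩ | ⟨e, he, t, ht, rfl⟩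
  · obtain ⟨z', hz', rfl⟩ := hy1 w ⟨z, hz, rfl⟩
    exact (abs_sub_cell_le' h0 h1 hu hc hM n w hz' hz).trans hn
  · obtain ⟨⟨s, hs, rfl⟩, hd⟩ := hy2 e he ⟨t, ht, rfl⟩
    rw [dist_wire_param h0 h1, mul_lt_mul_iff_right₀ (wireLength_pos h0 h1 e.1)] at hd
    refine abs_le_of_sq_le_sq ?_ hε.le
    refine (sq_sub_wire_le h0 h1 hu e (hM _) ht hs).trans (le_trans ?_ hδ')
    have h2 : rhoD α e.1 * M ≤ M := by
      refine mul_le_of_le_one_left hM0 ((rhoD_le h0 h1 _).trans ?_)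
      exact pow_le_one₀ (by positivity) (pow_le_one₀ (by norm_num) (by norm_num))
    exact mul_le_mul hd.le h2 (mul_nonneg (rhoD_pos h0 h1 _).le hM0) hδ.le

end Energy

/-! ### The limit form: bilinearity, closedness and compactness. -/

section EnergyForm

variable {α : ℝ}

theorem WireH1.add {u v : Plane → ℝ} (hu : WireH1 α u) (hv : WireH1 α v) : WireH1 α (u + v) :=
  fun e => (hu e).add (hv e)

theorem WireH1.smul {u : Plane → ℝ} (hu : WireH1 α u) (c : ℝ) : WireH1 α (c • u) :=
  fun e => (hu e).smul c

theorem WireH1.sub {u v : Plane → ℝ} (hu : WireH1 α u) (hv : WireH1 α v) : WireH1 α (u - v) :=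
  fun e => (hu e).sub (hv e)

theorem energyAt_comm (n : ℕ) (u v : Plane → ℝ) : energyAt α n u v = energyAt α n v u := by
  simp only [energyAt, discreteEnergy, wireEnergy, mul_comm]

theorem energyAt_add_left (n : ℕ) {u v w : Plane → ℝ} (hu : WireH1 α u) (hv : WireH1 α v)
    (hw : WireH1 α w) : energyAt α n (u + v) w = energyAt α n u w + energyAt α n v w := by
  have hd : discreteEnergy α n (u + v) w = discreteEnergy α n u w + discreteEnergy α n v w := by
    simp only [discreteEnergy, ← Finset.sum_add_distrib, Pi.add_apply]
    exact Finset.sum_congr rfl fun _ _ => Finset.sum_congr rfl fun _ _ => by ring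
  have hk : ∀ k, wireEnergy α k (u + v) w = wireEnergy α k u w + wireEnergy α k v w := fun k => by
    simp only [wireEnergy_eq, ← Finset.sum_add_distrib]
    exact Finset.sum_congr rfl fun e _ => dirichletForm_add_left (hu _) (hv _) (hw _)
  simp only [energyAt, hd, hk, mul_add, Finset.sum_add_distrib]
  ring

theorem energyAt_smul_left (n : ℕ) (c : ℝ) (u w : Plane → ℝ) :
    energyAt α n (c • u) w = c * energyAt α n u w := by
  have hd : discreteEnergy α n (c • u) w = c * discreteEnergy α n u w := by
    simp only [discreteEnergy, Finset.mul_sum, Pi.smul_apply, smul_eq_mul]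
    exact Finset.sum_congr rfl fun _ _ => Finset.sum_congr rfl fun _ _ => by ring
  have hk : ∀ k, wireEnergy α k (c • u) w = c * wireEnergy α k u w := fun k => by
    simp only [wireEnergy_eq, Finset.mul_sum]
    exact Finset.sum_congr rfl fun e _ => dirichletForm_smul_left c _ _
  simp only [energyAt, hd, hk, mul_add, Finset.mul_sum]
  congr 1
  · ring
  · exact Finset.sum_congr rfl fun _ _ => by ring

theorem energyAt_add_self (n : ℕ) {u v : Plane → ℝ} (hu : WireH1 α u) (hv : WireH1 α v) :
    energyAt α n (u + v) (u + v) =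
      energyAt α n u u + 2 * energyAt α n u v + energyAt α n v v := by
  rw [energyAt_add_left n hu hv (hu.add hv), energyAt_comm n u (u + v),
    energyAt_comm n v (u + v), energyAt_add_left n hu hv hu, energyAt_add_left n hu hv hv,
    energyAt_comm n v u]
  ring

theorem energyAt_sub_self (n : ℕ) {u v : Plane → ℝ} (hu : WireH1 α u) (hv : WireH1 α v) :
    energyAt α n (u - v) (u - v) =
      energyAt α n u u - 2 * energyAt α n u v + energyAt α n v v := by
  have h : u - v = u + (-1 : ℝ) • v := by rw [neg_one_smul, sub_eq_add_neg]
  rw [h, energyAt_add_self n hu (hv.smul _), energyAt_comm n u ((-1 : ℝ) • v),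
    energyAt_smul_left, energyAt_smul_left, energyAt_comm n v ((-1 : ℝ) • v), energyAt_smul_left, energyAt_comm n v u]
  ring

theorem energyAt_add_le (h0 : 0 < α) (h1 : α < 1 / 3) (n : ℕ) {u v : Plane → ℝ}
    (hu : WireH1 α u) (hv : WireH1 α v) : energyAt α n (u + v) (u + v) ≤
      2 * energyAt α n u u + 2 * energyAt α n v v := by
  have := energyAt_nonneg h0 h1 n (u - v)
  rw [energyAt_sub_self n hu hv] at this
  rw [energyAt_add_self n hu hv]
  linarith

theorem extendZero_apply {u : C(hanoiAttractor α, ℝ)} {x : Plane} (hx : x ∈ hanoiAttractor α) :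
    extendZero α u x = u ⟨x, hx⟩ := dif_pos hx

theorem extendZero_add (u v : C(hanoiAttractor α, ℝ)) :
    extendZero α (u + v) = extendZero α u + extendZero α v := by
  ext x
  by_cases hx : x ∈ hanoiAttractor α <;> simp [extendZero, hx]

theorem extendZero_smul (c : ℝ) (u : C(hanoiAttractor α, ℝ)) :
    extendZero α (c • u) = c • extendZero α u := by
  ext x
  by_cases hx : x ∈ hanoiAttractor α <;> simp [extendZero, hx]

theorem extendZero_sub (u v : C(hanoiAttractor α, ℝ)) :
    extendZero α (u - v) = extendZero α u - extendZero α v := by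
  ext x
  by_cases hx : x ∈ hanoiAttractor α <;> simp [extendZero, hx]

theorem continuousOn_extendZero (u : C(hanoiAttractor α, ℝ)) :
    ContinuousOn (extendZero α u) (hanoiAttractor α) := by
  rw [continuousOn_iff_continuous_domRestrict]
  convert u.continuous using 1
  ext x
  exact extendZero_apply x.2

/-- The energy at level `n` of a continuous function on the attractor. -/
noncomputable abbrev levelEnergy (n : ℕ) (u : C(hanoiAttractor α, ℝ)) : ℝ :=
  energyAt α n (extendZero α u) (extendZero α u)

/-- The energies increase with the level, so convergence amounts to boundedness, which is easier to
verify for sums, compositions and limits. -/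
theorem mem_neumannDomain_iff (h0 : 0 < α) (h1 : α < 1 / 3) {u : C(hanoiAttractor α, ℝ)} :
    u ∈ neumannDomain α ↔ WireH1 α (extendZero α u) ∧ ∃ M, ∀ n, levelEnergy n u ≤ M := by
  refine and_congr_right fun hu => ⟨fun ⟨L, hL⟩ => ⟨L, fun n => ?_⟩, fun ⟨M, hM⟩ => ?_⟩
  · exact (energyAt_mono h0 h1 hu).ge_of_tendsto hL n
  · exact ⟨_, tendsto_atTop_ciSup (energyAt_mono h0 h1 hu) ⟨M, forall_mem_range.2 hM⟩⟩

/-- The energy domain as a space of functions. -/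
def neumannSubmodule (h0 : 0 < α) (h1 : α < 1 / 3) : Submodule ℝ C(hanoiAttractor α, ℝ) where
  carrier := neumannDomain α
  add_mem' {u v} hu hv := by
    obtain ⟨hu, M, hM⟩ := (mem_neumannDomain_iff h0 h1).1 hu
    obtain ⟨hv, N, hN⟩ := (mem_neumannDomain_iff h0 h1).1 hv
    rw [mem_neumannDomain_iff h0 h1, extendZero_add]
    refine ⟨hu.add hv, 2 * M + 2 * N, fun n => ?_⟩
    rw [levelEnergy, extendZero_add]
    linarith [energyAt_add_le h0 h1 n hu hv, hM n, hN n]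
  zero_mem' := by
    have h : extendZero α (0 : C(hanoiAttractor α, ℝ)) = (0 : ℝ) • fun _ => 0 := by
      ext x
      by_cases hx : x ∈ hanoiAttractor α <;> simp [extendZero, hx]
    rw [mem_neumannDomain_iff h0 h1]
    refine ⟨fun e => ?_, 0, fun n => ?_⟩
    · rw [h]
      exact isH1_of_lipschitzOn (K := 0) (LipschitzOnWith.of_dist_le_mul (by simp))
    · rw [levelEnergy, h, energyAt_smul_left, zero_mul]
  smul_mem' c u hu := by
    obtain ⟨hu, M, hM⟩ := (mem_neumannDomain_iff h0 h1).1 hu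
    rw [mem_neumannDomain_iff h0 h1, extendZero_smul]
    refine ⟨hu.smul c, c * (c * M), fun n => ?_⟩
    rw [levelEnergy, extendZero_smul, energyAt_smul_left, energyAt_comm, energyAt_smul_left,
      ← mul_assoc, ← mul_assoc]
    exact mul_le_mul_of_nonneg_left (hM n) (mul_self_nonneg c)

variable (h0 : 0 < α) (h1 : α < 1 / 3)

/-- Polarization: the mixed energies are a quarter of the difference of the energies of u + v and u
− v, both of which converge. -/
theorem exists_hasEnergy {u v : C(hanoiAttractor α, ℝ)} (hu : u ∈ neumannSubmodule h0 h1)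
    (hv : v ∈ neumannSubmodule h0 h1) : ∃ c, HasEnergy α u v c := by
  obtain ⟨-, A, hA⟩ := add_mem hu hv
  obtain ⟨-, B, hB⟩ := sub_mem hu hv
  refine ⟨(A - B) / 4, ?_⟩
  refine ((hA.sub hB).div_const 4).congr fun n => ?_
  rw [extendZero_add, extendZero_sub, energyAt_add_self n hu.1 hv.1, energyAt_sub_self n hu.1 hv.1]
  ring

/-- The limit energy. -/
noncomputable def limitEnergy (u v : C(hanoiAttractor α, ℝ)) : ℝ :=
  limUnder atTop fun n => energyAt α n (extendZero α u) (extendZero α v)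

theorem hasEnergy_limitEnergy {u v : C(hanoiAttractor α, ℝ)} (hu : u ∈ neumannSubmodule h0 h1)
    (hv : v ∈ neumannSubmodule h0 h1) : HasEnergy α u v (limitEnergy u v) :=
  tendsto_nhds_limUnder (exists_hasEnergy h0 h1 hu hv)

theorem HasEnergy.unique {u v : C(hanoiAttractor α, ℝ)} {a b : ℝ} (ha : HasEnergy α u v a)
    (hb : HasEnergy α u v b) : a = b := tendsto_nhds_unique ha hb

theorem limitEnergy_comm (u v : C(hanoiAttractor α, ℝ)) : limitEnergy u v = limitEnergy v u := by
  simp only [limitEnergy, energyAt_comm]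

theorem levelEnergy_le {u : C(hanoiAttractor α, ℝ)} (hu : u ∈ neumannSubmodule h0 h1) (n : ℕ) :
    levelEnergy n u ≤ limitEnergy u u :=
  (energyAt_mono h0 h1 hu.1).ge_of_tendsto (hasEnergy_limitEnergy h0 h1 hu hu) n

theorem limitEnergy_le {u : C(hanoiAttractor α, ℝ)} (hu : u ∈ neumannSubmodule h0 h1) {M : ℝ}
    (h : ∀ n, levelEnergy n u ≤ M) : limitEnergy u u ≤ M :=
  le_of_tendsto' (hasEnergy_limitEnergy h0 h1 hu hu) h

theorem limitEnergy_self_nonneg {u : C(hanoiAttractor α, ℝ)} (hu : u ∈ neumannSubmodule h0 h1) :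
    0 ≤ limitEnergy u u :=
  ge_of_tendsto' (hasEnergy_limitEnergy h0 h1 hu hu) fun n => energyAt_nonneg h0 h1 n _

/-- The energy form on a subspace of the energy domain. -/
noncomputable def energyForm (p : Submodule ℝ C(hanoiAttractor α, ℝ))
    (hp : p ≤ neumannSubmodule h0 h1) : LinearMap.BilinForm ℝ p :=
  have hadd : ∀ u v w : p, limitEnergy (u + v : C(hanoiAttractor α, ℝ)) w =
      limitEnergy (u : C(hanoiAttractor α, ℝ)) w + limitEnergy (v : C(hanoiAttractor α, ℝ)) w :=
    fun u v w => by
      refine HasEnergy.unique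
        (hasEnergy_limitEnergy h0 h1 (add_mem (hp u.2) (hp v.2)) (hp w.2)) ?_
      refine ((hasEnergy_limitEnergy h0 h1 (hp u.2) (hp w.2)).add
        (hasEnergy_limitEnergy h0 h1 (hp v.2) (hp w.2))).congr fun n => ?_
      rw [extendZero_add, energyAt_add_left n (hp u.2).1 (hp v.2).1 (hp w.2).1]
  have hsmul : ∀ (c : ℝ) (u w : p), limitEnergy (c • u : C(hanoiAttractor α, ℝ)) w =
      c * limitEnergy (u : C(hanoiAttractor α, ℝ)) w := fun c u w => by
    refine HasEnergy.unique
      (hasEnergy_limitEnergy h0 h1 (Submodule.smul_mem _ c (hp u.2)) (hp w.2)) ?_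
    refine ((hasEnergy_limitEnergy h0 h1 (hp u.2) (hp w.2)).const_mul c).congr fun n => ?_
    rw [extendZero_smul, energyAt_smul_left]
  LinearMap.mk₂ ℝ (fun u v => limitEnergy (u : C(hanoiAttractor α, ℝ)) v)
    (fun u v w => hadd u v w) (fun c u w => hsmul c u w)
    (fun u v w => by
      simp only [limitEnergy_comm (u : C(hanoiAttractor α, ℝ))]; exact hadd v w u)
    (fun c u w => by
      simp only [limitEnergy_comm (u : C(hanoiAttractor α, ℝ))]; exact hsmul c w u)

theorem energyForm_apply (p : Submodule ℝ C(hanoiAttractor α, ℝ))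
    (hp : p ≤ neumannSubmodule h0 h1) (u v : p) :
    energyForm h0 h1 p hp u v = limitEnergy (u : C(hanoiAttractor α, ℝ)) v := rfl

theorem abs_sub_le_limitEnergy {u : C(hanoiAttractor α, ℝ)} (hu : u ∈ neumannSubmodule h0 h1)
    (x y : hanoiAttractor α) : |u x - u y| ≤ 30 * √(limitEnergy u u) := by
  have := abs_sub_le_of_energy_le h0 h1 hu.1 (continuousOn_extendZero u) (levelEnergy_le h0 h1 hu)
    x.2 y.2
  rwa [extendZero_apply x.2, extendZero_apply y.2] at this

/-- The domain of the energy is complete, for uniform convergence combined with energy. -/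
theorem mem_neumannSubmodule_of_tendsto [CompactSpace (hanoiAttractor α)]
    {u : ℕ → C(hanoiAttractor α, ℝ)} {v : C(hanoiAttractor α, ℝ)}
    (hu : ∀ n, u n ∈ neumannSubmodule h0 h1) (huv : Tendsto u atTop (𝓝 v))
    (hcau : ∀ ε > 0, ∃ N, ∀ m ≥ N, ∀ n ≥ N, limitEnergy (u m - u n) (u m - u n) < ε) :
    v ∈ neumannSubmodule h0 h1 ∧
      Tendsto (fun n => limitEnergy (u n - v) (u n - v)) atTop (𝓝 0) := by
  have hpt : ∀ x ∈ hanoiAttractor α,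
      Tendsto (fun n => extendZero α (u n) x) atTop (𝓝 (extendZero α v x)) := fun x hx => by
    simp only [extendZero_apply hx]
    exact ((continuous_eval_const _).tendsto v).comp huv
  have hwire : ∀ e : Wire, IsH1 (extendZero α v ∘ e.param α) ∧
      Tendsto (fun n => dirichletForm (extendZero α (u n - v) ∘ e.param α)
        (extendZero α (u n - v) ∘ e.param α)) atTop (𝓝 0) := fun e => by
    simp only [extendZero_sub, Pi.sub_comp]
    refine isH1_of_tendsto (fun n => (hu n).1 e)
      (fun t ht => hpt _ (wire_param_mem_hanoiAttractor h0 h1 e ht)) fun ε hε => ?_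
    have hC := rhoC_pos h0 h1 e.1
    obtain ⟨N, hN⟩ := hcau (ε / rhoC α e.1) (by positivity)
    refine ⟨N, fun m hm n hn => ?_⟩
    have h2 := dirichletForm_wire_le h0 h1 e
      (levelEnergy_le h0 h1 (sub_mem (hu m) (hu n)) (e.1 + 1))
    rw [extendZero_sub, Pi.sub_comp] at h2
    refine h2.trans_lt ?_
    have := hN m hm n hn
    rwa [lt_div_iff₀' hC] at this
  have hvH : WireH1 α (extendZero α v) := fun e => (hwire e).1
  -- At a fixed level only finitely many vertices and wires contribute, so convergence there is
  -- termwise.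
  have hlev : ∀ n, Tendsto (fun m => levelEnergy n (u m - v)) atTop (𝓝 0) := by
    intro n
    have hpt' : ∀ x ∈ hanoiAttractor α,
        Tendsto (fun m => extendZero α (u m - v) x) atTop (𝓝 0) := fun x hx => by
      have := (hpt x hx).sub_const (extendZero α v x)
      simp only [extendZero_sub, Pi.sub_apply]
      rwa [sub_self] at this
    have hd : Tendsto (fun m => discreteEnergy α n (extendZero α (u m - v))
        (extendZero α (u m - v))) atTop (𝓝 0) := by
      have : (0 : ℝ) = ∑ w : Fin n → Fin 3, ∑ i : Fin 3, (0 - 0) * (0 - 0) := by simp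
      rw [this]
      refine tendsto_finsetSum _ fun w _ => tendsto_finsetSum _ fun i _ => ?_
      have h2 : ∀ i, Tendsto (fun m => extendZero α (u m - v) (wordMap α n w (corner i)))
          atTop (𝓝 0) := fun i =>
        hpt' _ (wordMap_mem_hanoiAttractor h0 h1 n w (corner_mem_hanoiAttractor h0 h1 i))
      exact ((h2 _).sub (h2 _)).mul ((h2 _).sub (h2 _))
    have hw : ∀ k, Tendsto (fun m => wireEnergy α k (extendZero α (u m - v))
        (extendZero α (u m - v))) atTop (𝓝 0) := fun k => by
      have : (0 : ℝ) = ∑ e : (Fin k → Fin 3) × Fin 3, 0 := by simp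
      rw [this]
      exact tendsto_finsetSum _ fun e _ => (hwire ⟨k, e⟩).2
    have := (hd.const_mul (rhoD α n)⁻¹).add
      (tendsto_finsetSum (Finset.range n) fun k _ => (hw k).const_mul (rhoC α k)⁻¹)
    simp only [levelEnergy, energyAt]
    simpa using this
  -- Write u m − v = (u m − u k) + (u k − v) and let k → ∞ at a fixed level n. The resulting bound
  -- does not depend on n, so it survives in the limit energy.
  have hsub : ∀ ε > 0, ∃ N, ∀ m ≥ N, ∀ n, levelEnergy n (u m - v) ≤ ε := fun ε hε => by
    obtain ⟨N, hN⟩ := hcau (ε / 2) (by positivity)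
    refine ⟨N, fun m hm n => ?_⟩
    have h2 : Tendsto (fun k => 2 * (ε / 2) + 2 * levelEnergy n (u k - v)) atTop
        (𝓝 (2 * (ε / 2) + 2 * 0)) := ((hlev n).const_mul 2).const_add _
    have h3 : 2 * (ε / 2) + 2 * 0 = ε := by ring
    rw [h3] at h2
    refine ge_of_tendsto h2 ?_
    filter_upwards [eventually_ge_atTop N] with k hk
    have h4 : u m - v = (u m - u k) + (u k - v) := by abel
    have h5 := energyAt_add_le h0 h1 n (u := extendZero α (u m - u k))
      (v := extendZero α (u k - v)) (by rw [extendZero_sub]; exact WireH1.sub (hu m).1 (hu k).1)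
      (by rw [extendZero_sub]; exact WireH1.sub (hu k).1 hvH)
    rw [← extendZero_add, ← h4] at h5
    have h6 := levelEnergy_le h0 h1 (sub_mem (hu m) (hu k)) n
    have h7 := hN m hm k hk
    linarith
  have hmem : ∀ m, WireH1 α (extendZero α (u m - v)) := fun m => by
    rw [extendZero_sub]; exact WireH1.sub (hu m).1 hvH
  have hsubmem : ∀ ε > 0, ∃ N, ∀ m ≥ N, u m - v ∈ neumannSubmodule h0 h1 ∧
      limitEnergy (u m - v) (u m - v) ≤ ε := fun ε hε => by
    obtain ⟨N, hN⟩ := hsub ε hε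
    refine ⟨N, fun m hm => ?_⟩
    have h2 : u m - v ∈ neumannSubmodule h0 h1 :=
      (mem_neumannDomain_iff h0 h1).2 ⟨hmem m, ε, hN m hm⟩
    exact ⟨h2, limitEnergy_le h0 h1 h2 (hN m hm)⟩
  have hv : v ∈ neumannSubmodule h0 h1 := by
    obtain ⟨N, hN⟩ := hsubmem 1 one_pos
    have := sub_mem (hu N) (hN N le_rfl).1
    rwa [sub_sub_cancel] at this
  refine ⟨hv, Metric.tendsto_atTop.2 fun ε hε => ?_⟩
  obtain ⟨N, hN⟩ := hsubmem (ε / 2) (by positivity)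
  refine ⟨N, fun m hm => ?_⟩
  have h2 := limitEnergy_self_nonneg h0 h1 (sub_mem (hu m) hv)
  rw [Real.dist_eq, sub_zero, abs_of_nonneg h2]
  linarith [(hN m hm).2]

/-- Sets of functions bounded in energy and in supremum norm are relatively compact. -/
theorem isCompact_closure_energy_le [CompactSpace (hanoiAttractor α)] (M R : ℝ) :
    IsCompact (closure {u : C(hanoiAttractor α, ℝ) | u ∈ neumannSubmodule h0 h1 ∧
      limitEnergy u u ≤ M ∧ ‖u‖ ≤ R}) := by
  rcases lt_or_ge M 0 with hM | hM
  · have : {u : C(hanoiAttractor α, ℝ) | u ∈ neumannSubmodule h0 h1 ∧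
        limitEnergy u u ≤ M ∧ ‖u‖ ≤ R} = ∅ := by
      refine eq_empty_of_forall_notMem fun u hu => ?_
      linarith [limitEnergy_self_nonneg h0 h1 hu.1, hu.2.1]
    rw [this, closure_empty]
    exact isCompact_empty
  -- Arzelà–Ascoli is applied to bounded continuous functions and the result carried back along this
  -- isometry.
  let e := ContinuousMap.isometryEquivBoundedOfCompact (hanoiAttractor α) ℝ
  set A := {u : C(hanoiAttractor α, ℝ) | u ∈ neumannSubmodule h0 h1 ∧
      limitEnergy u u ≤ M ∧ ‖u‖ ≤ R}
  have hA : IsCompact (closure (e '' A)) := by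
    refine BoundedContinuousFunction.arzela_ascoli (Metric.closedBall 0 R)
      (isCompact_closedBall 0 R) _ ?_ ?_
    · rintro _ x ⟨u, hu, rfl⟩
      rw [mem_closedBall_zero_iff]
      exact (u.norm_coe_le_norm x).trans hu.2.2
    · intro x
      rw [Metric.equicontinuousAt_iff]
      intro ε hε
      have h2 := exists_equicontinuity h0 h1 hM (x : Plane) (half_pos hε)
      obtain ⟨δ, hδ, h3⟩ := Metric.eventually_nhds_iff.1 h2
      refine ⟨δ, hδ, fun y hy => ?_⟩
      rintro ⟨_, u, hu, rfl⟩
      have h4 := h3 hy y.2 _ hu.1.1 (continuousOn_extendZero u)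
        fun n => (levelEnergy_le h0 h1 hu.1 n).trans hu.2.1
      rw [extendZero_apply x.2, extendZero_apply y.2] at h4
      rw [Real.dist_eq]
      exact h4.trans_lt (half_lt_self hε)
  have h2 := hA.image e.symm.continuous
  have h3 : e.symm '' closure (e '' A) = closure A :=
    (e.symm.toHomeomorph.image_closure _).trans
      (congrArg closure (e.toEquiv.symm_image_image A))
  rwa [h3] at h2

end EnergyForm

/-! ### The operator of the energy form for a general measure. -/

section Operator

variable {α : ℝ} (h0 : 0 < α) (h1 : α < 1 / 3) [CompactSpace (hanoiAttractor α)]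
  (μ : Measure (hanoiAttractor α)) [IsFiniteMeasure μ] [μ.IsOpenPosMeasure]

/-- The supremum norm is controlled by energy and `L²` norm. -/
theorem exists_norm_sq_le : ∃ A > 0, ∀ u ∈ neumannSubmodule h0 h1,
    ‖u‖ ^ 2 ≤ A * (limitEnergy u u + ‖ContinuousMap.toLp 2 μ ℝ u‖ ^ 2) := by
  have : Nonempty (hanoiAttractor α) := ⟨⟨_, corner_mem_hanoiAttractor h0 h1 0⟩⟩
  have hm : 0 < μ.real univ := by
    rw [measureReal_def, ENNReal.toReal_pos_iff]
    exact ⟨isOpen_univ.measure_pos μ univ_nonempty, measure_lt_top _ _⟩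
  refine ⟨1800 + 2 / μ.real univ, by positivity, fun u hu => ?_⟩
  have hE := limitEnergy_self_nonneg h0 h1 hu
  set E := limitEnergy u u
  have hint : ∫ x, u x ^ 2 ∂μ = ‖ContinuousMap.toLp 2 μ ℝ u‖ ^ 2 := by
    rw [← real_inner_self_eq_norm_sq, L2.inner_def]
    refine integral_congr_ae ?_
    filter_upwards [ContinuousMap.coeFn_toLp (p := 2) (𝕜 := ℝ) μ u] with x hx
    rw [hx]
    simp [pow_two]
  have hi : Integrable (fun x => u x ^ 2) μ :=
    (by fun_prop : Continuous fun x => u x ^ 2).integrable_of_hasCompactSupport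
      (HasCompactSupport.of_compactSpace _)
  have hx : ∀ x, u x ^ 2 ≤ (1800 + 2 / μ.real univ) *
      (E + ‖ContinuousMap.toLp 2 μ ℝ u‖ ^ 2) := by
    intro x
    -- From a² ≤ 2b² + 2(a − b)² and the oscillation bound 30√E, whence 1800 = 2·30². Integrating
    -- over y replaces u(y)² by the L² norm.
    have h2 : ∀ y, u x ^ 2 ≤ 2 * u y ^ 2 + 1800 * E := fun y => by
      have h3 := abs_sub_le_limitEnergy h0 h1 hu x y
      have h4 : (u x - u y) ^ 2 ≤ 900 * E := by
        rw [← sq_abs]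
        refine (pow_le_pow_left₀ (abs_nonneg _) h3 2).trans ?_
        rw [mul_pow, Real.sq_sqrt hE]
        norm_num
      nlinarith [sq_nonneg (u x - 2 * u y)]
    have h5 := integral_mono (μ := μ) (integrable_const (u x ^ 2))
      ((hi.const_mul 2).add (integrable_const (1800 * E))) h2
    simp only [Pi.add_apply] at h5
    rw [integral_const, integral_add (hi.const_mul 2) (integrable_const _), integral_const_mul,
      integral_const, hint, smul_eq_mul, smul_eq_mul] at h5
    have h6 : u x ^ 2 ≤ (2 * ‖ContinuousMap.toLp 2 μ ℝ u‖ ^ 2 + μ.real univ * (1800 * E)) /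
        μ.real univ := by
      rw [le_div_iff₀ hm]; linarith
    refine h6.trans ?_
    rw [div_le_iff₀ hm]
    have e : (1800 + 2 / μ.real univ) * (E + ‖ContinuousMap.toLp 2 μ ℝ u‖ ^ 2) * μ.real univ =
        (2 * ‖ContinuousMap.toLp 2 μ ℝ u‖ ^ 2 + μ.real univ * (1800 * E)) +
        (2 * E + 1800 * μ.real univ * ‖ContinuousMap.toLp 2 μ ℝ u‖ ^ 2) := by
      field_simp
      ring
    rw [e]
    exact le_add_of_nonneg_right (by positivity)
  have h2 : ‖u‖ ≤ √((1800 + 2 / μ.real univ) * (E + ‖ContinuousMap.toLp 2 μ ℝ u‖ ^ 2)) := by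
    rw [ContinuousMap.norm_le _ (Real.sqrt_nonneg _)]
    exact fun x => Real.abs_le_sqrt (hx x)
  calc ‖u‖ ^ 2 ≤ _ := pow_le_pow_left₀ (norm_nonneg _) h2 2
    _ = _ := Real.sq_sqrt (by positivity)

/-- The operator associated with the energy on a closed dense subspace of the energy domain. -/
theorem exists_operator_of_energy (p : Submodule ℝ C(hanoiAttractor α, ℝ))
    (hp : p ≤ neumannSubmodule h0 h1)
    (hclosed : ∀ (u : ℕ → C(hanoiAttractor α, ℝ)) (v : C(hanoiAttractor α, ℝ)), (∀ n, u n ∈ p) →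
      Tendsto u atTop (𝓝 v) → v ∈ neumannSubmodule h0 h1 → v ∈ p)
    (hdense : DenseRange fun u : p => ContinuousMap.toLp 2 μ ℝ (u : C(hanoiAttractor α, ℝ)))
    (hinf : ¬ FiniteDimensional ℝ (Lp ℝ 2 μ)) :
    ∃ T : Lp ℝ 2 μ →ₗ.[ℝ] Lp ℝ 2 μ, Dense (T.domain : Set (Lp ℝ 2 μ)) ∧ IsSelfAdjoint T ∧
      (∀ f : T.domain, 0 ≤ inner ℝ (T f) (f : Lp ℝ 2 μ)) ∧
      (∀ f : T.domain, ∃ u ∈ p, ContinuousMap.toLp 2 μ ℝ u = f ∧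
        ∀ v ∈ p, HasEnergy α u v (inner ℝ (T f) (ContinuousMap.toLp 2 μ ℝ v))) ∧
      HasDiscreteSpectrum T ∧
      ∀ T' : Lp ℝ 2 μ →ₗ.[ℝ] Lp ℝ 2 μ, IsSelfAdjoint T' →
        (∀ f : T'.domain, ∃ u ∈ p, ContinuousMap.toLp 2 μ ℝ u = f ∧
          ∀ v ∈ p, HasEnergy α u v (inner ℝ (T' f) (ContinuousMap.toLp 2 μ ℝ v))) → T' = T := by
  let J : C(hanoiAttractor α, ℝ) →L[ℝ] Lp ℝ 2 μ := ContinuousMap.toLp 2 μ ℝ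
  obtain ⟨A, hA0, hA⟩ := exists_norm_sq_le h0 h1 μ
  have hcomplete : ∀ u : ℕ → p, (∀ ε > 0, ∃ N, ∀ m ≥ N, ∀ n ≥ N,
      energyForm h0 h1 p hp (u m - u n) (u m - u n) + ‖J (u m - u n : p)‖ ^ 2 < ε) →
      ∃ v, Tendsto (fun n => energyForm h0 h1 p hp (u n - v) (u n - v) + ‖J (u n - v : p)‖ ^ 2)
        atTop (𝓝 0) := by
    intro u hu
    change ∀ ε > 0, ∃ N, ∀ m ≥ N, ∀ n ≥ N, limitEnergy (u m - u n : C(hanoiAttractor α, ℝ))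
      (u m - u n : C(hanoiAttractor α, ℝ)) + ‖J (u m - u n : C(hanoiAttractor α, ℝ))‖ ^ 2 < ε at hu
    have hmem : ∀ m n, (u m - u n : C(hanoiAttractor α, ℝ)) ∈ neumannSubmodule h0 h1 :=
      fun m n => sub_mem (hp (u m).2) (hp (u n).2)
    -- Control of the supremum norm turns a form-Cauchy sequence into a uniformly Cauchy one, so the
    -- limit exists as a continuous function.
    have hc : CauchySeq fun n => (u n : C(hanoiAttractor α, ℝ)) := by
      refine Metric.cauchySeq_iff.2 fun ε hε => ?_
      obtain ⟨N, hN⟩ := hu (ε ^ 2 / A) (by positivity)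
      refine ⟨N, fun m hm n hn => ?_⟩
      have h2 := hN m hm n hn
      rw [lt_div_iff₀' hA0] at h2
      rw [dist_eq_norm]
      exact lt_of_pow_lt_pow_left₀ 2 hε.le ((hA _ (hmem m n)).trans_lt h2)
    obtain ⟨v, hv⟩ := cauchySeq_tendsto_of_complete hc
    obtain ⟨hvD, hlim⟩ := mem_neumannSubmodule_of_tendsto h0 h1 (fun n => hp (u n).2) hv
      fun ε hε => (hu ε hε).imp fun N hN m hm n hn =>
        (le_add_of_nonneg_right (by positivity)).trans_lt (hN m hm n hn)
    refine ⟨⟨v, hclosed _ v (fun n => (u n).2) hv hvD⟩, ?_⟩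
    have h2 : Tendsto (fun n => ‖J (u n - v : C(hanoiAttractor α, ℝ))‖ ^ 2) atTop (𝓝 0) := by
      have h3 := (J.continuous.tendsto _).comp (tendsto_sub_nhds_zero_iff.2 hv)
      rw [map_zero] at h3
      simpa using h3.norm.pow 2
    have := hlim.add h2
    rw [add_zero] at this
    exact this
  have hcompact : IsCompact (closure (((J : C(hanoiAttractor α, ℝ) →ₗ[ℝ] Lp ℝ 2 μ) ∘ₗ p.subtype) ''
      {u | energyForm h0 h1 p hp u u ≤ 1 ∧ ‖J u‖ ≤ 1})) := by
    have hc := (isCompact_closure_energy_le h0 h1 1 (√(A * 2))).image J.continuous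
    refine hc.of_isClosed_subset isClosed_closure (closure_minimal ?_ hc.isClosed)
    rintro _ ⟨u, ⟨hu1, hu2⟩, rfl⟩
    refine ⟨u, subset_closure ⟨hp u.2, hu1, ?_⟩, rfl⟩
    refine Real.le_sqrt_of_sq_le ((hA _ (hp u.2)).trans ?_)
    have hu1 : limitEnergy (u : C(hanoiAttractor α, ℝ)) u ≤ 1 := hu1
    have hu2 : ‖ContinuousMap.toLp 2 μ ℝ (u : C(hanoiAttractor α, ℝ))‖ ≤ 1 := hu2
    have h3 := norm_nonneg (ContinuousMap.toLp 2 μ ℝ (u : C(hanoiAttractor α, ℝ)))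
    exact mul_le_mul_of_nonneg_left (by nlinarith) hA0.le
  obtain ⟨T, t1, t2, t3, t4, t5, t6⟩ := exists_operator_of_form
    ((J : C(hanoiAttractor α, ℝ) →ₗ[ℝ] Lp ℝ 2 μ) ∘ₗ p.subtype) (energyForm h0 h1 p hp)
    (fun u v => limitEnergy_comm _ _) (fun u => limitEnergy_self_nonneg h0 h1 (hp u.2))
    ((ContinuousMap.toLp_injective μ).comp Subtype.val_injective) hdense hcomplete hcompact hinf
  refine ⟨T, t1, t2, t3, fun f => ?_, t5, fun T' h2 h3 => t6 T' h2 fun f => ?_⟩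
  · obtain ⟨u, hu, huv⟩ := t4 f
    refine ⟨u, u.2, hu, fun v hv => ?_⟩
    have h2 := huv ⟨v, hv⟩
    rw [energyForm_apply] at h2
    have h3 := hasEnergy_limitEnergy h0 h1 (hp u.2) (hp hv)
    rw [h2] at h3
    exact h3
  · obtain ⟨u, hu, hu', huv⟩ := h3 f
    exact ⟨⟨u, hu⟩, hu', fun v =>
      (hasEnergy_limitEnergy h0 h1 (hp hu) (hp v.2)).unique (huv v v.2)⟩

end Operator

/-! ### Density of the energy domains in L². -/

section Density

variable {α : ℝ}

theorem wordMap_split (n k : ℕ) (v : Fin (n + k) → Fin 3) :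
    ∃ (w : Fin n → Fin 3) (v' : Fin k → Fin 3), ∀ x,
      wordMap α (n + k) v x = wordMap α n w (wordMap α k v' x) := by
  induction k with
  | zero => exact ⟨v, Fin.elim0, fun x => rfl⟩
  | succ k ih =>
    obtain ⟨w, v', h⟩ := ih (Fin.init v)
    refine ⟨w, Fin.snoc v' (v (Fin.last _)), fun x => ?_⟩
    rw [wordMap_snoc, ← h, ← wordMap_snoc]
    congr 1
    exact (Fin.snoc_init_self v).symm

/-- Lipschitz functions that are constant on all cells of some level have finite energy. -/
theorem mem_neumannSubmodule_of_lipschitz (h0 : 0 < α) (h1 : α < 1 / 3)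
    {u : C(hanoiAttractor α, ℝ)} {f : Plane → ℝ} {L : ℝ≥0} (hf : LipschitzWith L f)
    (huf : ∀ x, u x = f x) (n : ℕ)
    (hconst : ∀ w : Fin n → Fin 3, ∃ c, ∀ x ∈ hanoiAttractor α, f (wordMap α n w x) = c) :
    u ∈ neumannSubmodule h0 h1 := by
  have hu : ∀ x ∈ hanoiAttractor α, extendZero α u x = f x := fun x hx => by
    rw [extendZero_apply hx, huf]
  have hH : WireH1 α (extendZero α u) := fun e => by
    have hl : LipschitzWith ⟨wireLength α e.1, (wireLength_pos h0 h1 _).le⟩ (e.param α) :=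
      LipschitzWith.of_dist_le_mul fun s t => by
        rw [dist_wire_param h0 h1, Real.dist_eq]
        rfl
    refine isH1_of_lipschitzOn (K := L * ⟨wireLength α e.1, (wireLength_pos h0 h1 _).le⟩) ?_
    intro s hs t ht
    rw [Function.comp_apply, Function.comp_apply, hu _ (wire_param_mem_hanoiAttractor h0 h1 e hs),
      hu _ (wire_param_mem_hanoiAttractor h0 h1 e ht)]
    exact (hf.comp hl) s t
  have hcell : ∀ m ≥ n, ∀ v : Fin m → Fin 3, ∃ c, ∀ x ∈ hanoiAttractor α,
      extendZero α u (wordMap α m v x) = c := by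
    intro m hm v
    obtain ⟨k, rfl⟩ := Nat.exists_eq_add_of_le hm
    obtain ⟨w, v', h⟩ := wordMap_split (α := α) n k v
    obtain ⟨c, hc⟩ := hconst w
    refine ⟨c, fun x hx => ?_⟩
    rw [hu _ (wordMap_mem_hanoiAttractor h0 h1 _ _ hx), h]
    exact hc _ (wordMap_mem_hanoiAttractor h0 h1 _ _ hx)
  -- Cells of level m ≥ n and wires inside them lie in cells where u is constant, so the energy is
  -- stationary from level n on.
  have hd : ∀ m ≥ n, discreteEnergy α m (extendZero α u) (extendZero α u) = 0 := fun m hm =>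
    Finset.sum_eq_zero fun v _ => Finset.sum_eq_zero fun i _ => by
      obtain ⟨c, hc⟩ := hcell m hm v
      rw [hc _ (corner_mem_hanoiAttractor h0 h1 i), hc _ (corner_mem_hanoiAttractor h0 h1 _)]
      ring
  have hw : ∀ k ≥ n, wireEnergy α k (extendZero α u) (extendZero α u) = 0 := fun k hk => by
    rw [wireEnergy_eq]
    refine Finset.sum_eq_zero fun ⟨v, i⟩ _ => ?_
    obtain ⟨c, hc⟩ := hcell k hk v
    refine dirichletForm_eq_zero_of_const (c := c) (fun t ht => ?_) _
    rw [Function.comp_apply, wire_param_eq]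
    exact hc _ (baseWire_mem_hanoiAttractor h0 h1 i ht)
  refine (mem_neumannDomain_iff h0 h1).2 ⟨hH, levelEnergy n u, fun m => ?_⟩
  rcases le_total m n with h | h
  · exact energyAt_mono h0 h1 hH h
  · rw [levelEnergy, levelEnergy, energyAt, energyAt, hd m h, hd n le_rfl,
      ← Finset.sum_subset (Finset.range_mono h)]
    · rw [mul_zero, mul_zero]
    · intro k _ hk
      rw [hw k (by simpa using hk), mul_zero]

theorem const_mem_neumannSubmodule (h0 : 0 < α) (h1 : α < 1 / 3) (c : ℝ) :
    ContinuousMap.const _ c ∈ neumannSubmodule h0 h1 :=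
  mem_neumannSubmodule_of_lipschitz h0 h1 (LipschitzWith.const c) (fun _ => rfl) 0
    fun _ => ⟨c, fun _ _ => rfl⟩

/-- The energy domain is stable under Lipschitz functions vanishing at zero. -/
theorem lipschitz_comp_mem_neumannSubmodule (h0 : 0 < α) (h1 : α < 1 / 3)
    {u : C(hanoiAttractor α, ℝ)} (hu : u ∈ neumannSubmodule h0 h1) {φ : C(ℝ, ℝ)} {L : ℝ≥0}
    (hφ : LipschitzWith L φ) (hφ0 : φ 0 = 0) : φ.comp u ∈ neumannSubmodule h0 h1 := by
  -- Composition commutes with extension by zero because φ 0 = 0.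
  have he : extendZero α (φ.comp u) = φ ∘ extendZero α u := by
    ext x
    by_cases hx : x ∈ hanoiAttractor α <;> simp [extendZero, hx, hφ0]
  obtain ⟨hH, M, hM⟩ := (mem_neumannDomain_iff h0 h1).1 hu
  refine (mem_neumannDomain_iff h0 h1).2 ⟨?_, L ^ 2 * M, fun n => ?_⟩
  · rw [he]
    exact fun e => ((hH e).lipschitz_comp hφ).1
  · refine le_trans ?_ (mul_le_mul_of_nonneg_left (hM n) (by positivity))
    rw [levelEnergy, he, levelEnergy, energyAt, energyAt, mul_add, Finset.mul_sum]
    refine add_le_add ?_ (Finset.sum_le_sum fun k _ => ?_)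
    · rw [mul_left_comm]
      refine mul_le_mul_of_nonneg_left ?_ (inv_nonneg.2 (rhoD_pos h0 h1 n).le)
      rw [discreteEnergy, discreteEnergy, Finset.mul_sum]
      refine Finset.sum_le_sum fun w _ => ?_
      rw [Finset.mul_sum]
      refine Finset.sum_le_sum fun i _ => ?_
      rw [← pow_two, ← pow_two, ← mul_pow]
      refine sq_le_sq.2 ?_
      rw [abs_mul, NNReal.abs_eq]
      simpa [Real.dist_eq] using hφ.dist_le_mul (extendZero α u (wordMap α n w (corner i)))
        (extendZero α u (wordMap α n w (corner (i + 1))))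
    · rw [mul_left_comm]
      refine mul_le_mul_of_nonneg_left ?_ (inv_nonneg.2 (rhoC_pos h0 h1 k).le)
      rw [wireEnergy_eq, wireEnergy_eq, Finset.mul_sum]
      exact Finset.sum_le_sum fun e _ => ((hH ⟨k, e⟩).lipschitz_comp hφ).2

/-- The energy domain separates the points of the attractor. -/
theorem exists_separating (h0 : 0 < α) (h1 : α < 1 / 3) {x y : hanoiAttractor α} (hxy : x ≠ y) :
    ∃ u ∈ neumannSubmodule h0 h1, u x ≠ u y := by
  have hK := (hanoiAttractor_spec h0 h1).1.1
  have hs : 0 ≤ (1 - α) / 2 := by linarith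
  obtain ⟨B, hB⟩ := Metric.isBounded_iff.1 hK.isBounded
  -- At this level the cells are too small to contain both x and y.
  obtain ⟨n, hn⟩ : ∃ n : ℕ, ((1 - α) / 2) ^ n * B < dist x y := by
    have hlim : Tendsto (fun m : ℕ => ((1 - α) / 2) ^ m * B) atTop (𝓝 (0 * B)) :=
      (tendsto_pow_atTop_nhds_zero_of_lt_one hs (by linarith)).mul_const B
    rw [zero_mul] at hlim
    exact (hlim.eventually (gt_mem_nhds (dist_pos.2 hxy))).exists
  let cell : (Fin n → Fin 3) → Set Plane := fun w => wordMap α n w '' hanoiAttractor α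
  have hcell : ∀ w, IsCompact (cell w) := fun w => hK.image (continuous_wordMap n w)
  -- S gathers x with the cells through x, and S' gathers y with all other cells. They are disjoint
  -- compact sets that together contain every cell of level n.
  let S : Set Plane := {(x : Plane)} ∪ ⋃ w ∈ {w | (x : Plane) ∈ cell w}, cell w
  let S' : Set Plane := {(y : Plane)} ∪ ⋃ w ∈ {w | (x : Plane) ∉ cell w}, cell w
  have hS : IsCompact S :=
    isCompact_singleton.union ((toFinite _).isCompact_biUnion fun w _ => hcell w)
  have hS' : IsCompact S' :=
    isCompact_singleton.union ((toFinite _).isCompact_biUnion fun w _ => hcell w)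
  have hSne : S.Nonempty := ⟨x, Or.inl rfl⟩
  have hyS : ∀ w, (x : Plane) ∈ cell w → (y : Plane) ∉ cell w := by
    rintro w ⟨a, ha, hax⟩ ⟨b, hb, hby⟩
    refine hn.not_ge ?_
    rw [Subtype.dist_eq, ← hax, ← hby, dist_wordMap h1]
    exact mul_le_mul_of_nonneg_left (hB ha hb) (by positivity)
  have hdisj : ∀ z ∈ S', z ∉ S := by
    rintro z (rfl | hz) (hz' | hz')
    · exact hxy (Subtype.ext hz'.symm)
    · obtain ⟨w, hw, hzw⟩ := mem_iUnion₂.1 hz'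
      exact hyS w hw hzw
    · obtain ⟨w, hw, hzw⟩ := mem_iUnion₂.1 hz
      rw [mem_singleton_iff.1 hz'] at hzw
      exact hw hzw
    · obtain ⟨w, hw, a, ha, haz⟩ := mem_iUnion₂.1 hz
      obtain ⟨v, hv, b, hb, hbz⟩ := mem_iUnion₂.1 hz'
      have := wordMap_cell_disjoint h0 h1 n ha hb (haz.trans hbz.symm)
      subst this
      exact hw hv
  obtain ⟨m, hm, hmin⟩ := hS'.exists_isMinOn ⟨y, Or.inl rfl⟩
    (Metric.continuous_infDist_pt S).continuousOn
  set ε := Metric.infDist m S with hε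
  have hε0 : 0 < ε := (hS.isClosed.notMem_iff_infDist_pos hSne).1 (hdisj m hm)
  -- Cutting the distance to S at its minimum ε over S' gives 0 on S and ε on S', so f is constant
  -- on each cell and separates x from y.
  let f : Plane → ℝ := fun z => min (Metric.infDist z S) ε
  have hf : LipschitzWith 1 f := (Metric.lipschitz_infDist_pt S).min_const ε
  have hfS : ∀ z ∈ S, f z = 0 := fun z hz => by
    simp only [f]
    rw [Metric.infDist_zero_of_mem hz, min_eq_left hε0.le]
  have hfS' : ∀ z ∈ S', f z = ε := fun z hz => min_eq_right (hmin hz)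
  refine ⟨⟨fun z => f z, hf.continuous.comp continuous_subtype_val⟩,
    mem_neumannSubmodule_of_lipschitz h0 h1 hf (fun _ => rfl) n fun w => ?_, ?_⟩
  · by_cases hw : (x : Plane) ∈ cell w
    · exact ⟨0, fun z hz => hfS _ (Or.inr (mem_iUnion₂.2 ⟨w, hw, z, hz, rfl⟩))⟩
    · exact ⟨ε, fun z hz => hfS' _ (Or.inr (mem_iUnion₂.2 ⟨w, hw, z, hz, rfl⟩))⟩
  · change f x ≠ f y
    rw [hfS x (Or.inl rfl), hfS' y (Or.inl rfl)]
    exact hε0.ne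

/-- The energy domain with Dirichlet boundary conditions as a space of functions. -/
def dirichletSubmodule (h0 : 0 < α) (h1 : α < 1 / 3) : Submodule ℝ C(hanoiAttractor α, ℝ) where
  carrier := dirichletDomain α
  add_mem' {u v} hu hv := ⟨add_mem (S := Submodule ℝ C(hanoiAttractor α, ℝ))
    (s := neumannSubmodule h0 h1) hu.1 hv.1, fun i => by
      rw [extendZero_add, Pi.add_apply, hu.2, hv.2, add_zero]⟩
  zero_mem' := ⟨zero_mem (neumannSubmodule h0 h1), fun i => by
    rw [extendZero_apply (corner_mem_hanoiAttractor h0 h1 i)]; rfl⟩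
  smul_mem' c u hu := ⟨Submodule.smul_mem (neumannSubmodule h0 h1) c hu.1, fun i => by
    rw [extendZero_smul, Pi.smul_apply, hu.2, smul_zero]⟩

theorem mem_dirichletSubmodule_iff (h0 : 0 < α) (h1 : α < 1 / 3) {u : C(hanoiAttractor α, ℝ)} :
    u ∈ dirichletSubmodule h0 h1 ↔ u ∈ neumannSubmodule h0 h1 ∧
      ∀ i, u ⟨corner i, corner_mem_hanoiAttractor h0 h1 i⟩ = 0 := by
  refine and_congr_right fun _ => forall_congr' fun i => ?_
  rw [extendZero_apply (corner_mem_hanoiAttractor h0 h1 i)]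

/-- Polynomials in `edgeParam 0`, which takes every value in [0, 1] on K, embed into the continuous
functions. -/
theorem infinite_dimensional_continuousMap (h0 : 0 < α) (h1 : α < 1 / 3) :
    ¬ FiniteDimensional ℝ C(hanoiAttractor α, ℝ) := by
  intro _
  let f : C(hanoiAttractor α, ℝ) :=
    ⟨fun x => edgeParam 0 x, (continuous_edgeParam 0).comp continuous_subtype_val⟩
  have hinj : Function.Injective (Polynomial.aeval f : Polynomial ℝ →ₐ[ℝ] C(hanoiAttractor α, ℝ)) := by
    refine (injective_iff_map_eq_zero _).2 fun p hp => ?_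
    refine Polynomial.eq_zero_of_infinite_isRoot p ((Icc_infinite zero_lt_one).mono fun t ht => ?_)
    obtain ⟨x, hx, rfl⟩ := Icc_subset_edgeParam_image h0 h1 0 ht
    have := congrArg (fun g : C(hanoiAttractor α, ℝ) => g ⟨x, hx⟩) hp
    simp only [Polynomial.aeval_continuousMap_apply] at this
    simpa [Polynomial.IsRoot, f] using this
  exact Polynomial.not_finite (Module.Finite.of_injective
    (Polynomial.aeval f : Polynomial ℝ →ₐ[ℝ] C(hanoiAttractor α, ℝ)).toLinearMap hinj)

variable [CompactSpace (hanoiAttractor α)]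

/-- The energy domain is uniformly dense in the continuous functions. -/
theorem dense_neumannSubmodule (h0 : 0 < α) (h1 : α < 1 / 3) :
    Dense (neumannSubmodule h0 h1 : Set C(hanoiAttractor α, ℝ)) := by
  have habs : ∀ u ∈ neumannSubmodule h0 h1, |u| ∈ neumannSubmodule h0 h1 := fun u hu => by
    have := lipschitz_comp_mem_neumannSubmodule h0 h1 hu (φ := ⟨fun t => |t|, continuous_abs⟩)
      (L := 1) (LipschitzWith.of_dist_le_mul fun a b => by
        simpa [Real.dist_eq] using abs_abs_sub_abs_le a b) (by simp)
    have he : |u| = (⟨fun t => |t|, continuous_abs⟩ : C(ℝ, ℝ)).comp u := by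
      ext x
      simp
    rwa [he]
  have h2 : closure (neumannSubmodule h0 h1 : Set C(hanoiAttractor α, ℝ)) = ⊤ := by
    -- Stability under absolute values gives minima and maxima. It remains to match prescribed
    -- values at two points, by an affine change of a separating function.
    refine ContinuousMap.sublattice_closure_eq_top _ ⟨0, zero_mem _⟩ ?_ ?_ ?_
    · intro f hf g hg
      rw [inf_eq_half_smul_add_sub_abs_sub' ℝ]
      exact Submodule.smul_mem _ _ (sub_mem (add_mem hf hg) (habs _ (sub_mem hg hf)))
    · intro f hf g hg
      rw [sup_eq_half_smul_add_add_abs_sub' ℝ]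
      exact Submodule.smul_mem _ _ (add_mem (add_mem hf hg) (habs _ (sub_mem hg hf)))
    · intro v x y
      by_cases hxy : x = y
      · subst hxy
        exact ⟨_, const_mem_neumannSubmodule h0 h1 (v x), rfl, rfl⟩
      · obtain ⟨u, hu, hne⟩ := exists_separating h0 h1 hxy
        have hne' : u y - u x ≠ 0 := sub_ne_zero.2 hne.symm
        refine ⟨((v y - v x) / (u y - u x)) • (u - ContinuousMap.const _ (u x)) +
          ContinuousMap.const _ (v x), add_mem (Submodule.smul_mem _ _ (sub_mem hu
            (const_mem_neumannSubmodule h0 h1 _))) (const_mem_neumannSubmodule h0 h1 _), ?_, ?_⟩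
        · simp
        · simp [div_mul_cancel₀ _ hne']
  exact dense_iff_closure_eq.2 h2

/-- The energy domain with Dirichlet conditions is uniformly dense in the continuous functions that
vanish at the corners. -/
theorem mem_closure_dirichletSubmodule (h0 : 0 < α) (h1 : α < 1 / 3) {v : C(hanoiAttractor α, ℝ)}
    (hv : ∀ i, v ⟨corner i, corner_mem_hanoiAttractor h0 h1 i⟩ = 0) :
    v ∈ closure (dirichletSubmodule h0 h1 : Set C(hanoiAttractor α, ℝ)) := by
  refine Metric.mem_closure_iff.2 fun ε hε => ?_
  obtain ⟨u, hu, huv⟩ := Metric.mem_closure_iff.1 (dense_neumannSubmodule h0 h1 v) (ε / 3)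
    (by positivity)
  -- Soft thresholding: φ kills values of size at most ε/3 and moves every value by at most ε/3. The
  -- approximant u is that small at the corners, so φ ∘ u vanishes there.
  let φ : C(ℝ, ℝ) := ⟨fun t => t - max (-(ε / 3)) (min t (ε / 3)), by fun_prop⟩
  have hφ : LipschitzWith (1 + 1) φ := by
    refine LipschitzWith.sub LipschitzWith.id ?_
    exact (LipschitzWith.id.min_const _).const_max _
  have hφ0 : ∀ t, |t| ≤ ε / 3 → φ t = 0 := fun t ht => by
    rw [abs_le] at ht
    change t - max (-(ε / 3)) (min t (ε / 3)) = 0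
    rw [min_eq_left ht.2, max_eq_right ht.1, sub_self]
  have hφd : ∀ t, |t - φ t| ≤ ε / 3 := fun t => by
    change |t - (t - max (-(ε / 3)) (min t (ε / 3)))| ≤ ε / 3
    rw [sub_sub_cancel, abs_le]
    exact ⟨le_max_left _ _, max_le (by linarith) (min_le_right _ _)⟩
  refine ⟨φ.comp u, (mem_dirichletSubmodule_iff h0 h1).2
    ⟨lipschitz_comp_mem_neumannSubmodule h0 h1 hu hφ (hφ0 0 (by simpa using by positivity)),
      fun i => hφ0 _ ?_⟩, ?_⟩
  · have := (ContinuousMap.dist_apply_le_dist (f := v) (g := u)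
      ⟨corner i, corner_mem_hanoiAttractor h0 h1 i⟩).trans huv.le
    rwa [hv, Real.dist_eq, zero_sub, abs_neg] at this
  · have h2 : dist u (φ.comp u) ≤ ε / 3 :=
      (ContinuousMap.dist_le (by positivity)).2 fun x => by
        rw [Real.dist_eq]
        exact hφd (u x)
    linarith [dist_triangle v u (φ.comp u)]

variable (μ : Measure (hanoiAttractor α)) [IsFiniteMeasure μ]

theorem denseRange_neumann (h0 : 0 < α) (h1 : α < 1 / 3) :
    DenseRange fun u : neumannSubmodule h0 h1 =>
      ContinuousMap.toLp 2 μ ℝ (u : C(hanoiAttractor α, ℝ)) :=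
  (ContinuousMap.toLp_denseRange ℝ μ ℝ (by norm_num)).comp
    (dense_neumannSubmodule h0 h1).denseRange_val (ContinuousLinearMap.continuous _)

theorem norm_toLp_sq (u : C(hanoiAttractor α, ℝ)) :
    ‖ContinuousMap.toLp 2 μ ℝ u‖ ^ 2 = ∫ x, u x ^ 2 ∂μ := by
  rw [← real_inner_self_eq_norm_sq, L2.inner_def]
  refine integral_congr_ae ?_
  filter_upwards [ContinuousMap.coeFn_toLp (p := 2) (𝕜 := ℝ) μ u] with x hx
  rw [hx]
  simp [pow_two]

theorem denseRange_dirichlet (h0 : 0 < α) (h1 : α < 1 / 3)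
    (hμ : ∀ i, μ {⟨corner i, corner_mem_hanoiAttractor h0 h1 i⟩} = 0) :
    DenseRange fun u : dirichletSubmodule h0 h1 =>
      ContinuousMap.toLp 2 μ ℝ (u : C(hanoiAttractor α, ℝ)) := by
  let J : C(hanoiAttractor α, ℝ) →L[ℝ] Lp ℝ 2 μ := ContinuousMap.toLp 2 μ ℝ
  let c : Fin 3 → hanoiAttractor α := fun i => ⟨corner i, corner_mem_hanoiAttractor h0 h1 i⟩
  have hrange : range (fun u : dirichletSubmodule h0 h1 =>
      ContinuousMap.toLp 2 μ ℝ (u : C(hanoiAttractor α, ℝ))) =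
      J '' (dirichletSubmodule h0 h1 : Set C(hanoiAttractor α, ℝ)) := by
    ext g
    simp [J]
  rw [DenseRange, hrange]
  have hvan : ∀ v : C(hanoiAttractor α, ℝ), (∀ i, v (c i) = 0) →
      J v ∈ closure (J '' (dirichletSubmodule h0 h1 : Set C(hanoiAttractor α, ℝ))) := fun v hv =>
    image_closure_subset_closure_image J.continuous
      ⟨v, mem_closure_dirichletSubmodule h0 h1 hv, rfl⟩
  have hall : ∀ v : C(hanoiAttractor α, ℝ),
      J v ∈ closure (J '' (dirichletSubmodule h0 h1 : Set C(hanoiAttractor α, ℝ))) := by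
    intro v
    have hcl : IsClosed (range c) := (finite_range c).isClosed
    have hne : (range c).Nonempty := range_nonempty c
    -- These cutoffs vanish at the corners and tend to 1 off them, hence almost everywhere. So χ n *
    -- v tends to v in L² by dominated convergence.
    let χ : ℕ → C(hanoiAttractor α, ℝ) := fun n =>
      ⟨fun x => min (n * Metric.infDist x (range c)) 1, by fun_prop⟩
    have hχ : ∀ n x, 0 ≤ χ n x ∧ χ n x ≤ 1 := fun n x =>
      ⟨le_min (mul_nonneg n.cast_nonneg Metric.infDist_nonneg) zero_le_one, min_le_right _ _⟩
    have hlim : Tendsto (fun n => ‖J (χ n * v - v)‖ ^ 2) atTop (𝓝 0) := by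
      simp only [J, norm_toLp_sq]
      rw [← integral_zero (hanoiAttractor α) ℝ (μ := μ)]
      refine tendsto_integral_of_dominated_convergence (fun x => ‖v‖ ^ 2)
        (fun n => (by fun_prop : Continuous fun x => (χ n * v - v) x ^ 2).aestronglyMeasurable)
        (integrable_const _) (fun n => Eventually.of_forall fun x => ?_) ?_
      · have h2 : (χ n * v - v) x = (χ n x - 1) * v x := by
          simp [sub_mul]
        rw [h2, norm_pow, norm_mul]
        refine pow_le_pow_left₀ (by positivity) ?_ 2
        refine (mul_le_of_le_one_left (norm_nonneg _) ?_).trans (v.norm_coe_le_norm x)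
        rw [Real.norm_eq_abs, abs_le]
        constructor <;> linarith [(hχ n x).1, (hχ n x).2]
      · have hnull : μ (range c) = 0 := by
          rw [← iUnion_singleton_eq_range]
          exact measure_iUnion_null hμ
        filter_upwards [compl_mem_ae_iff.2 hnull] with x hx
        have hpos := (hcl.notMem_iff_infDist_pos hne).1 hx
        refine tendsto_const_nhds.congr' ?_
        obtain ⟨N, hN⟩ := exists_nat_ge (1 / Metric.infDist x (range c))
        filter_upwards [eventually_ge_atTop N] with n hn
        have h2 : χ n x = 1 := by
          refine min_eq_right ?_
          rw [← div_le_iff₀ hpos]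
          exact hN.trans (by exact_mod_cast hn)
        simp [h2]
    have hlim' : Tendsto (fun n => J (χ n * v)) atTop (𝓝 (J v)) := by
      rw [tendsto_iff_norm_sub_tendsto_zero]
      have := hlim.sqrt
      simpa only [Real.sqrt_sq (norm_nonneg _), Real.sqrt_zero, map_sub] using this
    refine isClosed_closure.mem_of_tendsto hlim' (Eventually.of_forall fun n => hvan _ fun i => ?_)
    have h2 : χ n (c i) = 0 := by
      change min (n * Metric.infDist (c i) (range c)) 1 = 0
      rw [Metric.infDist_zero_of_mem (mem_range_self i)]
      simp
    rw [ContinuousMap.mul_apply, h2, zero_mul]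
  have hd : DenseRange J := ContinuousMap.toLp_denseRange ℝ μ ℝ (by norm_num)
  rw [← dense_closure]
  exact hd.mono (range_subset_iff.2 hall)

theorem infinite_dimensional_L2 (h0 : 0 < α) (h1 : α < 1 / 3) [μ.IsOpenPosMeasure] :
    ¬ FiniteDimensional ℝ (Lp ℝ 2 μ) := fun _ =>
  infinite_dimensional_continuousMap h0 h1 (Module.Finite.of_injective
    (ContinuousMap.toLp 2 μ ℝ : C(hanoiAttractor α, ℝ) →L[ℝ] Lp ℝ 2 μ).toLinearMap
    (ContinuousMap.toLp_injective μ))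

end Density

/-! ### The measure μ: finite, positive on open sets, without atoms. -/

section HanoiMeasure

open Measure

variable {α β : ℝ}

theorem hausdorffMeasure_wire_param_image (h0 : 0 < α) (h1 : α < 1 / 3) (e : Wire) (s : Set ℝ) :
    (hausdorffMeasure 1 : Measure Plane) (e.param α '' s)
      = ENNReal.ofReal (wireLength α e.1) * volume s := by
  have hd : dist (e.left α) (e.right α) = wireLength α e.1 := by
    have := dist_wire_param h0 h1 e 1 0
    simpa [Wire.param] using this
  have := hausdorffMeasure_lineMap_image (e.left α) (e.right α) s
  rw [hausdorffMeasure_real] at this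
  refine this.trans ?_
  rw [← hd, ← edist_dist, edist_nndist]
  rfl

theorem hausdorffMeasure_wire_segment (h0 : 0 < α) (h1 : α < 1 / 3) (e : Wire) :
    (hausdorffMeasure 1 : Measure Plane) (e.segment α)
      = ENNReal.ofReal (wireLength α e.1) := by
  rw [wire_segment_eq, hausdorffMeasure_wire_param_image h0 h1]
  simp

/-- This is the ratio of total wire masses at successive levels: three times as many wires, weight
β, length (1 − α)/2. Writing x = 2/(3(1 − α)), the bound on β makes it less than x, and x < 1
because α < 1/3. -/
theorem weight_ratio_lt_one (h1 : α < 1 / 3)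
    (hβ1 : β < (2 / (3 * (1 - α))) ^ 2) : 3 * (β * ((1 - α) / 2)) < 1 := by
  have hc : 0 < 1 - α := by linarith
  set x := 2 / (3 * (1 - α)) with hx
  have hx1 : x * (3 * (1 - α)) = 2 := div_mul_cancel₀ _ (by positivity)
  nlinarith [mul_lt_mul_of_pos_right hβ1 hc]

theorem rawWireMeasure_univ_lt_top (h0 : 0 < α) (h1 : α < 1 / 3) (hβ0 : 0 < β)
    (hβ1 : β < (2 / (3 * (1 - α))) ^ 2) : rawWireMeasure α β univ < ⊤ := by
  have hq := weight_ratio_lt_one h1 hβ1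
  set q := 3 * (β * ((1 - α) / 2)) with hqdef
  have hq0 : 0 ≤ q := by
    have : 0 < 1 - α := by linarith
    positivity
  have hsum : Summable fun k : ℕ => 3 * α * q ^ k :=
    (summable_geometric_of_lt_one hq0 hq).mul_left _
  rw [rawWireMeasure, sum_apply _ MeasurableSet.univ, ENNReal.tsum_sigma']
  -- The index k carries 3^(k+1) wires, each of weighted length β^k α((1 − α)/2)^k.
  have hterm : ∀ k : ℕ, ∑' b : (Fin k → Fin 3) × Fin 3,
      (ENNReal.ofReal (β ^ (⟨k, b⟩ : Wire).1) •
        (hausdorffMeasure 1 : Measure Plane).restrict (Wire.segment α ⟨k, b⟩)) univ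
      = ENNReal.ofReal (3 * α * q ^ k) := by
    intro k
    have h : ∀ b : (Fin k → Fin 3) × Fin 3,
        (ENNReal.ofReal (β ^ (⟨k, b⟩ : Wire).1) •
          (hausdorffMeasure 1 : Measure Plane).restrict (Wire.segment α ⟨k, b⟩)) univ
        = ENNReal.ofReal (β ^ k * wireLength α k) := by
      intro b
      rw [Measure.smul_apply, restrict_apply_univ, hausdorffMeasure_wire_segment h0 h1,
        smul_eq_mul, ← ENNReal.ofReal_mul (by positivity)]
    rw [tsum_congr h, tsum_fintype, Finset.sum_const, nsmul_eq_mul, ← ENNReal.ofReal_natCast,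
      ← ENNReal.ofReal_mul (by positivity)]
    congr 1
    simp [wireLength, hqdef, mul_pow]
    ring
  rw [tsum_congr hterm, ← ENNReal.ofReal_tsum_of_nonneg (fun k => by positivity) hsum]
  exact ENNReal.ofReal_lt_top

/-- By the conventions of `ℝ≥0∞` this includes a = 0 and a = ⊤, where the product is 0. Finiteness
of μ thus needs no information on the Hausdorff measure of the dust. -/
theorem inv_two_mul_mul_self_lt_top (a : ℝ≥0∞) : (2 * a)⁻¹ * a < ⊤ := by
  rcases eq_or_ne a 0 with rfl | h
  · simp
  rcases eq_or_ne a ⊤ with rfl | h'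
  · simp
  exact ENNReal.mul_lt_top (by simp [h, pos_iff_ne_zero]) h'.lt_top

theorem planeMeasure_univ_lt_top (h0 : 0 < α) (h1 : α < 1 / 3) :
    planeMeasure α β univ < ⊤ := by
  have hF := (hanoiDust_spec h0 h1).1.1.measurableSet
  rw [planeMeasure, Measure.add_apply, restrict_apply_univ, restrict_apply_univ, dustMeasure,
    wireMeasure, Measure.smul_apply, Measure.smul_apply, Measure.restrict_apply hF, inter_self]
  exact ENNReal.add_lt_top.2 ⟨inv_two_mul_mul_self_lt_top _, inv_two_mul_mul_self_lt_top _⟩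

theorem hanoiMeasure_apply (h0 : 0 < α) (h1 : α < 1 / 3) (s : Set (hanoiAttractor α)) :
    hanoiMeasure α β s = planeMeasure α β (Subtype.val '' s) :=
  (MeasurableEmbedding.subtype_coe
    (hanoiAttractor_spec h0 h1).1.1.measurableSet).comap_apply _ _

theorem isFiniteMeasure_hanoiMeasure (h0 : 0 < α) (h1 : α < 1 / 3) :
    IsFiniteMeasure (hanoiMeasure α β) := by
  refine ⟨?_⟩
  rw [hanoiMeasure_apply h0 h1]
  exact (measure_mono (subset_univ _)).trans_lt (planeMeasure_univ_lt_top h0 h1)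

/-- Wires are dense in K, so an open set meets one in a set of positive length. Finite raw mass is
what keeps the normalizing factor of `wireMeasure` from being 0. -/
theorem isOpenPosMeasure_hanoiMeasure (h0 : 0 < α) (h1 : α < 1 / 3) (hβ0 : 0 < β)
    (hβ1 : β < (2 / (3 * (1 - α))) ^ 2) : (hanoiMeasure α β).IsOpenPosMeasure := by
  refine ⟨fun U hU hne hzero => ?_⟩
  obtain ⟨V, hV, rfl⟩ := isOpen_induced_iff.1 hU
  obtain ⟨⟨x, hx⟩, hxV⟩ := hne
  obtain ⟨y, hyV, hyJ⟩ := mem_closure_iff.1 (hanoiAttractor_subset_closure_wires h0 h1 hx) V hV hxV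
  obtain ⟨e, he⟩ := mem_iUnion.1 hyJ
  rw [wire_segment_eq] at he
  obtain ⟨t, ht, rfl⟩ := he
  have hcont : Continuous (e.param α) := AffineMap.lineMap_continuous
  set s : Set ℝ := Ioo 0 1 ∩ e.param α ⁻¹' V with hs
  have hspos : 0 < volume s := (isOpen_Ioo.inter (hV.preimage hcont)).measure_pos _ ⟨t, ht, hyV⟩
  have hsub : e.param α '' s ⊆ Subtype.val '' (Subtype.val ⁻¹' V : Set (hanoiAttractor α)) := by
    rintro _ ⟨r, hr, rfl⟩
    exact ⟨⟨_, wire_param_mem_hanoiAttractor h0 h1 e (Ioo_subset_Icc_self hr.1)⟩, hr.2, rfl⟩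
  have hseg : e.param α '' s ⊆ e.segment α := by
    rw [wire_segment_eq]; exact image_mono inter_subset_left
  have hJ : e.param α '' s ⊆ hanoiWires α := hseg.trans (subset_iUnion (Wire.segment α) e)
  have hpos : 0 < ENNReal.ofReal (β ^ e.1) *
      (hausdorffMeasure 1 : Measure Plane) (e.param α '' s) := by
    rw [hausdorffMeasure_wire_param_image h0 h1]
    exact ENNReal.mul_pos (ENNReal.ofReal_pos.2 (by positivity)).ne'
      (ENNReal.mul_pos (ENNReal.ofReal_pos.2 (wireLength_pos h0 h1 _)).ne' hspos.ne').ne'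
  have hraw : 0 < rawWireMeasure α β (e.param α '' s) := by
    refine hpos.trans_le (le_trans ?_ (le_sum_apply _ _))
    refine le_trans ?_ (ENNReal.le_tsum e)
    rw [Measure.smul_apply, Measure.restrict_eq_self _ hseg, smul_eq_mul]
  have hfin : 2 * rawWireMeasure α β (hanoiWires α) ≠ ⊤ :=
    ENNReal.mul_ne_top (by simp)
      ((measure_mono (subset_univ _)).trans_lt (rawWireMeasure_univ_lt_top h0 h1 hβ0 hβ1)).ne
  have hwire : 0 < (wireMeasure α β).restrict (hanoiWires α) (e.param α '' s) := by
    rw [Measure.restrict_eq_self _ hJ, wireMeasure, Measure.smul_apply, smul_eq_mul]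
    exact ENNReal.mul_pos (ENNReal.inv_ne_zero.2 hfin) hraw.ne'
  rw [hanoiMeasure_apply h0 h1] at hzero
  have h := measure_mono_null hsub hzero
  rw [planeMeasure, Measure.add_apply, add_eq_zero] at h
  exact hwire.ne' h.2

theorem hanoiDim_pos (h0 : 0 < α) (h1 : α < 1 / 3) : 0 < hanoiDim α := by
  refine div_pos (Real.log_pos (by norm_num)) (sub_pos.2 ?_)
  exact Real.log_lt_log (by linarith) (by linarith)

/-- Hausdorff measures of positive dimension have no atoms; this makes the Dirichlet domain dense in
L². -/
theorem hanoiMeasure_singleton (h0 : 0 < α) (h1 : α < 1 / 3) (x : hanoiAttractor α) :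
    hanoiMeasure α β {x} = 0 := by
  have hd := nullSingletonClass_hausdorff Plane (hanoiDim_pos h0 h1)
  have h1' := nullSingletonClass_hausdorff Plane one_pos
  rw [hanoiMeasure_apply h0 h1, image_singleton, planeMeasure, Measure.add_apply, add_eq_zero]
  refine ⟨Measure.restrict_le_self.absolutelyContinuous ?_,
    Measure.restrict_le_self.absolutelyContinuous ?_⟩
  · rw [dustMeasure, Measure.smul_apply,
      Measure.restrict_le_self.absolutelyContinuous (measure_singleton x.1), smul_zero]
  · have : rawWireMeasure α β {x.1} = 0 := by
      rw [rawWireMeasure, sum_apply_eq_zero]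
      intro e
      rw [Measure.smul_apply,
        Measure.restrict_le_self.absolutelyContinuous (measure_singleton x.1), smul_zero]
    rw [wireMeasure, Measure.smul_apply, this, smul_zero]

end HanoiMeasure

/-! ### The Neumann and Dirichlet Laplacians. -/

section Laplacian

variable {α β : ℝ}

/-- `IsNegLaplacian` in terms of the embedding of continuous functions into `L²`. -/
theorem isNegLaplacian_iff [CompactSpace (hanoiAttractor α)] [IsFiniteMeasure (hanoiMeasure α β)]
    {D : Set C(hanoiAttractor α, ℝ)} {T : HanoiL2 α β →ₗ.[ℝ] HanoiL2 α β} :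
    IsNegLaplacian α β D T ↔ Dense (T.domain : Set (HanoiL2 α β)) ∧ IsSelfAdjoint T ∧
      (∀ f : T.domain, 0 ≤ inner ℝ (T f) (f : HanoiL2 α β)) ∧
      ∀ f : T.domain, ∃ u ∈ D, ContinuousMap.toLp 2 (hanoiMeasure α β) ℝ u = (f : HanoiL2 α β) ∧
        ∀ v ∈ D, HasEnergy α u v
          (inner ℝ (T f) (ContinuousMap.toLp 2 (hanoiMeasure α β) ℝ v)) := by
  have hinner : ∀ (g : HanoiL2 α β) (v : C(hanoiAttractor α, ℝ)),
      inner ℝ g (ContinuousMap.toLp 2 (hanoiMeasure α β) ℝ v)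
        = ∫ x, g x * v x ∂hanoiMeasure α β := by
    intro g v
    rw [L2.inner_def]
    refine integral_congr_ae ?_
    filter_upwards [ContinuousMap.coeFn_toLp (p := 2) (𝕜 := ℝ) (hanoiMeasure α β) v] with x hx
    rw [hx]
    simp [mul_comm]
  have hae : ∀ (g : HanoiL2 α β) (u : C(hanoiAttractor α, ℝ)),
      ContinuousMap.toLp 2 (hanoiMeasure α β) ℝ u = g ↔ ⇑g =ᵐ[hanoiMeasure α β] u := by
    intro g u
    have hu := ContinuousMap.coeFn_toLp (p := 2) (𝕜 := ℝ) (hanoiMeasure α β) u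
    refine ⟨fun h => h ▸ hu, fun h => Lp.ext (hu.trans h.symm)⟩
  simp only [hinner, hae]
  exact ⟨fun h => ⟨h.1, h.2, h.3, h.4⟩, fun h => ⟨h.1, h.2.1, h.2.2.1, h.2.2.2⟩⟩

theorem existsUnique_isNegLaplacian (h0 : 0 < α) (h1 : α < 1 / 3)
    [CompactSpace (hanoiAttractor α)] [IsFiniteMeasure (hanoiMeasure α β)]
    [(hanoiMeasure α β).IsOpenPosMeasure] (p : Submodule ℝ C(hanoiAttractor α, ℝ))
    (hp : p ≤ neumannSubmodule h0 h1)
    (hclosed : ∀ (u : ℕ → C(hanoiAttractor α, ℝ)) (v : C(hanoiAttractor α, ℝ)),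
      (∀ n, u n ∈ p) → Tendsto u atTop (𝓝 v) → v ∈ neumannSubmodule h0 h1 → v ∈ p)
    (hdense : DenseRange fun u : p =>
      ContinuousMap.toLp 2 (hanoiMeasure α β) ℝ (u : C(hanoiAttractor α, ℝ))) :
    (∃! T : HanoiL2 α β →ₗ.[ℝ] HanoiL2 α β, IsNegLaplacian α β p T) ∧
      ∀ T : HanoiL2 α β →ₗ.[ℝ] HanoiL2 α β, IsNegLaplacian α β p T → HasDiscreteSpectrum T := by
  obtain ⟨T, hT1, hT2, hT3, hT4, hspec, huniq⟩ := exists_operator_of_energy h0 h1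
    (hanoiMeasure α β) p hp hclosed hdense (infinite_dimensional_L2 _ h0 h1)
  have hun : ∀ T', IsNegLaplacian α β p T' → T' = T := fun T' h =>
    have h := isNegLaplacian_iff.1 h
    huniq T' h.2.1 h.2.2.2
  exact ⟨⟨T, isNegLaplacian_iff.2 ⟨hT1, hT2, hT3, hT4⟩, hun⟩, fun T' h => hun T' h ▸ hspec⟩

end Laplacian

theorem theorem3 (α β : ℝ) (hα0 : 0 < α) (hα1 : α < 1 / 3)
    (hβ0 : 0 < β) (hβ1 : β < (2 / (3 * (1 - α))) ^ 2) :
    ((∃! T : HanoiL2 α β →ₗ.[ℝ] HanoiL2 α β, IsNegLaplacian α β (neumannDomain α) T) ∧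
      ∀ T : HanoiL2 α β →ₗ.[ℝ] HanoiL2 α β,
        IsNegLaplacian α β (neumannDomain α) T → HasDiscreteSpectrum T) ∧
    ((∃! T : HanoiL2 α β →ₗ.[ℝ] HanoiL2 α β, IsNegLaplacian α β (dirichletDomain α) T) ∧
      ∀ T : HanoiL2 α β →ₗ.[ℝ] HanoiL2 α β,
        IsNegLaplacian α β (dirichletDomain α) T → HasDiscreteSpectrum T) := by
  have : CompactSpace (hanoiAttractor α) :=
    isCompact_iff_compactSpace.1 (hanoiAttractor_spec hα0 hα1).1.1
  have : IsFiniteMeasure (hanoiMeasure α β) := isFiniteMeasure_hanoiMeasure hα0 hα1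
  have : (hanoiMeasure α β).IsOpenPosMeasure := isOpenPosMeasure_hanoiMeasure hα0 hα1 hβ0 hβ1
  constructor
  -- The carriers of `neumannSubmodule` and `dirichletSubmodule` are `neumannDomain` and
  -- `dirichletDomain` by definition, so the general statement applies verbatim.
  · exact existsUnique_isNegLaplacian hα0 hα1 (neumannSubmodule hα0 hα1) le_rfl
      (fun _ _ _ _ h => h) (denseRange_neumann _ hα0 hα1)
  · refine existsUnique_isNegLaplacian hα0 hα1 (dirichletSubmodule hα0 hα1)
      (fun u hu => ((mem_dirichletSubmodule_iff hα0 hα1).1 hu).1) (fun u v hu huv hv => ?_)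
      (denseRange_dirichlet _ hα0 hα1 fun i => hanoiMeasure_singleton hα0 hα1 _)
    refine (mem_dirichletSubmodule_iff hα0 hα1).2 ⟨hv, fun i => ?_⟩
    -- Uniform limits preserve the zero values at the corners.
    refine tendsto_nhds_unique (((continuous_eval_const _).tendsto v).comp huv) ?_
    exact tendsto_const_nhds.congr fun n =>
      (((mem_dirichletSubmodule_iff hα0 hα1).1 (hu n)).2 i).symm
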